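/- **Theorem A.** Let $\mathbb T^2=\mathbb R^2/\mathbb Z^2$ carry a smooth Riemannian metric $g=\langle\cdot,\cdot\rangle$ and an orientation, and let $i$ be the rotation of tangent vectors through $\pi/2$ according to the orientation. Let $f\in C^\infty(\mathbb T^2)$ be a real function, $\mathbf e$ a smooth vector field on $\mathbb T^2$, and put $$\lambda(x,v)=f(x)+\langle \mathbf e(x),iv\rangle ,\qquad (x,v)\in S\mathbb T^2,$$ where $S\mathbb T^2$ is the unit circle bundle with projection $\pi:S\mathbb T^2\to\mathbb T^2$. Let $\phi_t$ be the flow on $S\mathbb T^2$ defined by $D_t\dot\gamma=\lambda(\gamma,\dot\gamma)\,i\dot\gamma$, that is, $\phi_t(x,v)=(\gamma(t),\dot\gamma(t))$ for the solution $\gamma$ with $\gamma(0)=x$, $\dot\gamma(0)=v$. For $x\in\mathbb T^2$ let $$\exp^\lambda_x(tv)=\pi(\phi_t(x,v)),\qquad t>0,\ v\in S_x\mathbb T^2 .$$ The thermostat $(\mathbb T^2,g,f,\mathbf e)$ is said to have no conjugate points if, for every $x\in\mathbb T^2$, the map $\exp^\lambda_x:T_x\mathbb T^2\setminus\{0\}\to\mathbb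 T^2$ is a (smooth) local diffeomorphism. Then the thermostat $(\mathbb T^2,g,f,\mathbf e)$ has no conjugate points if and only if $f=0$ and there is $U\in C^\infty(\mathbb T^2)$ such that $\operatorname{div}(\mathbf e+\nabla U)=0$ and the metric $e^{-2U}g$ is flat. (Here $\operatorname{div}$ and $\nabla$ are taken with respect to $g$.) -/

import Mathlib

open scoped ContDiff Manifold Topology Matrix

namespace Thermostat

noncomputable section

/-- The standard 2-torus `𝕋² = ℝ²/ℤ²`. -/
abbrev T2 : Type := UnitAddTorus (Fin 2)

/-- The universal covering map `ℝ² → ℝ²/ℤ²`. It is a local diffeomorphism, and the smooth structure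
of `𝕋²` is the one that it induces. Every tangent space of `𝕋²` is identified with `ℝ²` through
the coordinate vector fields `∂₀, ∂₁`. -/
def proj (x : Fin 2 → ℝ) : T2 := fun i => (x i : UnitAddCircle)

/-- `h ∈ C^∞(𝕋²)`. -/
def Smooth (h : T2 → ℝ) : Prop := ContDiff ℝ ∞ (fun x : Fin 2 → ℝ => h (proj x))

/-- The partial derivative `∂ᵢ h` on `𝕋²`. -/
def pd (i : Fin 2) (h : T2 → ℝ) (p : T2) : ℝ :=
  deriv (fun t : ℝ => h (p + Pi.single i (t : UnitAddCircle))) 0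

/-- A map from `ℝ²` to `𝕋²` is a local (smooth) diffeomorphism at `w`: near `w` it lifts to a local
diffeomorphism of `ℝ²` through the covering map. -/
def IsLocalDiffeoAt (F : (Fin 2 → ℝ) → T2) (w : Fin 2 → ℝ) : Prop :=
  ∃ G : (Fin 2 → ℝ) → (Fin 2 → ℝ),
    IsLocalDiffeomorphAt 𝓘(ℝ, Fin 2 → ℝ) 𝓘(ℝ, Fin 2 → ℝ) ∞ G w ∧
      ∀ᶠ u in 𝓝 w, F u = proj (G u)

/-- A smooth Riemannian metric on `𝕋²`, given by its components `g_{ij} = ⟨∂ᵢ, ∂ⱼ⟩`. -/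
structure Metric where
  /-- the matrix of components at a point -/
  g : T2 → Matrix (Fin 2) (Fin 2) ℝ
  smooth : ∀ i j, Smooth (fun p => g p i j)
  posDef : ∀ p, (g p).PosDef

namespace Metric

variable (m : Metric)

/-- The inner product `⟨v, w⟩` on `T_p 𝕋²`. -/
def inner (p : T2) (v w : Fin 2 → ℝ) : ℝ := v ⬝ᵥ (m.g p *ᵥ w)

/-- The length of a tangent vector. -/
def norm (p : T2) (v : Fin 2 → ℝ) : ℝ := √(m.inner p v v)

/-- The Christoffel symbol `Γ^k_{ij}` of the Levi-Civita connection. -/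
def christoffel (k i j : Fin 2) (p : T2) : ℝ :=
  (1 / 2) * ∑ l, (m.g p)⁻¹ k l *
    (pd i (fun q => m.g q j l) p + pd j (fun q => m.g q i l) p - pd l (fun q => m.g q i j) p)

/-- The component `R^l_{kij}` of the curvature tensor: `R(∂ᵢ, ∂ⱼ)∂ₖ = ∑ R^l_{kij} ∂ₗ`. -/
def curvature (l k i j : Fin 2) (p : T2) : ℝ :=
  pd i (m.christoffel l j k) p - pd j (m.christoffel l i k) p +
    ∑ n, (m.christoffel l i n p * m.christoffel n j k p -
      m.christoffel l j n p * m.christoffel n i k p)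

/-- The metric is flat: its curvature tensor vanishes identically. -/
def IsFlat : Prop := ∀ l k i j p, m.curvature l k i j p = 0

/-- The gradient `∇U`. -/
def grad (U : T2 → ℝ) (p : T2) : Fin 2 → ℝ := fun k => ∑ j, (m.g p)⁻¹ k j * pd j U p

/-- The divergence of a vector field with respect to the Riemannian area. -/
def div (X : T2 → Fin 2 → ℝ) (p : T2) : ℝ :=
  (1 / √(m.g p).det) * ∑ i, pd i (fun q => √(m.g q).det * X q i) p

/-- The conformal metric `e^{-2U} g`. -/
def conformal (U : T2 → ℝ) (hU : Smooth U) : Metric where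
  g := fun p => Real.exp (-2 * U p) • m.g p
  smooth := fun i j => by
    have h := (Real.contDiff_exp.comp ((contDiff_const (c := (-2 : ℝ))).mul hU)).mul (m.smooth i j)
    exact h
  posDef := fun p => (m.posDef p).smul (Real.exp_pos _)

end Metric

/-- An oriented Riemannian 2-torus. The orientation is encoded by a sign: it is `1` if the frame
`(∂₀, ∂₁)` is positively oriented and `-1` otherwise. -/
structure OrientedTorus extends Metric where
  /-- the sign of the frame `(∂₀, ∂₁)` -/
  sign : ℤˣ

namespace OrientedTorus

variable (M : OrientedTorus)

/-- The rotation `v ↦ iv` of `T_p 𝕋²` through `π/2` according to the orientation. -/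
def rot (p : T2) (v : Fin 2 → ℝ) : Fin 2 → ℝ :=
  ((((M.sign : ℤ) : ℝ)) / √(M.g p).det) • ![-(M.g p *ᵥ v) 1, (M.g p *ᵥ v) 0]

/-- `iv` is orthogonal to `v`, has the length of `v`, and `(v, iv)` is positively oriented. -/
theorem rot_spec (p : T2) (v : Fin 2 → ℝ) :
    M.inner p v (M.rot p v) = 0 ∧ M.norm p (M.rot p v) = M.norm p v ∧
      (v ≠ 0 → 0 < ((M.sign : ℤ) : ℝ) * (v 0 * M.rot p v 1 - v 1 * M.rot p v 0)) := by
  have hdet := (M.posDef p).det_pos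
  have hs : √(M.g p).det * √(M.g p).det = (M.g p).det := Real.mul_self_sqrt hdet.le
  have hpos : 0 < √(M.g p).det := Real.sqrt_pos.2 hdet
  have hsym : M.g p 1 0 = M.g p 0 1 := by
    have := (M.posDef p).isHermitian.apply 0 1
    simpa using this
  have hsg : ((M.sign : ℤ) : ℝ) * ((M.sign : ℤ) : ℝ) = 1 := by
    rcases Int.units_eq_one_or M.sign with h | h <;> simp [h]
  have hd : (M.g p).det = M.g p 0 0 * M.g p 1 1 - M.g p 0 1 * M.g p 0 1 := by
    rw [Matrix.det_fin_two, hsym]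
  refine ⟨?_, ?_, ?_⟩
  · simp [Metric.inner, rot, dotProduct, Matrix.mulVec, Fin.sum_univ_two, hsym]
    ring
  · unfold Metric.norm
    congr 1
    simp only [Metric.inner, rot, dotProduct, Matrix.mulVec, Fin.sum_univ_two, hsym,
      Pi.smul_apply, smul_eq_mul, Matrix.cons_val_zero, Matrix.cons_val_one]
    generalize √(M.g p).det = s at *
    generalize ((M.sign : ℤ) : ℝ) = ε at *
    rw [hd] at hs
    field_simp
    have hε : ε ^ 2 = 1 := by rw [sq, hsg]
    have hs' : s ^ 2 = M.g p 0 0 * M.g p 1 1 - M.g p 0 1 * M.g p 0 1 := by rw [sq, hs]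
    rw [hε, hs']
    ring
  · intro hv
    have hq : 0 < v ⬝ᵥ (M.g p *ᵥ v) := by
      simpa using (M.posDef p).dotProduct_mulVec_pos hv
    have : ((M.sign : ℤ) : ℝ) * (v 0 * M.rot p v 1 - v 1 * M.rot p v 0) =
        (((M.sign : ℤ) : ℝ) * ((M.sign : ℤ) : ℝ)) * (v ⬝ᵥ (M.g p *ᵥ v)) / √(M.g p).det := by
      simp [rot, dotProduct, Fin.sum_univ_two]
      ring
    rw [this, hsg, one_mul]
    exact div_pos hq hpos

/-- The function `λ(x, v) = f(x) + ⟨e(x), iv⟩`. -/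
def lam (f : T2 → ℝ) (e : T2 → Fin 2 → ℝ) (p : T2) (v : Fin 2 → ℝ) : ℝ :=
  f p + M.inner p (e p) (M.rot p v)

/-- `c : ℝ → ℝ²` is a lift of a unit speed thermostat geodesic `γ = proj ∘ c` of `𝕋²`, that is,
`D_t γ' = λ(γ, γ') iγ'`. -/
structure IsThermostatGeodesic (f : T2 → ℝ) (e : T2 → Fin 2 → ℝ) (c : ℝ → Fin 2 → ℝ) :
    Prop where
  contDiff : ContDiff ℝ 2 c
  unitSpeed : ∀ t, M.norm (proj (c t)) (deriv c t) = 1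
  equation : ∀ t k,
    deriv (deriv c) t k +
        ∑ i, ∑ j, M.christoffel k i j (proj (c t)) * deriv c t i * deriv c t j =
      M.lam f e (proj (c t)) (deriv c t) * M.rot (proj (c t)) (deriv c t) k

open Classical in
/-- The flow `φ_t` of the thermostat on the unit circle bundle: `φ_t(x, v) = (γ(t), γ'(t))`, where
`γ` is the thermostat geodesic with `γ(0) = x` and `γ'(0) = v`. (For unit `v` there is exactly one
such `γ`, defined for all times; `φ_t` is the identity outside the unit circle bundle.) -/
def flow (f : T2 → ℝ) (e : T2 → Fin 2 → ℝ) (t : ℝ) (z : T2 × (Fin 2 → ℝ)) :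
    T2 × (Fin 2 → ℝ) :=
  if h : ∃ c, M.IsThermostatGeodesic f e c ∧ proj (c 0) = z.1 ∧ deriv c 0 = z.2 then
    (proj (h.choose t), deriv h.choose t)
  else z

/-- The exponential map `exp_x^λ(tv) = π(φ_t(x, v))`, for `t > 0` and `v` a unit vector at `x`. -/
def expMap (f : T2 → ℝ) (e : T2 → Fin 2 → ℝ) (x : T2) (w : Fin 2 → ℝ) : T2 :=
  (M.flow f e (M.norm x w) (x, (M.norm x w)⁻¹ • w)).1

/-- The thermostat has no conjugate points: for every `x` the map `exp_x^λ`, defined on the vectors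
`tv` with `t > 0` and `v` unit, i.e. on the nonzero vectors, is a local diffeomorphism. -/
def NoConjugatePoints (f : T2 → ℝ) (e : T2 → Fin 2 → ℝ) : Prop :=
  ∀ x : T2, ∀ w : Fin 2 → ℝ, w ≠ 0 → IsLocalDiffeoAt (M.expMap f e x) w

end OrientedTorus

end

end Thermostat

/-!
# Thermostats without conjugate points on the two-torus

The Gram-Schmidt process applied to the coordinate coframe gives a global orthonormal coframe
`θ₁ = a dx₀ + b dx₁`, `θ₂ = c dx₁`. Hence the unit circle bundle is `𝕋² × S¹` with coordinates
`(x₀, x₁, α)`, where `α` is the angle in the frame, and everything can be computed with smooth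
periodic functions (`Per`) on `ℝ²` and `ℝ³`. The orientation enters only through the sign of `f`
(`Describes.force`), so that one may assume that `(∂₀, ∂₁)` is positively oriented. The connection
form `ω` of the Levi-Civita connection and the vector field `e` are combined into the one-form `η`,
which is `ω` plus the contraction of the area form with `e`; the generator of the thermostat flow
then turns the angle with the speed `f - η(v)`. The flow in these coordinates is smooth
(`contDiff_flow`, by the implicit function theorem in the space of paths), and the projections of
its trajectories are exactly the thermostat geodesics (`Describes.isThermostatGeodesic`,
`Describes.eq_foot_Φ`).

*The Jacobi equation.* Let `Y` and `Q` be the values on the variation field, obtained by turning the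
initial velocity, of the one-forms `y = -sin α θ₁ + cos α θ₂` and
`q = dα + η - f (cos α θ₁ + sin α θ₂)`. The structure equations `Coords.lie_yForm` and
`Coords.lie_qForm` give `Y' = Q + p Y` and `Q' = -K Y` with `Y(0) = 0`, `Q(0) = 1`, where `p` is the
divergence of the flow with respect to the Liouville measure and `K` (called `kt`) is a curvature.
The Jacobian of the exponential map in polar coordinates is `Y` up to a positive factor
(`Coords.det_expPolar`), so that there are no conjugate points if and only if `Y` has no zero at
positive times (`Describes.noConjugatePoints_iff`).

*Hopf's argument.* If `Y` has no zero, then `ρ = Q / Y`, evaluated at time `T` along the trajectory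
that ends at a given point, is a smooth solution of the Riccati equation
`∂_T ρ + Xρ = -ρ² - pρ - K`, where `X` is the generator of the flow. Integration against a weight
`w > 0` and the Cauchy-Schwarz inequality give a Riccati inequality for the integral of `w ρ`. It
cannot hold for all `T > 0` (`not_riccati`) unless the integral of `w K - (X w)² / (2 w)` is
nonpositive (`Coords.int_kt_le`). For `w = 1` the integral of `K` is that of `f²`, since all other
terms are derivatives; hence `f = 0` (`Coords.f_eq_zero`). Then `K` is the function `-dη / (a c)` on
the base, it has integral zero, and the weights `w = 1 + s K` with small `s > 0` give `K = 0`
(`Coords.dη_eq_zero`). Conversely, if `f = 0` and `dη = 0` then `Q = 1`, and `Y' = 1 + p Y` is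
solved by a positive function (`Coords.Y_pos`). No conjugate points thus means `f = 0` and `dη = 0`.

*The geometric form of the condition.* For every `U`, the two-form `dη` is the sum of the curvature
form of `e^{-2U} g` and of the divergence of `e + ∇U` (`Coords.dη_thermostat`), and a metric is
flat if and only if its connection form is closed (`Represents.isFlat_iff`). So if the conformal
metric is flat and the divergence vanishes then `dη = 0`. For the converse one needs a function
`U` with `div (e + ∇U) = 0`, a linear elliptic equation in divergence form. Its smooth solution
(`exists_div_flux_eq_zero`) is obtained from Galerkin approximations by trigonometric polynomials.
Because the Galerkin spaces are invariant under differentiation, the energy estimate applies to the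
derivatives of the approximations too, and bounds each of them in the mean
(`bddDeriv_of_isGalerkin`); a Sobolev inequality turns this into uniform bounds, a subsequence
(taken along an ultrafilter) converges with all derivatives (`exists_limit`), and the limit solves
the equation because the trigonometric monomials are complete (`eq_zero_of_orthogonal`).
-/

namespace Thermostat

noncomputable section

section

open MeasureTheory Set

variable {n : ℕ} {L : Fin n → ℝ}

/-! ### Smooth periodic functions -/

theorem two_le_infty : (2 : WithTop ℕ∞) ≤ ∞ :=
  WithTop.coe_le_coe.2 (le_top : (2 : ℕ∞) ≤ ⊤)

/-- The algebra of smooth real functions on `ℝⁿ` which have the period `L i` in the direction of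
the `i`-th coordinate, as a subalgebra of all functions. -/
def perAlgebra (L : Fin n → ℝ) : Subalgebra ℝ ((Fin n → ℝ) → ℝ) where
  carrier := {h | ContDiff ℝ ∞ h ∧ ∀ i x, h (x + Pi.single i (L i)) = h x}
  mul_mem' := fun ha hb => ⟨ha.1.mul hb.1, fun i x => by simp [ha.2 i x, hb.2 i x]⟩
  add_mem' := fun ha hb => ⟨ha.1.add hb.1, fun i x => by simp [ha.2 i x, hb.2 i x]⟩
  algebraMap_mem' := fun r => ⟨contDiff_const, fun i x => rfl⟩

/-- The type of smooth real functions on `ℝⁿ` with the periods `L`. -/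
def Per (L : Fin n → ℝ) : Type := perAlgebra L

namespace Per

instance : CommRing (Per L) := inferInstanceAs (CommRing (perAlgebra L))
instance : Algebra ℝ (Per L) := inferInstanceAs (Algebra ℝ (perAlgebra L))
instance : FunLike (Per L) (Fin n → ℝ) ℝ := ⟨fun h => Subtype.val h, Subtype.val_injective⟩

/-- A smooth periodic function as an element of the algebra. -/
def mk (h : (Fin n → ℝ) → ℝ) (h1 : ContDiff ℝ ∞ h)
    (h2 : ∀ i x, h (x + Pi.single i (L i)) = h x) : Per L := Subtype.mk h ⟨h1, h2⟩

@[simp] theorem mk_apply (h : (Fin n → ℝ) → ℝ) (h1 : ContDiff ℝ ∞ h)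
    (h2 : ∀ i x, h (x + Pi.single i (L i)) = h x) (x : Fin n → ℝ) : mk h h1 h2 x = h x := rfl

theorem contDiff (h : Per L) : ContDiff ℝ ∞ h := (Subtype.prop h).1

theorem continuous (h : Per L) : Continuous h := h.contDiff.continuous

theorem differentiable (h : Per L) : Differentiable ℝ h := h.contDiff.differentiable (by simp)

theorem periodic (h : Per L) (i : Fin n) (x : Fin n → ℝ) : h (x + Pi.single i (L i)) = h x :=
  (Subtype.prop h).2 i x

theorem ext {g h : Per L} (H : ∀ x, g x = h x) : g = h := DFunLike.ext _ _ H

@[simp] theorem add_apply (g h : Per L) (x : Fin n → ℝ) : (g + h) x = g x + h x := rfl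
@[simp] theorem sub_apply (g h : Per L) (x : Fin n → ℝ) : (g - h) x = g x - h x := rfl
@[simp] theorem neg_apply (g : Per L) (x : Fin n → ℝ) : (-g) x = -g x := rfl
@[simp] theorem mul_apply (g h : Per L) (x : Fin n → ℝ) : (g * h) x = g x * h x := rfl
@[simp] theorem one_apply (x : Fin n → ℝ) : (1 : Per L) x = 1 := rfl
@[simp] theorem zero_apply (x : Fin n → ℝ) : (0 : Per L) x = 0 := rfl
@[simp] theorem smul_apply (r : ℝ) (g : Per L) (x : Fin n → ℝ) : (r • g) x = r * g x := rfl
@[simp] theorem pow_apply (g : Per L) (k : ℕ) (x : Fin n → ℝ) : (g ^ k) x = g x ^ k := rfl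
@[simp] theorem sum_apply {ι : Type*} (s : Finset ι) (g : ι → Per L) (x : Fin n → ℝ) :
    (∑ i ∈ s, g i) x = ∑ i ∈ s, g i x := by
  induction s using Finset.cons_induction with
  | empty => rfl
  | cons a s ha ih => rw [Finset.sum_cons, Finset.sum_cons, add_apply, ih]

theorem fderiv_periodic (h : Per L) (i : Fin n) (x : Fin n → ℝ) :
    fderiv ℝ h (x + Pi.single i (L i)) = fderiv ℝ h x := by
  rw [← fderiv_comp_add_right]
  congr 1
  funext y
  exact h.periodic i y

/-- The partial derivative `∂ᵢ`, a derivation of the algebra of smooth periodic functions. -/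
def d (i : Fin n) : Derivation ℝ (Per L) (Per L) :=
  Derivation.mk'
    { toFun := fun h => mk (fun x => fderiv ℝ h x (Pi.single i 1))
        ((h.contDiff.fderiv_right (m := ∞) (by simp)).clm_apply contDiff_const)
        fun j x => by rw [fderiv_periodic]
      map_add' := fun g h => ext fun x => by
        change fderiv ℝ (⇑g + ⇑h) x _ = _
        rw [fderiv_add (g.differentiable x) (h.differentiable x)]; rfl
      map_smul' := fun r h => ext fun x => by
        change fderiv ℝ (r • ⇑h) x _ = _
        rw [fderiv_const_smul (h.differentiable x)]; rfl }
    (fun g h => ext fun x => by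
      change fderiv ℝ (⇑g * ⇑h) x _ = g x * fderiv ℝ h x _ + h x * fderiv ℝ g x _
      rw [fderiv_mul (g.differentiable x) (h.differentiable x)]; rfl)

theorem d_apply (i : Fin n) (h : Per L) (x : Fin n → ℝ) :
    d i h x = fderiv ℝ h x (Pi.single i 1) := rfl

theorem fderiv_apply (h : Per L) (x v : Fin n → ℝ) :
    fderiv ℝ h x v = ∑ i, v i * d i h x := by
  conv_lhs => rw [pi_eq_sum_univ' v, map_sum]
  refine Finset.sum_congr rfl fun i _ => ?_
  rw [d_apply, ← smul_eq_mul, ← map_smul]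

theorem d_mul_apply (i : Fin n) (g h : Per L) (x : Fin n → ℝ) :
    d i (g * h) x = d i g x * h x + g x * d i h x := by
  rw [Derivation.leibniz]
  simp only [smul_eq_mul, add_apply, mul_apply]
  ring

theorem d_comm (i j : Fin n) (h : Per L) : d i (d j h) = d j (d i h) := by
  refine ext fun x => ?_
  have key : ∀ i j : Fin n, d i (d j h) x =
      fderiv ℝ (fderiv ℝ h) x (Pi.single i 1) (Pi.single j 1) := fun i j => by
    have hd : DifferentiableAt ℝ (fderiv ℝ h) x :=
      ((h.contDiff.of_le two_le_infty).fderiv_right (m := 1) one_add_one_eq_two.le).differentiable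
        one_ne_zero x
    rw [d_apply]
    change fderiv ℝ (fun y => fderiv ℝ h y (Pi.single j 1)) x _ = _
    rw [fderiv_clm_apply hd (differentiableAt_const _)]
    simp
  rw [key, key]
  exact (h.contDiff.contDiffAt.isSymmSndFDerivAt (by simpa using two_le_infty)).eq _ _

/-- The inverse of a nowhere vanishing smooth periodic function. -/
def inv (h : Per L) (h0 : ∀ x, h x ≠ 0) : Per L :=
  mk (fun x => (h x)⁻¹) (h.contDiff.inv h0) fun i x => by rw [h.periodic]

theorem inv_apply (h : Per L) (h0 : ∀ x, h x ≠ 0) (x : Fin n → ℝ) : h.inv h0 x = (h x)⁻¹ := rfl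

theorem d_inv_apply (h : Per L) (h0 : ∀ x, h x ≠ 0) (i : Fin n) (x : Fin n → ℝ) :
    d i (h.inv h0) x = -(d i h x) / h x ^ 2 := by
  have h1 : h * h.inv h0 = 1 := ext fun y => by simp [inv_apply, h0 y]
  have h2 := congrArg (fun g : Per L => g x) (congrArg (d i) h1)
  simp only [d_mul_apply, Derivation.map_one_eq_zero, zero_apply, inv_apply] at h2
  have := h0 x
  field_simp at h2 ⊢
  linarith

/-- Composition with a smooth function of one variable. -/
def comp (φ : ℝ → ℝ) (h : Per L) (hφ : ∀ x, ContDiffAt ℝ ∞ φ (h x)) : Per L :=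
  mk (fun x => φ (h x)) (contDiff_iff_contDiffAt.2 fun x => (hφ x).comp x h.contDiff.contDiffAt)
    fun i x => by rw [h.periodic]

theorem comp_apply (φ : ℝ → ℝ) (h : Per L) (hφ : ∀ x, ContDiffAt ℝ ∞ φ (h x)) (x : Fin n → ℝ) :
    comp φ h hφ x = φ (h x) := rfl

/-! ### Integration over a period box -/

theorem integrableOn (h : Per L) : IntegrableOn h (Icc 0 L) :=
  h.continuous.continuousOn.integrableOn_compact isCompact_Icc

/-- The integral of a smooth periodic function over a period box. -/
def int : Per L →ₗ[ℝ] ℝ where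
  toFun h := ∫ x in Icc 0 L, h x
  map_add' g h := integral_add g.integrableOn h.integrableOn
  map_smul' r _ := integral_const_mul r _

theorem int_def (h : Per L) : int h = ∫ x in Icc 0 L, h x := rfl

theorem int_mono {g h : Per L} (H : ∀ x, g x ≤ h x) : int g ≤ int h :=
  setIntegral_mono g.integrableOn h.integrableOn H

theorem int_nonneg {h : Per L} (H : ∀ x, 0 ≤ h x) : 0 ≤ int h :=
  setIntegral_nonneg measurableSet_Icc fun x _ => H x

theorem eq_of_sub_int (h : Per L) {x y : Fin n → ℝ} (hxy : ∀ i, ∃ k : ℤ, x i = y i + k * L i) :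
    h x = h y := by
  choose k hk using hxy
  have hz : ∀ (j : Fin n) (k : ℤ) (y : Fin n → ℝ), h (y + Pi.single j (k * L j)) = h y := by
    intro j k y
    induction k using Int.induction_on with
    | zero => simp
    | succ k ih =>
      rw [← ih]
      conv_rhs => rw [← h.periodic j]
      congr 1
      rw [add_assoc, ← Pi.single_add]
      push_cast; ring_nf
    | pred k ih =>
      rw [← ih]
      conv_lhs => rw [← h.periodic j]
      congr 1
      rw [add_assoc, ← Pi.single_add]
      push_cast; ring_nf
  have key : ∀ s : Finset (Fin n), h (y + ∑ i ∈ s, Pi.single i (k i * L i)) = h y := by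
    intro s
    induction s using Finset.cons_induction with
    | empty => simp
    | cons j s hj ih => rw [Finset.sum_cons, add_comm (Pi.single j _), ← add_assoc, hz, ih]
  have hx : x = y + ∑ i, Pi.single i (k i * L i) := by
    funext j
    rw [Pi.add_apply, hk j, Finset.sum_apply, Finset.sum_eq_single j
      (fun i _ hi => Pi.single_eq_of_ne' hi _) (by simp), Pi.single_eq_same]
  rw [hx, key]

/-- Every point is equivalent to a point of the period box. -/
theorem exists_mem_Icc (hL : ∀ i, 0 < L i) (x : Fin n → ℝ) :
    ∃ y ∈ Icc 0 L, ∀ h : Per L, h y = h x := by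
  have h1 := fun i => Int.floor_le (x i / L i)
  have h2 := fun i => Int.lt_floor_add_one (x i / L i)
  simp only [le_div_iff₀ (hL _)] at h1
  simp only [div_lt_iff₀ (hL _)] at h2
  refine ⟨fun i => x i - ⌊x i / L i⌋ * L i, ⟨fun i => ?_, fun i => ?_⟩, fun h =>
    (h.eq_of_sub_int fun i => ⟨⌊x i / L i⌋, by ring⟩).symm⟩
  · simpa using h1 i
  · have := h2 i
    simp only
    linarith

theorem exists_bound (hL : ∀ i, 0 < L i) (h : Per L) : ∃ C, 0 < C ∧ ∀ x, |h x| ≤ C := by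
  obtain ⟨C, hC⟩ := isCompact_Icc.exists_bound_of_continuousOn (s := Icc 0 L)
    h.continuous.continuousOn
  refine ⟨max C 1, by positivity, fun x => ?_⟩
  obtain ⟨y, hy, h'⟩ := exists_mem_Icc hL x
  rw [← h' h]
  exact (hC y hy).trans (le_max_left _ _)

/-- A nonnegative smooth periodic function with vanishing integral is zero. -/
theorem eq_zero_of_int_le (hL : ∀ i, 0 < L i) {h : Per L} (H : ∀ x, 0 ≤ h x) (h0 : int h ≤ 0)
    (x : Fin n → ℝ) : h x = 0 := by
  have hae : (h : (Fin n → ℝ) → ℝ) =ᵐ[volume.restrict (Icc 0 L)] 0 :=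
    (integral_eq_zero_iff_of_nonneg H h.integrableOn).1 (le_antisymm h0 (int_nonneg H))
  have hint : (interior (Icc 0 L)) = pi univ fun i => Ioo 0 (L i) := by
    rw [← pi_univ_Icc, interior_pi_set finite_univ]
    simp
  have hne : (interior (Icc 0 L)).Nonempty := by
    rw [hint]
    exact ⟨fun i => L i / 2, fun i _ => ⟨half_pos (hL i), half_lt_self (hL i)⟩⟩
  have hcl : closure (interior (Icc 0 L)) = Icc 0 L :=
    (convex_Icc (𝕜 := ℝ) (0 : Fin n → ℝ) L).closure_interior_eq_closure_of_nonempty_interior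
      hne |>.trans
      isClosed_Icc.closure_eq
  have h2 := Measure.eqOn_of_ae_eq hae h.continuous.continuousOn continuousOn_const
    (by rw [hcl])
  obtain ⟨y, hy, h'⟩ := exists_mem_Icc hL x
  rw [← h' h]
  exact h2 hy

/-- Integrals of derivatives vanish. -/
theorem int_d {m : ℕ} {L : Fin (m + 1) → ℝ} (hL : ∀ i, 0 < L i) (i : Fin (m + 1)) (h : Per L) :
    int (d i h) = 0 := by
  have H := integral_divergence_of_hasFDerivAt_off_countable' (0 : Fin (m + 1) → ℝ) L
    (fun j => (hL j).le) (fun j => if j = i then h else 0)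
    (fun j x => if j = i then fderiv ℝ h x else 0) ∅ countable_empty
    (fun j => by
      split_ifs
      · exact h.continuous.continuousOn
      · exact continuousOn_const)
    (fun x _ j => by
      split_ifs
      · exact (h.differentiable x).hasFDerivAt
      · exact hasFDerivAt_const _ _)
    (by
      have : (fun x => ∑ j, (if j = i then fderiv ℝ h x else 0) (Pi.single j 1)) = d i h := by
        funext x
        rw [Finset.sum_eq_single i (fun j _ hj => by simp [hj]) (by simp)]
        simp [d_apply]
      rw [this]
      exact (d i h).integrableOn)
  have h1 : int (d i h) = ∫ x in Icc 0 L, ∑ j, (if j = i then fderiv ℝ h x else 0)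
      (Pi.single j 1) := by
    rw [int_def]
    congr 1
    funext x
    rw [Finset.sum_eq_single i (fun j _ hj => by simp [hj]) (by simp)]
    simp [d_apply]
  rw [h1, H]
  refine Finset.sum_eq_zero fun j _ => ?_
  split_ifs with hj
  · rw [sub_eq_zero]
    congr 1
    funext x
    rw [← h.periodic j (Fin.insertNth j ((0 : Fin (m + 1) → ℝ) j) x)]
    congr 1
    funext k
    refine Fin.succAboveCases j ?_ (fun k => ?_) k <;> simp
  · simp

/-- Integration by parts. -/
theorem int_d_mul {m : ℕ} {L : Fin (m + 1) → ℝ} (hL : ∀ i, 0 < L i) (i : Fin (m + 1))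
    (g h : Per L) : int (d i g * h) = -int (g * d i h) := by
  have := int_d hL i (g * h)
  rw [Derivation.leibniz, map_add] at this
  simp only [smul_eq_mul] at this
  rw [mul_comm h] at this
  linarith

end Per

end

section

open MeasureTheory Set

/-! ### Smooth dependence of flows on the initial data -/

section Flow

variable {E E' : Type} [NormedAddCommGroup E] [NormedSpace ℝ E]
  [NormedAddCommGroup E'] [NormedSpace ℝ E']

/-- The interval `[0, 1]`. -/
local notation "I01" => Icc (0 : ℝ) 1

/-- The bounded bilinear map which applies a continuous path of operators to a path of vectors. -/
def applyPath : C(I01, E →L[ℝ] E') →L[ℝ] C(I01, E) →L[ℝ] C(I01, E') :=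
  LinearMap.mkContinuous₂
    (LinearMap.mk₂ ℝ (fun (A : C(I01, E →L[ℝ] E')) (h : C(I01, E)) =>
        (⟨fun s => A s (h s), A.continuous.clm_apply h.continuous⟩ : C(I01, E')))
      (fun A B h => by ext s; simp) (fun r A h => by ext s; simp)
      (fun A g h => by ext s; simp) (fun r A h => by ext s; simp)) 1
    (fun A h => by
      rw [one_mul]
      refine (ContinuousMap.norm_le _ (by positivity)).2 fun s => ?_
      exact ((A s).le_opNorm (h s)).trans
        (mul_le_mul (A.norm_coe_le_norm s) (h.norm_coe_le_norm s) (by positivity) (by positivity)))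

theorem applyPath_apply (A : C(I01, E →L[ℝ] E')) (h : C(I01, E)) (s : I01) :
    applyPath A h s = A s (h s) := rfl

/-- Composition with a `C¹` map is differentiable on continuous paths: the modulus of continuity
of `fderiv φ` is uniform along a path, because composition with `fderiv φ` is continuous in the
compact-open topology. -/
theorem hasFDerivAt_postcomp (φ : E → E') (hφ : ContDiff ℝ 1 φ) (u : C(I01, E)) :
    HasFDerivAt (fun w : C(I01, E) => (⟨φ, hφ.continuous⟩ : C(E, E')).comp w)
      (applyPath
        ((⟨fderiv ℝ φ, hφ.continuous_fderiv one_ne_zero⟩ : C(E, E →L[ℝ] E')).comp u)) u := by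
  rw [hasFDerivAt_iff_isLittleO_nhds_zero, Asymptotics.isLittleO_iff]
  intro ε hε
  set D : C(E, E →L[ℝ] E') := ⟨fderiv ℝ φ, hφ.continuous_fderiv one_ne_zero⟩
  have hc := (ContinuousMap.continuous_postcomp (X := I01) D).continuousAt (x := u)
  have hc' := hc (Metric.closedBall_mem_nhds (D.comp u) hε)
  obtain ⟨δ, hδ, H⟩ := Metric.mem_nhds_iff.1 hc'
  filter_upwards [Metric.ball_mem_nhds (0 : C(I01, E)) hδ] with h hh
  rw [mem_ball_zero_iff] at hh
  refine (ContinuousMap.norm_le _ (by positivity)).2 fun s => ?_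
  have hb : ∀ y ∈ Metric.ball (u s) δ, ‖fderiv ℝ φ y - fderiv ℝ φ (u s)‖ ≤ ε := by
    intro y hy
    have h1 : u + ContinuousMap.const _ (y - u s) ∈ Metric.ball u δ := by
      rw [Metric.mem_ball, dist_eq_norm, add_sub_cancel_left]
      refine lt_of_le_of_lt ((ContinuousMap.norm_le _ (norm_nonneg (y - u s))).2 fun _ => le_rfl) ?_
      rwa [← dist_eq_norm]
    have h2 := (ContinuousMap.dist_le hε.le).1 (Metric.mem_closedBall.1 (H h1)) s
    rw [dist_eq_norm] at h2
    simpa [D] using h2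
  have h3 := (convex_ball (u s) δ).norm_image_sub_le_of_norm_hasFDerivWithin_le'
    (fun y _ => ((hφ.differentiable one_ne_zero) y).hasFDerivAt.hasFDerivWithinAt) hb
    (Metric.mem_ball_self hδ) (y := u s + h s) (by
      rw [Metric.mem_ball, dist_eq_norm, add_sub_cancel_left]
      exact (h.norm_coe_le_norm s).trans_lt hh)
  rw [add_sub_cancel_left] at h3
  refine le_trans h3 ?_
  gcongr
  exact h.norm_coe_le_norm s

/-- Composition with a smooth map is a smooth operator on continuous paths. -/
theorem contDiff_postcomp (k : ℕ) : ∀ {E' : Type} [NormedAddCommGroup E'] [NormedSpace ℝ E']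
    (φ : C(E, E')), ContDiff ℝ k φ → ContDiff ℝ k (fun w : C(I01, E) => φ.comp w) := by
  induction k with
  | zero =>
    intro E' _ _ φ _
    exact contDiff_zero.2 (ContinuousMap.continuous_postcomp φ)
  | succ k ih =>
    intro E' _ _ φ hφ
    have h1 : ContDiff ℝ 1 φ := hφ.of_le (by
      rw [Nat.cast_add, Nat.cast_one]; exact le_add_self)
    have hd := hasFDerivAt_postcomp φ h1
    have hφ' := hφ
    rw [Nat.cast_add, Nat.cast_one, contDiff_succ_iff_fderiv] at hφ' ⊢
    refine ⟨fun w => (hd w).differentiableAt, fun hω => by simp at hω, ?_⟩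
    have : fderiv ℝ (fun w : C(I01, E) => φ.comp w) = fun w => applyPath
        ((⟨fderiv ℝ φ, h1.continuous_fderiv one_ne_zero⟩ : C(E, E →L[ℝ] E')).comp w) :=
      funext fun w => (hd w).fderiv
    rw [this]
    exact (ContinuousLinearMap.contDiff (E := C(I01, E →L[ℝ] E'))
      (F := C(I01, E) →L[ℝ] C(I01, E')) applyPath).comp
          (ih ⟨fderiv ℝ φ, h1.continuous_fderiv one_ne_zero⟩ hφ'.2.2)

/-- The operator which integrates a continuous path from `0`. -/
def integratePath : C(I01, E) →L[ℝ] C(I01, E) :=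
  LinearMap.mkContinuous
    { toFun := fun h => ⟨fun s => ∫ τ in (0 : ℝ)..s, h (projIcc 0 1 zero_le_one τ),
        (intervalIntegral.continuous_primitive (fun a b =>
          (h.continuous.comp continuous_projIcc).intervalIntegrable a b) 0).comp
          continuous_subtype_val⟩
      map_add' := fun g h => by
        ext s
        exact intervalIntegral.integral_add
          ((g.continuous.comp continuous_projIcc).intervalIntegrable _ _)
          ((h.continuous.comp continuous_projIcc).intervalIntegrable _ _)
      map_smul' := fun r h => by
        ext s
        exact intervalIntegral.integral_smul r _ } 1
    (fun h => by
      rw [one_mul]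
      refine (ContinuousMap.norm_le _ (norm_nonneg _)).2 fun s => ?_
      have := intervalIntegral.norm_integral_le_of_norm_le_const (a := (0 : ℝ)) (b := s)
        (f := fun τ => h (projIcc 0 1 zero_le_one τ)) (C := ‖h‖) fun τ _ => h.norm_coe_le_norm _
      refine le_trans this ?_
      rw [sub_zero, abs_of_nonneg s.2.1]
      exact mul_le_of_le_one_right (norm_nonneg _) s.2.2)

theorem integratePath_apply (h : C(I01, E)) (s : I01) :
    integratePath h s = ∫ τ in (0 : ℝ)..s, h (projIcc 0 1 zero_le_one τ) := rfl

theorem norm_integratePath_le (h : C(I01, E)) : ‖integratePath h‖ ≤ ‖h‖ := by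
  have h2 : ‖integratePath (E := E)‖ ≤ 1 := LinearMap.mkContinuous_norm_le _ zero_le_one _
  exact ((integratePath (E := E)).le_opNorm h).trans (mul_le_of_le_one_left (norm_nonneg _) h2)

variable [CompleteSpace E]

/-- The global flow of a bounded smooth Lipschitz vector field exists. -/
theorem exists_globalFlow {F : E → E} (hF : ContDiff ℝ ∞ F) {K : NNReal} (hK : LipschitzWith K F)
    {M : NNReal} (hM : ∀ x, ‖F x‖ ≤ M) :
    ∃ Φ : ℝ → E → E, (∀ z, Φ 0 z = z) ∧ ∀ t z, HasDerivAt (Φ · z) (F (Φ t z)) t := by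
  have h1 : ContMDiff 𝓘(ℝ, E) 𝓘(ℝ, E).tangent 1 (fun x ↦ (⟨x, F x⟩ : TangentBundle 𝓘(ℝ, E) E)) :=
    contMDiff_vectorSpace_iff_contDiff.2 (hF.of_le (by simp))
  have key : ∀ z : E, ∃ γ : ℝ → E, γ 0 = z ∧
      IsMIntegralCurve (I := 𝓘(ℝ, E)) γ (fun x : E => (F x : TangentSpace 𝓘(ℝ, E) x)) := by
    refine exists_isMIntegralCurve_of_isMIntegralCurveOn h1 one_pos fun z => ?_
    have hP : IsPicardLindelof (fun _ => F) (tmin := -1) (tmax := 1) ⟨0, by simp⟩ z M 0 M K :=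
      IsPicardLindelof.of_time_independent (fun x _ => hM x) hK.lipschitzOnWith (by simp)
    obtain ⟨γ, h0, hγ⟩ := hP.exists_eq_forall_mem_Icc_hasDerivWithinAt₀
    refine ⟨γ, h0, fun t ht => ?_⟩
    have := ((hγ t (Ioo_subset_Icc_self ht)).hasDerivAt (Icc_mem_nhds ht.1 ht.2)).hasFDerivAt
    exact this.hasMFDerivAt.hasMFDerivWithinAt
  choose Φ h0 hΦ using key
  refine ⟨fun t z => Φ z t, h0, fun t z => ?_⟩
  have h3 : HasFDerivAt (Φ z) ((1 : ℝ →L[ℝ] ℝ).smulRight (F (Φ z t))) t := (hΦ z t).hasFDerivAt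
  simpa using h3.hasDerivAt

omit [CompleteSpace E] in
theorem flow_unique {F : E → E} {K : NNReal} (hK : LipschitzWith K F) {γ₁ γ₂ : ℝ → E}
    (h₁ : ∀ t, HasDerivAt γ₁ (F (γ₁ t)) t) (h₂ : ∀ t, HasDerivAt γ₂ (F (γ₂ t)) t)
    (h0 : γ₁ 0 = γ₂ 0) : γ₁ = γ₂ :=
  ODE_solution_unique_univ (v := fun _ => F) (s := fun _ => univ) (t₀ := 0)
    (fun _ => hK.lipschitzOnWith) (fun t => ⟨h₁ t, mem_univ _⟩) (fun t => ⟨h₂ t, mem_univ _⟩) h0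

omit [CompleteSpace E] in
theorem flow_add {F : E → E} {K : NNReal} (hK : LipschitzWith K F) {Φ : ℝ → E → E}
    (h0 : ∀ z, Φ 0 z = z) (hΦ : ∀ t z, HasDerivAt (Φ · z) (F (Φ t z)) t) (s t : ℝ) (z : E) :
    Φ (s + t) z = Φ s (Φ t z) := by
  refine congrFun (flow_unique hK (γ₁ := fun s => Φ (s + t) z) (γ₂ := fun s => Φ s (Φ t z))
    (fun s => ?_) (fun s => hΦ s _) (by simp [h0])) s
  exact (hΦ (s + t) z).comp_add_const s t

/-- For short times the flow solves the integral equation `u = z + t ∫ F(u)` on paths, to which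
the implicit function theorem applies. -/
theorem contDiffAt_flow_of_small {F : E → E} (hF : ContDiff ℝ ∞ F) {K : NNReal}
    (hK : LipschitzWith K F) {Φ : ℝ → E → E} (h0 : ∀ z, Φ 0 z = z)
    (hΦ : ∀ t z, HasDerivAt (Φ · z) (F (Φ t z)) t) (t₀ : ℝ) (z₀ : E) (ht : |t₀| * K < 1) :
    ContDiffAt ℝ ∞ (fun p : ℝ × E => Φ p.1 p.2) (t₀, z₀) := by
  set Fc : C(E, E) := ⟨F, hF.continuous⟩
  have hc : ∀ z, Continuous (Φ · z) := fun z =>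
    continuous_iff_continuousAt.2 fun t => (hΦ t z).continuousAt
  -- the rescaled trajectory `σ ↦ Φ (t σ) z`
  let path : ℝ × E → C(I01, E) := fun p =>
    ⟨fun σ => Φ (p.1 * σ) p.2, (hc p.2).comp (continuous_const.mul continuous_subtype_val)⟩
  let G : (ℝ × E) × C(I01, E) → C(I01, E) := fun q =>
    q.2 - ContinuousLinearMap.const ℝ I01 q.1.2 - q.1.1 • integratePath (Fc.comp q.2)
  have hN : ContDiff ℝ ∞ (fun w : C(I01, E) => Fc.comp w) :=
    contDiff_infty.2 fun k => contDiff_postcomp k Fc (hF.of_le (by exact_mod_cast le_top))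
  have hG : ContDiff ℝ ∞ G := by
    refine (contDiff_snd.sub ((ContinuousLinearMap.contDiff _).comp
      (contDiff_snd.comp contDiff_fst))).sub ?_
    exact (contDiff_fst.comp contDiff_fst).smul
      (integratePath.contDiff.comp (hN.comp contDiff_snd))
  have hG0 : ∀ p, G (p, path p) = 0 := by
    intro p
    ext σ
    have h1 : ∀ τ ∈ uIcc (0 : ℝ) σ, HasDerivAt (fun τ => Φ (p.1 * τ) p.2)
        (p.1 • F (Φ (p.1 * τ) p.2)) τ := fun τ _ => by
      have h2 := (hΦ (p.1 * τ) p.2).scomp τ ((hasDerivAt_id τ).const_mul p.1)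
      rwa [mul_one] at h2
    have h3 := intervalIntegral.integral_eq_sub_of_hasDerivAt h1
      (((hF.continuous.comp ((hc p.2).comp (continuous_const.mul continuous_id))).const_smul
        p.1).intervalIntegrable _ _)
    have h4 : integratePath (Fc.comp (path p)) σ = ∫ τ in (0 : ℝ)..σ, F (Φ (p.1 * τ) p.2) := by
      rw [integratePath_apply]
      refine intervalIntegral.integral_congr fun τ hτ => ?_
      rw [uIcc_of_le σ.2.1] at hτ
      have : (projIcc (0 : ℝ) 1 zero_le_one τ : ℝ) = τ := by
        rw [projIcc_of_mem _ ⟨hτ.1, hτ.2.trans σ.2.2⟩]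
      simp [path, Fc, this]
    rw [intervalIntegral.integral_smul, ← h4, mul_zero, h0] at h3
    simp only [G, ContinuousMap.sub_apply, ContinuousMap.smul_apply, h3,
      ContinuousMap.zero_apply]
    simp [path]
  -- `u ↦ t ∫ F(u)` is a contraction for `|t| K < 1`
  have huniq : ∀ p : ℝ × E, |p.1| * K < 1 → ∀ u v, G (p, u) = 0 → G (p, v) = 0 → u = v := by
    intro p hp u v hu hv
    have h1 : u - v = p.1 • integratePath (Fc.comp u - Fc.comp v) := by
      rw [map_sub, smul_sub]
      have : u - v = (G (p, u) + p.1 • integratePath (Fc.comp u)) -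
          (G (p, v) + p.1 • integratePath (Fc.comp v)) := by
        simp only [G]; abel
      rw [this, hu, hv, zero_add, zero_add]
    have h2 : ‖Fc.comp u - Fc.comp v‖ ≤ K * ‖u - v‖ := by
      refine (ContinuousMap.norm_le _ (by positivity)).2 fun s => ?_
      refine (hK.norm_sub_le (u s) (v s)).trans ?_
      gcongr
      exact (u - v).norm_coe_le_norm s
    have h3 : ‖u - v‖ ≤ (|p.1| * K) * ‖u - v‖ := by
      conv_lhs => rw [h1]
      rw [norm_smul, Real.norm_eq_abs, mul_assoc]
      gcongr
      exact (norm_integratePath_le _).trans h2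
    have h4 : ‖u - v‖ = 0 := by
      by_contra hne
      have : 0 < ‖u - v‖ := lt_of_le_of_ne (norm_nonneg _) (Ne.symm hne)
      nlinarith
    rwa [norm_eq_zero, sub_eq_zero] at h4
  set q₀ : (ℝ × E) × C(I01, E) := ((t₀, z₀), path (t₀, z₀))
  have hinv : (fderiv ℝ G q₀ ∘L .inr ℝ (ℝ × E) C(I01, E)).IsInvertible := by
    set D : C(E, E →L[ℝ] E) := ⟨fderiv ℝ F, hF.continuous_fderiv (by simp)⟩
    set T : C(I01, E) →L[ℝ] C(I01, E) := t₀ • (integratePath ∘L applyPath (D.comp q₀.2))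
    have h1 : HasFDerivAt (fun w => G (q₀.1, w)) (1 - T) q₀.2 := by
      have h2 := (integratePath.hasFDerivAt.comp q₀.2
        (hasFDerivAt_postcomp F (hF.of_le (by simp)) q₀.2)).const_smul t₀
      exact ((hasFDerivAt_id q₀.2).sub_const (ContinuousLinearMap.const ℝ I01 z₀)).sub h2
    have h2 : HasFDerivAt (fun w => G (q₀.1, w))
        (fderiv ℝ G q₀ ∘L .inr ℝ (ℝ × E) C(I01, E)) q₀.2 :=
      ((hG.differentiable (by simp) q₀).hasFDerivAt).comp q₀.2 (hasFDerivAt_prodMk_right _ _)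
    rw [h2.unique h1]
    have hT : ‖T‖ < 1 := by
      refine lt_of_le_of_lt (T.opNorm_le_bound (by positivity) fun h => ?_) ht
      simp only [T, _root_.smul_apply, ContinuousLinearMap.comp_apply, norm_smul,
        Real.norm_eq_abs, mul_assoc]
      gcongr
      refine (norm_integratePath_le _).trans
        ((ContinuousMap.norm_le _ (by positivity)).2 fun s => ?_)
      rw [applyPath_apply]
      refine ((D.comp q₀.2 s).le_opNorm _).trans ?_
      gcongr
      · exact norm_fderiv_le_of_lipschitz ℝ hK
      · exact h.norm_coe_le_norm s
    obtain ⟨w, hw⟩ := isUnit_one_sub_of_norm_lt_one (R := C(I01, E) →L[ℝ] C(I01, E)) (x := T) hT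
    exact ⟨ContinuousLinearEquiv.unitsEquiv ℝ _ w, by rw [← hw]; rfl⟩
  have hGq : ContDiffAt ℝ ∞ G q₀ := hG.contDiffAt
  have hψ := hGq.contDiffAt_implicitFunction (by simp) hinv
  have hψ0 := hGq.eventually_apply_implicitFunction (by simp) hinv
  have hsmall : ∀ᶠ p : ℝ × E in 𝓝 (t₀, z₀), |p.1| * K < 1 :=
    (by fun_prop : Continuous fun p : ℝ × E => |p.1| * (K : ℝ)).continuousAt.eventually_lt
      continuousAt_const ht
  have hev : (fun p : ℝ × E => Φ p.1 p.2) =ᶠ[𝓝 (t₀, z₀)]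
      fun p => ContinuousMap.evalCLM ℝ (⟨1, by simp⟩ : I01)
        (hGq.implicitFunction (by simp) hinv p) := by
    filter_upwards [hsmall, hψ0] with p hp hp0
    rw [show G q₀ = 0 from hG0 _] at hp0
    have := huniq p hp _ _ (hG0 p) hp0
    rw [← this]
    simp [path]
  exact ((ContinuousLinearMap.contDiff _).contDiffAt.comp _ hψ).congr_of_eventuallyEq hev

/-- The flow of a smooth Lipschitz vector field is smooth in time and initial value. -/
theorem contDiff_flow {F : E → E} (hF : ContDiff ℝ ∞ F) {K : NNReal}
    (hK : LipschitzWith K F) {Φ : ℝ → E → E} (h0 : ∀ z, Φ 0 z = z)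
    (hΦ : ∀ t z, HasDerivAt (Φ · z) (F (Φ t z)) t) :
    ContDiff ℝ ∞ (fun p : ℝ × E => Φ p.1 p.2) := by
  have key : ∀ n : ℕ, ∀ (t : ℝ) (z : E), |t| * K < n →
      ContDiffAt ℝ ∞ (fun p : ℝ × E => Φ p.1 p.2) (t, z) := by
    intro n
    induction n with
    | zero =>
      intro t z h
      rw [Nat.cast_zero] at h
      exact absurd h (not_lt.2 (by positivity))
    | succ n ih =>
      intro t z h
      rcases Nat.eq_zero_or_pos n with rfl | hn
      · exact contDiffAt_flow_of_small hF hK h0 hΦ t z (by simpa using h)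
      have hn' : (0 : ℝ) < n := by exact_mod_cast hn
      -- the times `s` and `t - s` satisfy the bounds with `n` and `1` in place of `n + 1`
      set s : ℝ := t * (n / (n + 1))
      have e1 : |s| * K < n := by
        rw [abs_mul, abs_of_pos (by positivity : (0 : ℝ) < n / (n + 1))]
        push_cast at h
        have h' : |t| * K / (n + 1) < 1 := by rwa [div_lt_one (by positivity)]
        calc |t| * (n / (n + 1)) * K = n * (|t| * K / (n + 1)) := by ring
          _ < n * 1 := by gcongr
          _ = n := mul_one _
      have e2 : |t - s| * K < 1 := by
        have : t - s = t * (1 / (n + 1)) := by simp only [s]; field_simp; ring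
        rw [this, abs_mul, abs_of_pos (by positivity : (0 : ℝ) < 1 / (n + 1))]
        push_cast at h
        have h' : |t| * K / (n + 1) < 1 := by rwa [div_lt_one (by positivity)]
        calc |t| * (1 / (n + 1)) * K = (|t| * K / (n + 1)) := by ring
          _ < 1 := h'
      have h1 : ContDiffAt ℝ ∞ (fun w => Φ s w) z :=
        ContDiffAt.comp (g := fun p : ℝ × E => Φ p.1 p.2) (f := fun w => (s, w)) z (ih s z e1)
          (contDiffAt_const.prodMk contDiffAt_id)
      have h2 : ContDiffAt ℝ ∞ (fun p : ℝ × E => (p.1 - s, Φ s p.2)) (t, z) :=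
        (contDiffAt_fst.sub contDiffAt_const).prodMk (h1.comp (t, z) contDiffAt_snd)
      have h3 := (contDiffAt_flow_of_small hF hK h0 hΦ (t - s) (Φ s z) e2).comp (t, z) h2
      refine h3.congr_of_eventuallyEq (Filter.Eventually.of_forall fun p => ?_)
      simp only [Function.comp_apply]
      rw [← flow_add hK h0 hΦ, sub_add_cancel]
  refine contDiff_iff_contDiffAt.2 fun p => ?_
  obtain ⟨n, hn⟩ := exists_nat_gt (|p.1| * K)
  exact key n p.1 p.2 hn

end Flow

end

section

open MeasureTheory Set

/-! ### Functions on the torus as periodic functions -/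

theorem one_pos' (i : Fin 2) : (0 : ℝ) < (1 : Fin 2 → ℝ) i := one_pos

theorem proj_surjective : Function.Surjective proj := fun p =>
  ⟨fun i => (QuotientAddGroup.mk_surjective (p i)).choose,
    funext fun i => (QuotientAddGroup.mk_surjective (p i)).choose_spec⟩

theorem proj_eq_iff {x y : Fin 2 → ℝ} : proj x = proj y ↔ ∀ i, ∃ k : ℤ, x i = y i + k := by
  rw [funext_iff]
  refine forall_congr' fun i => ?_
  change ((x i : ℝ) : AddCircle (1 : ℝ)) = ((y i : ℝ) : AddCircle (1 : ℝ)) ↔ _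
  rw [eq_comm, QuotientAddGroup.eq, AddSubgroup.mem_zmultiples_iff]
  refine exists_congr fun k => ?_
  simp only [zsmul_eq_mul, mul_one]
  constructor <;> intro h <;> linarith

theorem proj_add_single (x : Fin 2 → ℝ) (i : Fin 2) (t : ℝ) :
    proj (x + Pi.single i t) = proj x + Pi.single i (t : UnitAddCircle) := by
  funext j
  rcases eq_or_ne j i with rfl | h
  · simp [proj]
  · simp [proj, h]

theorem isOpenQuotientMap_proj : IsOpenQuotientMap proj :=
  IsOpenQuotientMap.piMap fun _ => QuotientAddGroup.isOpenQuotientMap_mk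

/-- The periodic function on `ℝ²` defined by a smooth function on the torus. -/
def lift (h : T2 → ℝ) (hh : Smooth h) : Per (1 : Fin 2 → ℝ) :=
  Per.mk (fun x => h (proj x)) hh fun i x => by
    congr 1
    rw [proj_eq_iff]
    intro j
    rcases eq_or_ne j i with rfl | hj
    · exact ⟨1, by simp⟩
    · exact ⟨0, by simp [hj]⟩

theorem lift_apply (h : T2 → ℝ) (hh : Smooth h) (x : Fin 2 → ℝ) : lift h hh x = h (proj x) := rfl

theorem pd_proj (i : Fin 2) (h : T2 → ℝ) (hh : Smooth h) (x : Fin 2 → ℝ) :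
    pd i h (proj x) = Per.d i (lift h hh) x := by
  rw [Per.d_apply, ← ((lift h hh).differentiable x).lineDeriv_eq_fderiv, lineDeriv, pd]
  congr 1
  funext t
  rw [lift_apply, ← Pi.single_smul, smul_eq_mul, mul_one, proj_add_single]

/-- The function on the torus defined by a periodic function on `ℝ²`. -/
def descend (h : Per (1 : Fin 2 → ℝ)) (p : T2) : ℝ := h (Function.surjInv proj_surjective p)

theorem descend_proj (h : Per (1 : Fin 2 → ℝ)) (x : Fin 2 → ℝ) : descend h (proj x) = h x := by
  refine h.eq_of_sub_int fun i => ?_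
  obtain ⟨k, hk⟩ := proj_eq_iff.1 (Function.surjInv_eq proj_surjective (proj x)) i
  exact ⟨k, by simpa using hk⟩

theorem smooth_descend (h : Per (1 : Fin 2 → ℝ)) : Smooth (descend h) := by
  have : (fun x => descend h (proj x)) = h := funext (descend_proj h)
  rw [Smooth, this]
  exact h.contDiff

theorem continuous_descend (h : Per (1 : Fin 2 → ℝ)) : Continuous (descend h) := by
  rw [isOpenQuotientMap_proj.isQuotientMap.continuous_iff]
  have : descend h ∘ proj = h := funext (descend_proj h)
  rw [this]
  exact h.continuous

/-! ### Trigonometric polynomials -/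

/-- The phase `2π (n₀ x₀ + n₁ x₁)`. -/
def phase (n : Fin 2 → ℤ) (x : Fin 2 → ℝ) : ℝ := 2 * Real.pi * (n 0 * x 0 + n 1 * x 1)

theorem hasFDerivAt_phase (n : Fin 2 → ℤ) (x : Fin 2 → ℝ) :
    HasFDerivAt (phase n) ((2 * Real.pi) • ((n 0 : ℝ) • ContinuousLinearMap.proj 0 +
      (n 1 : ℝ) • ContinuousLinearMap.proj 1 : (Fin 2 → ℝ) →L[ℝ] ℝ)) x :=
  (((hasFDerivAt_apply (𝕜 := ℝ) 0 x).const_mul _).add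
    ((hasFDerivAt_apply (𝕜 := ℝ) 1 x).const_mul _)).const_mul _

theorem contDiff_phase (n : Fin 2 → ℤ) : ContDiff ℝ ∞ (phase n) := by
  unfold phase; fun_prop

theorem phase_periodic (n : Fin 2 → ℤ) (i : Fin 2) (x : Fin 2 → ℝ) :
    phase n (x + Pi.single i ((1 : Fin 2 → ℝ) i)) = phase n x + n i * (2 * Real.pi) := by
  fin_cases i <;> simp [phase] <;> ring

/-- The trigonometric monomial `cos (2π n · x)`. -/
def cosMon (n : Fin 2 → ℤ) : Per (1 : Fin 2 → ℝ) :=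
  Per.mk (fun x => Real.cos (phase n x)) (Real.contDiff_cos.comp (contDiff_phase n))
    fun i x => by rw [phase_periodic, Real.cos_add_int_mul_two_pi]

/-- The trigonometric monomial `sin (2π n · x)`. -/
def sinMon (n : Fin 2 → ℤ) : Per (1 : Fin 2 → ℝ) :=
  Per.mk (fun x => Real.sin (phase n x)) (Real.contDiff_sin.comp (contDiff_phase n))
    fun i x => by rw [phase_periodic, Real.sin_add_int_mul_two_pi]

theorem phase_deriv_apply (n : Fin 2 → ℤ) (i : Fin 2) :
    ((2 * Real.pi) • ((n 0 : ℝ) • ContinuousLinearMap.proj 0 +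
      (n 1 : ℝ) • ContinuousLinearMap.proj 1 : (Fin 2 → ℝ) →L[ℝ] ℝ)) (Pi.single i 1) =
      2 * Real.pi * n i := by
  fin_cases i <;> simp

theorem d_cosMon (n : Fin 2 → ℤ) (i : Fin 2) :
    Per.d i (cosMon n) = (-(2 * Real.pi * n i)) • sinMon n := by
  refine Per.ext fun x => ?_
  rw [Per.d_apply, Per.smul_apply]
  have : HasFDerivAt (cosMon n) _ x := (hasFDerivAt_phase n x).cos
  rw [this.fderiv, _root_.smul_apply, phase_deriv_apply]
  simp [sinMon]
  ring

theorem d_sinMon (n : Fin 2 → ℤ) (i : Fin 2) :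
    Per.d i (sinMon n) = (2 * Real.pi * n i) • cosMon n := by
  refine Per.ext fun x => ?_
  rw [Per.d_apply, Per.smul_apply]
  have : HasFDerivAt (sinMon n) _ x := (hasFDerivAt_phase n x).sin
  rw [this.fderiv, _root_.smul_apply, phase_deriv_apply]
  simp [cosMon]
  ring

/-- The space of real trigonometric polynomials of degree at most `N`. -/
def trigPoly (N : ℕ) : Submodule ℝ (Per (1 : Fin 2 → ℝ)) :=
  Submodule.span ℝ (cosMon '' {n | ∀ i, |n i| ≤ N} ∪ sinMon '' {n | ∀ i, |n i| ≤ N})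

theorem finite_freq (N : ℕ) : {n : Fin 2 → ℤ | ∀ i, |n i| ≤ N}.Finite := by
  refine (finite_Icc (fun _ => -(N : ℤ)) (fun _ => (N : ℤ))).subset fun n hn => ?_
  exact ⟨fun i => (abs_le.1 (hn i)).1, fun i => (abs_le.1 (hn i)).2⟩

instance (N : ℕ) : FiniteDimensional ℝ (trigPoly N) :=
  FiniteDimensional.span_of_finite ℝ (((finite_freq N).image _).union ((finite_freq N).image _))

theorem cosMon_mem {n : Fin 2 → ℤ} {N : ℕ} (h : ∀ i, |n i| ≤ N) : cosMon n ∈ trigPoly N :=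
  Submodule.subset_span (Or.inl ⟨n, h, rfl⟩)

theorem sinMon_mem {n : Fin 2 → ℤ} {N : ℕ} (h : ∀ i, |n i| ≤ N) : sinMon n ∈ trigPoly N :=
  Submodule.subset_span (Or.inr ⟨n, h, rfl⟩)

theorem one_mem_trigPoly (N : ℕ) : (1 : Per (1 : Fin 2 → ℝ)) ∈ trigPoly N := by
  have : (1 : Per (1 : Fin 2 → ℝ)) = cosMon 0 := Per.ext fun x => by simp [cosMon, phase]
  rw [this]
  exact cosMon_mem fun i => by simp

theorem d_mem_trigPoly {N : ℕ} (i : Fin 2) {u : Per (1 : Fin 2 → ℝ)} (hu : u ∈ trigPoly N) :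
    Per.d i u ∈ trigPoly N := by
  induction hu using Submodule.span_induction with
  | mem u hu =>
    rcases hu with ⟨n, hn, rfl⟩ | ⟨n, hn, rfl⟩
    · rw [d_cosMon]; exact Submodule.smul_mem _ _ (sinMon_mem hn)
    · rw [d_sinMon]; exact Submodule.smul_mem _ _ (cosMon_mem hn)
  | zero => rw [map_zero]; exact Submodule.zero_mem _
  | add u v _ _ hu hv => rw [map_add]; exact Submodule.add_mem _ hu hv
  | smul r u _ hu => rw [Derivation.map_smul]; exact Submodule.smul_mem _ _ hu

/-! ### Galerkin approximations of an elliptic equation in divergence form -/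

section Galerkin

open Per

/-- A periodic function with vanishing gradient is constant. -/
theorem eq_const_of_d_eq_zero {u : Per (1 : Fin 2 → ℝ)} (h : ∀ i x, d i u x = 0)
    (x y : Fin 2 → ℝ) : u x = u y := by
  refine is_const_of_fderiv_eq_zero u.differentiable (fun z => ?_) x y
  ext v
  rw [fderiv_apply]
  simp [h]

variable (a : Fin 2 → Fin 2 → Per (1 : Fin 2 → ℝ))

/-- The vector field `a ∇u - F`. -/
def flux (F : Fin 2 → Per (1 : Fin 2 → ℝ)) (u : Per (1 : Fin 2 → ℝ)) (i : Fin 2) :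
    Per (1 : Fin 2 → ℝ) := ∑ j, a i j * d j u - F i

/-- `u` solves the equation `div (a ∇u - F) = 0` weakly on trigonometric polynomials of
degree at most `N`. -/
def IsGalerkin (F : Fin 2 → Per (1 : Fin 2 → ℝ)) (N : ℕ) (u : Per (1 : Fin 2 → ℝ)) : Prop :=
  u ∈ trigPoly N ∧ ∀ φ ∈ trigPoly N, int (∑ i, flux a F u i * d i φ) = 0

/-- Uniform ellipticity of the coefficient matrix. -/
def Elliptic (κ : ℝ) : Prop :=
  ∀ x (ξ : Fin 2 → ℝ), κ * ∑ i, ξ i ^ 2 ≤ ∑ i, ∑ j, a i j x * ξ j * ξ i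

variable {a}

/-- Galerkin solutions exist: adding `u(0) φ(0)` to the bilinear form makes it nondegenerate on the
finite-dimensional space of trigonometric polynomials, and testing with `φ = 1` then gives
`u(0) = 0`. -/
theorem exists_isGalerkin {κ : ℝ} (hκ : 0 < κ) (ha : Elliptic a κ)
    (F : Fin 2 → Per (1 : Fin 2 → ℝ)) (N : ℕ) : ∃ u, IsGalerkin a F N u ∧ u 0 = 0 := by
  let B : trigPoly N →ₗ[ℝ] Module.Dual ℝ (trigPoly N) := LinearMap.mk₂ ℝ
    (fun u φ => int (∑ i, (∑ j, a i j * d j u.1) * d i φ.1) + u.1 0 * φ.1 0)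
    (fun u v φ => by
      simp only [Submodule.coe_add, map_add, add_apply, mul_add, add_mul, Finset.sum_add_distrib]
      ring)
    (fun r u φ => by
      simp only [Submodule.coe_smul, Derivation.map_smul, smul_apply, mul_smul_comm,
        smul_mul_assoc, ← Finset.smul_sum, map_smul, smul_eq_mul]
      ring)
    (fun u v φ => by
      simp only [Submodule.coe_add, map_add, add_apply, mul_add, Finset.sum_add_distrib]
      ring)
    (fun r u φ => by
      simp only [Submodule.coe_smul, Derivation.map_smul, smul_apply, mul_smul_comm,
        ← Finset.smul_sum, map_smul, smul_eq_mul]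
      ring)
  have hB : ∀ u φ, B u φ = int (∑ i, (∑ j, a i j * d j u.1) * d i φ.1) + u.1 0 * φ.1 0 :=
    fun u φ => rfl
  have hinj : Function.Injective B := by
    rw [injective_iff_map_eq_zero]
    intro u hu
    have h1 : B u u = 0 := by rw [hu]; rfl
    rw [hB] at h1
    have hle : int (κ • ∑ i, d i u.1 ^ 2) ≤ int (∑ i, (∑ j, a i j * d j u.1) * d i u.1) := by
      refine int_mono fun x => ?_
      have := ha x fun i => d i u.1 x
      simpa [Finset.sum_mul, mul_add, add_mul] using this
    have hnn : ∀ x, 0 ≤ (κ • ∑ i, d i u.1 ^ 2) x := fun x => by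
      simp only [Per.smul_apply, Per.sum_apply, pow_apply]
      positivity
    have h0 := int_nonneg hnn
    have hu0 : u.1 0 = 0 := by nlinarith [mul_self_nonneg (u.1 0)]
    have hz := eq_zero_of_int_le one_pos' hnn (by nlinarith [mul_self_nonneg (u.1 0)])
    have hd : ∀ i x, d i u.1 x = 0 := by
      intro i x
      have := hz x
      simp only [Per.smul_apply, Fin.sum_univ_two] at this
      have h3 : d 0 u.1 x ^ 2 + d 1 u.1 x ^ 2 = 0 := by
        rcases mul_eq_zero.1 this with h | h
        · exact absurd h hκ.ne'
        · exact h
      fin_cases i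
      · exact pow_eq_zero_iff two_ne_zero |>.1 (by
          nlinarith [sq_nonneg (d 0 u.1 x), sq_nonneg (d 1 u.1 x)] : d 0 u.1 x ^ 2 = 0)
      · exact pow_eq_zero_iff two_ne_zero |>.1 (by
          nlinarith [sq_nonneg (d 0 u.1 x), sq_nonneg (d 1 u.1 x)] : d 1 u.1 x ^ 2 = 0)
    exact Subtype.ext (Per.ext fun x => by rw [eq_const_of_d_eq_zero hd x 0, hu0]; rfl)
  have hsurj : Function.Surjective B :=
    (LinearMap.injective_iff_surjective_of_finrank_eq_finrank
      (Subspace.dual_finrank_eq (K := ℝ)).symm).1 hinj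
  let ℓ : Module.Dual ℝ (trigPoly N) :=
    { toFun := fun φ => int (∑ i, F i * d i φ.1)
      map_add' := fun u v => by
        simp only [Submodule.coe_add, map_add, mul_add, Finset.sum_add_distrib]
      map_smul' := fun r u => by
        simp only [Submodule.coe_smul, Derivation.map_smul, mul_smul_comm, ← Finset.smul_sum,
          map_smul, RingHom.id_apply] }
  obtain ⟨u, hu⟩ := hsurj ℓ
  have hφ : ∀ φ, B u φ = ℓ φ := fun φ => by rw [hu]
  have h0 : u.1 0 = 0 := by
    have h1 := hφ ⟨1, one_mem_trigPoly N⟩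
    rw [hB] at h1
    simpa [ℓ] using h1
  refine ⟨u.1, ⟨u.2, fun φ hφN => ?_⟩, h0⟩
  have h1 := hφ ⟨φ, hφN⟩
  rw [hB, h0, zero_mul, add_zero] at h1
  simp only [flux, sub_mul, Finset.sum_sub_distrib, map_sub]
  exact sub_eq_zero.2 h1

/-- Derivatives of Galerkin solutions solve Galerkin equations, because the space of test functions
is invariant under partial derivatives. -/
theorem IsGalerkin.d {F : Fin 2 → Per (1 : Fin 2 → ℝ)} {N : ℕ} {u : Per (1 : Fin 2 → ℝ)}
    (h : IsGalerkin a F N u) (k : Fin 2) :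
    IsGalerkin a (fun i => Per.d k (F i) - ∑ j, Per.d k (a i j) * Per.d j u) N (Per.d k u) := by
  refine ⟨d_mem_trigPoly k h.1, fun φ hφ => ?_⟩
  have hflux : ∀ i, flux a (fun i => Per.d k (F i) - ∑ j, Per.d k (a i j) * Per.d j u)
      (Per.d k u) i = Per.d k (flux a F u i) := by
    intro i
    simp only [flux, map_sub, map_sum, Derivation.leibniz, smul_eq_mul,
      Finset.sum_add_distrib, d_comm k]
    simp only [mul_comm (Per.d _ u)]
    ring
  simp only [hflux, map_sum, int_d_mul one_pos', Finset.sum_neg_distrib, d_comm k]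
  have := h.2 _ (d_mem_trigPoly k hφ)
  rw [map_sum] at this
  rw [this, neg_zero]

/-- The energy estimate, obtained by testing with `u` itself. -/
theorem IsGalerkin.energy {κ : ℝ} (hκ : 0 < κ) (ha : Elliptic a κ)
    {F : Fin 2 → Per (1 : Fin 2 → ℝ)} {N : ℕ} {u : Per (1 : Fin 2 → ℝ)}
    (h : IsGalerkin a F N u) :
    ∑ i, int (Per.d i u * Per.d i u) ≤ (κ⁻¹) ^ 2 * ∑ i, int (F i * F i) := by
  have h1 := h.2 u h.1
  have h2 : int (κ • ∑ i, Per.d i u * Per.d i u - κ⁻¹ • ∑ i, F i * F i) ≤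
      int ((2 : ℝ) • ∑ i, flux a F u i * Per.d i u) := by
    refine int_mono fun x => ?_
    have h3 := ha x fun i => Per.d i u x
    have h4 : ∀ i, κ⁻¹ * (F i x * F i x) - 2 * (F i x * Per.d i u x) +
        κ * (Per.d i u x * Per.d i u x) = κ⁻¹ * (F i x - κ * Per.d i u x) ^ 2 := fun i => by
      field_simp; ring
    have h5 : ∀ i, 0 ≤ κ⁻¹ * (F i x - κ * Per.d i u x) ^ 2 := fun i => by positivity
    have h60 := h4 0 ▸ h5 0
    have h61 := h4 1 ▸ h5 1
    simp only [Fin.sum_univ_two, flux, smul_apply, sub_apply, add_apply, mul_apply] at h3 ⊢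
    nlinarith
  rw [map_sub, map_smul, map_smul, map_smul, h1, map_sum, map_sum, smul_eq_mul, smul_eq_mul,
    smul_zero, sub_nonpos] at h2
  calc ∑ i, int (Per.d i u * Per.d i u) = κ⁻¹ * (κ * ∑ i, int (Per.d i u * Per.d i u)) := by
        field_simp
    _ ≤ κ⁻¹ * (κ⁻¹ * ∑ i, int (F i * F i)) := by gcongr
    _ = _ := by ring

end Galerkin

/-! ### Sequences with bounded derivatives in the mean -/

section Bounded

open Per

/-- All derivatives of order at most `k` of the members of the sequence `w` are bounded in `L²`. -/
def BddDeriv : ℕ → (ℕ → Per (1 : Fin 2 → ℝ)) → Prop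
  | 0, w => ∃ C, ∀ N, int (w N * w N) ≤ C
  | k + 1, w => (∃ C, ∀ N, int (w N * w N) ≤ C) ∧ ∀ i, BddDeriv k fun N => d i (w N)

theorem BddDeriv.zero {k : ℕ} {w : ℕ → Per (1 : Fin 2 → ℝ)} (h : BddDeriv k w) :
    ∃ C, ∀ N, int (w N * w N) ≤ C := by
  cases k with
  | zero => exact h
  | succ k => exact h.1

theorem BddDeriv.of_succ {k : ℕ} : ∀ {w : ℕ → Per (1 : Fin 2 → ℝ)}, BddDeriv (k + 1) w →
    BddDeriv k w := by
  induction k with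
  | zero => exact fun h => h.1
  | succ k ih => exact fun h => ⟨h.1, fun i => ih (h.2 i)⟩

theorem BddDeriv.add {k : ℕ} : ∀ {v w : ℕ → Per (1 : Fin 2 → ℝ)}, BddDeriv k v → BddDeriv k w →
    BddDeriv k fun N => v N + w N := by
  have h0 : ∀ {v w : ℕ → Per (1 : Fin 2 → ℝ)}, (∃ C, ∀ N, int (v N * v N) ≤ C) →
      (∃ C, ∀ N, int (w N * w N) ≤ C) → ∃ C, ∀ N, int ((v N + w N) * (v N + w N)) ≤ C := by
    rintro v w ⟨C, hC⟩ ⟨D, hD⟩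
    refine ⟨2 * C + 2 * D, fun N => ?_⟩
    have : int ((v N + w N) * (v N + w N)) ≤
        int ((2 : ℝ) • (v N * v N) + (2 : ℝ) • (w N * w N)) := int_mono fun x => by
      simp only [mul_apply, add_apply, smul_apply]
      nlinarith [sq_nonneg (v N x - w N x)]
    rw [map_add, map_smul, map_smul, smul_eq_mul, smul_eq_mul] at this
    linarith [hC N, hD N]
  induction k with
  | zero => exact fun hv hw => h0 hv hw
  | succ k ih =>
    intro v w hv hw
    refine ⟨h0 hv.1 hw.1, fun i => ?_⟩
    simp only [map_add]
    exact ih (hv.2 i) (hw.2 i)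

theorem BddDeriv.mul_left {k : ℕ} : ∀ (g : Per (1 : Fin 2 → ℝ)) {w : ℕ → Per (1 : Fin 2 → ℝ)},
    BddDeriv k w → BddDeriv k fun N => g * w N := by
  have h0 : ∀ (g : Per (1 : Fin 2 → ℝ)) {w : ℕ → Per (1 : Fin 2 → ℝ)},
      (∃ C, ∀ N, int (w N * w N) ≤ C) → ∃ C, ∀ N, int ((g * w N) * (g * w N)) ≤ C := by
    rintro g w ⟨C, hC⟩
    obtain ⟨D, hD0, hD⟩ := exists_bound one_pos' g
    refine ⟨D ^ 2 * C, fun N => ?_⟩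
    have : int ((g * w N) * (g * w N)) ≤ int ((D ^ 2) • (w N * w N)) := int_mono fun x => by
      simp only [mul_apply, smul_apply]
      have h1 : g x ^ 2 ≤ D ^ 2 := sq_le_sq' (abs_le.1 (hD x)).1 (abs_le.1 (hD x)).2
      nlinarith [mul_le_mul_of_nonneg_right h1 (mul_self_nonneg (w N x))]
    rw [map_smul, smul_eq_mul] at this
    exact this.trans (by gcongr; exact hC N)
  induction k with
  | zero => exact fun g w h => h0 g h
  | succ k ih =>
    refine fun g w h => ⟨h0 g h.1, fun i => ?_⟩
    simp only [Derivation.leibniz, smul_eq_mul]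
    refine (ih g (h.2 i)).add ?_
    simp only [mul_comm (w _)]
    exact ih _ h.of_succ

theorem BddDeriv.const {k : ℕ} : ∀ (g : Per (1 : Fin 2 → ℝ)), BddDeriv k fun _ => g := by
  induction k with
  | zero => exact fun g => ⟨_, fun _ => le_rfl⟩
  | succ k ih => exact fun g => ⟨⟨_, fun _ => le_rfl⟩, fun i => ih _⟩

/-- Elliptic regularity for Galerkin approximations: the derivatives of all orders are bounded,
uniformly in the degree. In the induction, `∂ⱼ u` solves the equation whose right-hand side
`∂ⱼ F - (∂ⱼ a) ∇u` is controlled by the bounds already obtained. -/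
theorem bddDeriv_of_isGalerkin {a : Fin 2 → Fin 2 → Per (1 : Fin 2 → ℝ)} {κ : ℝ} (hκ : 0 < κ)
    (ha : Elliptic a κ) (k : ℕ) : ∀ {F : Fin 2 → ℕ → Per (1 : Fin 2 → ℝ)}
    {u : ℕ → Per (1 : Fin 2 → ℝ)}, (∀ N, IsGalerkin a (fun i => F i N) N (u N)) →
    (∀ i, BddDeriv k (F i)) → ∀ i, BddDeriv k fun N => d i (u N) := by
  have h0 : ∀ {F : Fin 2 → ℕ → Per (1 : Fin 2 → ℝ)} {u : ℕ → Per (1 : Fin 2 → ℝ)},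
      (∀ N, IsGalerkin a (fun i => F i N) N (u N)) →
      (∀ i, ∃ C, ∀ N, int (F i N * F i N) ≤ C) →
      ∀ i, ∃ C, ∀ N, int (d i (u N) * d i (u N)) ≤ C := by
    intro F u hu hF i
    choose C hC using hF
    refine ⟨(κ⁻¹) ^ 2 * ∑ i, C i, fun N => ?_⟩
    refine le_trans ?_ (((hu N).energy hκ ha).trans (by gcongr with i; exact hC i N))
    exact Finset.single_le_sum (f := fun i => int (d i (u N) * d i (u N)))
      (fun i _ => int_nonneg fun x => mul_self_nonneg _) (Finset.mem_univ i)
  induction k with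
  | zero => exact fun hu hF i => h0 hu hF i
  | succ k ih =>
    intro F u hu hF i
    refine ⟨h0 hu (fun i => (hF i).zero) i, fun j => ?_⟩
    have h1 := ih hu (fun i => (hF i).of_succ)
    simp only [d_comm j i]
    refine ih (F := fun i N => d j (F i N) - ∑ l, d j (a i l) * d l (u N))
      (fun N => (hu N).d j) (fun i => ?_) i
    have : (fun N => d j (F i N) - ∑ l, d j (a i l) * d l (u N)) = fun N => d j (F i N) +
        (-d j (a i 0) * d 0 (u N) + -d j (a i 1) * d 1 (u N)) := by
      funext N
      rw [Fin.sum_univ_two]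
      ring
    rw [this]
    exact ((hF i).2 j).add (((h1 0).mul_left _).add ((h1 1).mul_left _))

end Bounded

end

section

open MeasureTheory Set Filter Per

/-! ### A Sobolev inequality on the torus -/

theorem abs_le_integral_of_deriv {h h' : ℝ → ℝ} (hh : ∀ s, HasDerivAt h (h' s) s)
    (hc : Continuous h') {s : ℝ} (hs : s ∈ Icc (0 : ℝ) 1) :
    |h s| ≤ ∫ r in Icc (0 : ℝ) 1, (|h r| + |h' r|) := by
  have hch : Continuous h := continuous_iff_continuousAt.2 fun t => (hh t).continuousAt
  have hi1 : IntegrableOn (fun r => |h r|) (Icc (0 : ℝ) 1) :=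
    hch.abs.continuousOn.integrableOn_compact isCompact_Icc
  have hi2 : IntegrableOn (fun r => |h' r|) (Icc (0 : ℝ) 1) :=
    hc.abs.continuousOn.integrableOn_compact isCompact_Icc
  have hvol : (volume (Icc (0 : ℝ) 1)).toReal = 1 := by simp
  set A := ∫ r in Icc (0 : ℝ) 1, |h' r|
  have key : ∀ r ∈ Icc (0 : ℝ) 1, |h s| - A ≤ |h r| := by
    intro r hr
    have h1 : h s - h r = ∫ τ in r..s, h' τ :=
      (intervalIntegral.integral_eq_sub_of_hasDerivAt (fun τ _ => hh τ)
        (hc.intervalIntegrable _ _)).symm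
    have h2 : |h s - h r| ≤ A := by
      rw [h1, ← Real.norm_eq_abs]
      refine (intervalIntegral.norm_integral_le_integral_norm_uIoc).trans ?_
      refine setIntegral_mono_set hi2 (ae_of_all _ fun τ => abs_nonneg _) ?_
      exact (uIoc_subset_uIcc.trans (uIcc_subset_Icc hr hs)).eventuallyLE
    have := abs_sub_abs_le_abs_sub (h s) (h r)
    linarith
  have h3 : ∫ _ in Icc (0 : ℝ) 1, (|h s| - A) ≤ ∫ r in Icc (0 : ℝ) 1, |h r| :=
    setIntegral_mono_on (integrableOn_const (by simp)) hi1 measurableSet_Icc key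
  rw [setIntegral_const, Measure.real, hvol, one_smul] at h3
  rw [integral_add hi1 hi2]
  linarith

theorem int_eq_iterated {h : (Fin 2 → ℝ) → ℝ} (hc : Continuous h) :
    ∫ x in Icc (0 : Fin 2 → ℝ) 1, h x =
      ∫ s in Icc (0 : ℝ) 1, ∫ r in Icc (0 : ℝ) 1, h ![s, r] := by
  have hcm : Continuous fun q : ℝ × ℝ => h ![q.1, q.2] := by
    refine hc.comp (continuous_pi fun i => ?_)
    fin_cases i
    · exact continuous_fst
    · exact continuous_snd
  have h1 := (volume_preserving_finTwoArrow ℝ).setIntegral_preimage_emb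
    MeasurableEquiv.finTwoArrow.measurableEmbedding (fun q : ℝ × ℝ => h ![q.1, q.2])
    (Icc (0 : ℝ) 1 ×ˢ Icc (0 : ℝ) 1)
  have h2 : (MeasurableEquiv.finTwoArrow : (Fin 2 → ℝ) ≃ᵐ ℝ × ℝ) ⁻¹'
      (Icc (0 : ℝ) 1 ×ˢ Icc (0 : ℝ) 1) = Icc (0 : Fin 2 → ℝ) 1 := by
    ext x
    simp only [mem_preimage, mem_prod, mem_Icc, Pi.le_def, Fin.forall_fin_two,
      MeasurableEquiv.finTwoArrow_apply, Pi.zero_apply, Pi.one_apply]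
    tauto
  rw [h2] at h1
  have h3 : ∀ x : Fin 2 → ℝ, h ![(MeasurableEquiv.finTwoArrow x).1,
      (MeasurableEquiv.finTwoArrow x).2] = h x := fun x => by
    congr 1
    funext i
    fin_cases i <;> rfl
  simp only [h3] at h1
  rw [h1, Measure.volume_eq_prod, setIntegral_prod]
  exact hcm.continuousOn.integrableOn_compact (isCompact_Icc.prod isCompact_Icc)

theorem hasDerivAt_fst (w : Per (1 : Fin 2 → ℝ)) (s r : ℝ) :
    HasDerivAt (fun s => w ![s, r]) (d 0 w ![s, r]) s := by
  have h1 : HasDerivAt (fun s : ℝ => (![s, r] : Fin 2 → ℝ)) (Pi.single 0 1) s := by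
    rw [hasDerivAt_pi]
    intro i
    fin_cases i
    · exact hasDerivAt_id s
    · simpa using hasDerivAt_const s r
  exact (w.differentiable _).hasFDerivAt.comp_hasDerivAt s h1

theorem hasDerivAt_snd (w : Per (1 : Fin 2 → ℝ)) (s r : ℝ) :
    HasDerivAt (fun r => w ![s, r]) (d 1 w ![s, r]) r := by
  have h1 : HasDerivAt (fun r : ℝ => (![s, r] : Fin 2 → ℝ)) (Pi.single 1 1) r := by
    rw [hasDerivAt_pi]
    intro i
    fin_cases i
    · simpa using hasDerivAt_const r s
    · exact hasDerivAt_id r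
  exact (w.differentiable _).hasFDerivAt.comp_hasDerivAt r h1

/-- The supremum is controlled by the `L²` norms of `w`, `∂₀w`, `∂₁w` and `∂₁∂₀w`: the
one-dimensional estimate is applied in each variable, and `|t| ≤ 1 + t²`. -/
theorem abs_le_sobolev (w : Per (1 : Fin 2 → ℝ)) (x : Fin 2 → ℝ) :
    |w x| ≤ int (4 + w * w + d 0 w * d 0 w + d 1 w * d 1 w + d 1 (d 0 w) * d 1 (d 0 w)) := by
  obtain ⟨y, hy, hyx⟩ := exists_mem_Icc one_pos' x
  rw [← hyx w]
  have hy2 : y = ![y 0, y 1] := by funext i; fin_cases i <;> rfl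
  have hm1 : ∀ s : ℝ, Continuous fun r : ℝ => (![s, r] : Fin 2 → ℝ) := fun s => by fun_prop
  have hm0 : ∀ r : ℝ, Continuous fun s : ℝ => (![s, r] : Fin 2 → ℝ) := fun s => by fun_prop
  have h1 : |w y| ≤ ∫ s in Icc (0 : ℝ) 1, (|w ![s, y 1]| + |d 0 w ![s, y 1]|) := by
    conv_lhs => rw [hy2]
    exact abs_le_integral_of_deriv (h := fun s => w ![s, y 1]) (h' := fun s => d 0 w ![s, y 1])
      (fun s => hasDerivAt_fst w s _) ((d 0 w).continuous.comp (hm0 _)) ⟨hy.1 0, hy.2 0⟩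
  set g : (Fin 2 → ℝ) → ℝ := fun z => (|w z| + |d 1 w z|) + (|d 0 w z| + |d 1 (d 0 w) z|)
  have hg : Continuous g := (w.continuous.abs.add (d 1 w).continuous.abs).add
    ((d 0 w).continuous.abs.add (d 1 (d 0 w)).continuous.abs)
  have h2 : ∀ s, |w ![s, y 1]| + |d 0 w ![s, y 1]| ≤ ∫ r in Icc (0 : ℝ) 1, g ![s, r] := by
    intro s
    have e1 : ∀ v : Per (1 : Fin 2 → ℝ), IntegrableOn (fun r => |v ![s, r]| + |d 1 v ![s, r]|)
        (Icc (0 : ℝ) 1) := fun v =>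
      (((v.continuous.comp (hm1 s)).abs.add ((d 1 v).continuous.comp (hm1 s)).abs).continuousOn
        ).integrableOn_compact isCompact_Icc
    have e2 : ∀ v : Per (1 : Fin 2 → ℝ), |v ![s, y 1]| ≤
        ∫ r in Icc (0 : ℝ) 1, (|v ![s, r]| + |d 1 v ![s, r]|) := fun v =>
      abs_le_integral_of_deriv (h := fun r => v ![s, r]) (h' := fun r => d 1 v ![s, r])
        (fun r => hasDerivAt_snd v s r) ((d 1 v).continuous.comp (hm1 s)) ⟨hy.1 1, hy.2 1⟩
    have := integral_add (e1 w) (e1 (d 0 w))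
    simp only [g]
    rw [this]
    exact add_le_add (e2 w) (e2 (d 0 w))
  have hgc : Continuous fun s => ∫ r in Icc (0 : ℝ) 1, g ![s, r] := by
    refine continuous_parametric_integral_of_continuous ?_ isCompact_Icc
    refine hg.comp (continuous_pi fun i => ?_)
    fin_cases i
    · exact continuous_fst
    · exact continuous_snd
  have h3 : |w y| ≤ ∫ x in Icc (0 : Fin 2 → ℝ) 1, g x := by
    rw [int_eq_iterated hg]
    refine h1.trans (setIntegral_mono ?_ (hgc.continuousOn.integrableOn_compact isCompact_Icc) h2)
    exact ((w.continuous.comp (hm0 _)).abs.add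
      ((d 0 w).continuous.comp (hm0 _)).abs).continuousOn.integrableOn_compact isCompact_Icc
  refine h3.trans (setIntegral_mono (hg.continuousOn.integrableOn_compact isCompact_Icc)
    (integrableOn _) fun z => ?_)
  have hq : ∀ t : ℝ, |t| ≤ 1 + t * t := fun t => by
    rw [← abs_mul_abs_self t]; nlinarith [sq_nonneg (|t| - 1 / 2)]
  have h4 : (4 : Per (1 : Fin 2 → ℝ)) z = 4 := rfl
  simp only [g, Per.add_apply, Per.mul_apply, h4]
  linarith [hq (w z), hq (d 0 w z), hq (d 1 w z), hq (d 1 (d 0 w) z)]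

/-! ### Limits of sequences with bounded derivatives -/

/-- The iterated partial derivative along a word of indices. -/
def dw (l : List (Fin 2)) (h : Per (1 : Fin 2 → ℝ)) : Per (1 : Fin 2 → ℝ) :=
  l.foldr (fun i h => d i h) h

theorem dw_cons (i : Fin 2) (l : List (Fin 2)) (h : Per (1 : Fin 2 → ℝ)) :
    dw (i :: l) h = d i (dw l h) := rfl

theorem le_abs_add_abs (C : Fin 2 → ℝ) (i : Fin 2) : C i ≤ |C 0| + |C 1| := by
  have h0 := abs_nonneg (C 0)
  have h1 := abs_nonneg (C 1)
  fin_cases i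
  · exact (le_abs_self (C 0)).trans (by linarith)
  · exact (le_abs_self (C 1)).trans (by linarith)

theorem abs_sub_le_of_d_le {w : Per (1 : Fin 2 → ℝ)} {C : ℝ} (h : ∀ i x, |d i w x| ≤ C)
    (x y : Fin 2 → ℝ) : |w y - w x| ≤ 2 * C * ‖y - x‖ := by
  have hC : 0 ≤ C := (abs_nonneg _).trans (h 0 x)
  refine convex_univ.norm_image_sub_le_of_norm_fderiv_le (𝕜 := ℝ)
    (fun z _ => w.differentiable z) (fun z _ => ?_) (mem_univ x) (mem_univ y)
  refine ContinuousLinearMap.opNorm_le_bound _ (by positivity) fun v => ?_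
  rw [Per.fderiv_apply, Fin.sum_univ_two, Real.norm_eq_abs]
  have e : ∀ i, |v i * d i w z| ≤ ‖v‖ * C := fun i => by
    rw [abs_mul]
    exact mul_le_mul (norm_le_pi_norm v i) (h i z) (abs_nonneg _) (norm_nonneg _)
  linarith [abs_add_le (v 0 * d 0 w z) (v 1 * d 1 w z), e 0, e 1]

theorem taylor_of_d_le {w : Per (1 : Fin 2 → ℝ)} {C : ℝ} (h : ∀ i j x, |d i (d j w) x| ≤ C)
    (x y : Fin 2 → ℝ) : |w y - w x - ∑ i, (y - x) i * d i w x| ≤ 4 * C * ‖y - x‖ * ‖y - x‖ := by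
  have hC : 0 ≤ C := (abs_nonneg _).trans (h 0 0 x)
  rw [← Per.fderiv_apply]
  refine (convex_closedBall x ‖y - x‖).norm_image_sub_le_of_norm_hasFDerivWithin_le'
    (fun z _ => (w.differentiable z).hasFDerivAt.hasFDerivWithinAt) (fun z hz => ?_)
    (Metric.mem_closedBall_self (norm_nonneg _)) (by rw [Metric.mem_closedBall, dist_eq_norm])
  rw [Metric.mem_closedBall, dist_eq_norm] at hz
  refine ContinuousLinearMap.opNorm_le_bound _ (by positivity) fun v => ?_
  rw [_root_.sub_apply, Per.fderiv_apply, Per.fderiv_apply, Fin.sum_univ_two, Fin.sum_univ_two,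
    Real.norm_eq_abs]
  have e : ∀ i, |v i * (d i w z - d i w x)| ≤ ‖v‖ * (2 * C * ‖y - x‖) := fun i => by
    rw [abs_mul]
    refine mul_le_mul (norm_le_pi_norm v i) ?_ (abs_nonneg _) (norm_nonneg _)
    exact (abs_sub_le_of_d_le (fun j x => h j i x) x z).trans (by gcongr)
  have := abs_add_le (v 0 * (d 0 w z - d 0 w x)) (v 1 * (d 1 w z - d 1 w x))
  calc |v 0 * d 0 w z + v 1 * d 1 w z - (v 0 * d 0 w x + v 1 * d 1 w x)|
      = |v 0 * (d 0 w z - d 0 w x) + v 1 * (d 1 w z - d 1 w x)| := by ring_nf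
    _ ≤ 4 * C * ‖y - x‖ * ‖v‖ := by linarith [e 0, e 1]

/-- A sequence all of whose derivatives are uniformly bounded converges, along an ultrafilter,
to a smooth function, together with all derivatives. -/
theorem exists_limit (𝒰 : Ultrafilter ℕ) {u : ℕ → Per (1 : Fin 2 → ℝ)}
    (hu : ∀ l, ∃ C, ∀ N x, |dw l (u N) x| ≤ C) :
    ∃ U : Per (1 : Fin 2 → ℝ), ∀ l x, Tendsto (fun N => dw l (u N) x) 𝒰 (𝓝 (dw l U x)) := by
  have hlim : ∀ l x, ∃ y, Tendsto (fun N => dw l (u N) x) 𝒰 (𝓝 y) := by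
    intro l x
    obtain ⟨C, hC⟩ := hu l
    have hmem : ((𝒰.map fun N => dw l (u N) x : Ultrafilter ℝ) : Filter ℝ) ≤ 𝓟 (Icc (-C) C) := by
      rw [le_principal_iff]
      exact Filter.mem_map.2 (Filter.Eventually.of_forall fun N => abs_le.1 (hC N x))
    obtain ⟨y, -, hy⟩ := isCompact_Icc.ultrafilter_le_nhds _ hmem
    exact ⟨y, hy⟩
  choose ℓ hℓ using hlim
  -- the Taylor estimate passes to the limit
  have hder : ∀ l x, HasFDerivAt (ℓ l)
      (∑ i, ℓ (i :: l) x • (ContinuousLinearMap.proj i : (Fin 2 → ℝ) →L[ℝ] ℝ)) x := by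
    intro l x
    choose C hC using fun i j : Fin 2 => hu (i :: j :: l)
    set D := ∑ i, ∑ j, |C i j|
    have hD : ∀ N i j x, |d i (d j (dw l (u N))) x| ≤ D := fun N i j x =>
      ((hC i j N x).trans (le_abs_self _)).trans
        ((Finset.single_le_sum (f := fun j => |C i j|) (fun j _ => abs_nonneg _)
          (Finset.mem_univ j)).trans
        (Finset.single_le_sum (f := fun i => ∑ j, |C i j|)
          (fun i _ => Finset.sum_nonneg fun j _ => abs_nonneg _) (Finset.mem_univ i)))
    have hT : ∀ y, |ℓ l y - ℓ l x - ∑ i, (y - x) i * ℓ (i :: l) x| ≤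
        4 * D * ‖y - x‖ * ‖y - x‖ := by
      intro y
      refine le_of_tendsto (((hℓ l y).sub (hℓ l x)).sub
        (tendsto_finsetSum _ fun i _ => (hℓ (i :: l) x).const_mul ((y - x) i))).abs
        (Filter.Eventually.of_forall fun N => ?_)
      exact taylor_of_d_le (hD N) x y
    rw [hasFDerivAt_iff_isLittleO]
    have hO : (fun y => ℓ l y - ℓ l x - (∑ i, ℓ (i :: l) x •
        (ContinuousLinearMap.proj i : (Fin 2 → ℝ) →L[ℝ] ℝ)) (y - x)) =O[𝓝 x]
        fun y => ‖y - x‖ ^ 2 := by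
      refine Asymptotics.IsBigO.of_bound (4 * D) (Filter.Eventually.of_forall fun y => ?_)
      have := hT y
      rw [Real.norm_eq_abs, Real.norm_of_nonneg (sq_nonneg ‖y - x‖), pow_two, ← mul_assoc]
      convert this using 4
      simp [mul_comm]
    exact hO.trans_isLittleO (Asymptotics.isLittleO_pow_sub_sub x one_lt_two)
  have hsm : ∀ k : ℕ, ∀ l, ContDiff ℝ k (ℓ l) := by
    intro k
    induction k with
    | zero =>
      exact fun l => contDiff_zero.2
        (continuous_iff_continuousAt.2 fun x => (hder l x).continuousAt)
    | succ k ih =>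
      intro l
      rw [Nat.cast_add, Nat.cast_one, contDiff_succ_iff_fderiv]
      refine ⟨fun x => (hder l x).differentiableAt, fun hω => by simp at hω, ?_⟩
      rw [show fderiv ℝ (ℓ l) = fun x => ∑ i, ℓ (i :: l) x •
        (ContinuousLinearMap.proj i : (Fin 2 → ℝ) →L[ℝ] ℝ) from funext fun x => (hder l x).fderiv]
      exact ContDiff.sum fun i _ => (ih (i :: l)).smul contDiff_const
  have hper : ∀ i x, ℓ [] (x + Pi.single i ((1 : Fin 2 → ℝ) i)) = ℓ [] x := fun i x =>
    tendsto_nhds_unique (hℓ [] _) (by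
      refine (hℓ [] x).congr fun N => ?_
      rw [Per.periodic])
  let U : Per (1 : Fin 2 → ℝ) := Per.mk (ℓ []) (contDiff_infty.2 fun k => hsm k []) hper
  have hU : ∀ l x, dw l U x = ℓ l x := by
    intro l
    induction l with
    | nil => exact fun x => rfl
    | cons i l ih =>
      intro x
      rw [dw_cons, d_apply, show ⇑(dw l U) = ℓ l from funext ih, (hder l x).fderiv]
      fin_cases i <;> simp
  exact ⟨U, fun l x => by rw [hU]; exact hℓ l x⟩

/-- Pointwise convergence of equi-Lipschitz functions implies convergence of integrals. -/
theorem tendsto_int_mul {𝒰 : Filter ℕ} {w : ℕ → Per (1 : Fin 2 → ℝ)} {W : Per (1 : Fin 2 → ℝ)}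
    {C : ℝ} (hC : ∀ N i x, |d i (w N) x| ≤ C) (hw : ∀ x, Tendsto (fun N => w N x) 𝒰 (𝓝 (W x)))
    (φ : Per (1 : Fin 2 → ℝ)) : Tendsto (fun N => int (w N * φ)) 𝒰 (𝓝 (int (W * φ))) := by
  obtain ⟨B, hB0, hB⟩ := exists_bound one_pos' φ
  choose CW hCW0 hCW using fun i => exists_bound one_pos' (d i W)
  set K := |C| + CW 0 + CW 1 + 1
  have hK : 0 < K := by have := hCW0 0; have := hCW0 1; positivity
  have hI : (0 : ℝ) ≤ int (1 : Per (1 : Fin 2 → ℝ)) := int_nonneg fun x => zero_le_one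
  have hKw : ∀ N x y, |w N y - w N x| ≤ 2 * K * ‖y - x‖ := fun N => abs_sub_le_of_d_le fun i x => by
    have := hC N i x; have := hCW0 0; have := hCW0 1; have := le_abs_self C
    simp only [K]; linarith
  have hKW : ∀ x y, |W y - W x| ≤ 2 * K * ‖y - x‖ := abs_sub_le_of_d_le fun i x => by
    have h1 := (hCW i x).trans (le_abs_add_abs CW i)
    rw [abs_of_pos (hCW0 0), abs_of_pos (hCW0 1)] at h1
    have := abs_nonneg C
    simp only [K]; linarith
  rw [Metric.tendsto_nhds]
  intro ε hε
  set η := ε / (2 * (B * int (1 : Per (1 : Fin 2 → ℝ)) + 1))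
  have hη : 0 < η := by positivity
  obtain ⟨t, hts, htf, ht⟩ := (isCompact_Icc (a := (0 : Fin 2 → ℝ)) (b := 1)).finite_cover_balls
    (e := η / (8 * K)) (by positivity)
  have hev : ∀ᶠ N in 𝒰, ∀ x ∈ t, |w N x - W x| < η / 2 :=
    (eventually_all_finite htf).2 fun x _ => by
      have := (Metric.tendsto_nhds.1 (hw x)) (η / 2) (by positivity)
      simpa [Real.dist_eq] using this
  filter_upwards [hev] with N hN
  have hunif : ∀ x, |w N x - W x| ≤ η := by
    intro x
    obtain ⟨y, hy, hyx⟩ := exists_mem_Icc one_pos' x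
    rw [← hyx, ← hyx]
    obtain ⟨z, hz, hyz⟩ := mem_iUnion₂.1 (ht hy)
    rw [Metric.mem_ball, dist_eq_norm] at hyz
    have h1 := hKw N z y
    have h2 := hKW y z
    rw [norm_sub_rev] at h2
    have h3 : 2 * K * ‖y - z‖ ≤ η / 4 := by
      calc 2 * K * ‖y - z‖ ≤ 2 * K * (η / (8 * K)) := by gcongr
        _ = η / 4 := by field_simp; ring
    have h4 := hN z hz
    have h5 : w N y - W y = (w N y - w N z) + (w N z - W z) + (W z - W y) := by ring
    rw [h5]
    refine (abs_add_three _ _ _).trans ?_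
    linarith
  have hb : ∀ x, |w N x * φ x - W x * φ x| ≤ η * B := fun x => by
    rw [← sub_mul, abs_mul]
    exact mul_le_mul (hunif x) (hB x) (abs_nonneg _) hη.le
  have hup : int (w N * φ - W * φ) ≤ int ((η * B) • (1 : Per (1 : Fin 2 → ℝ))) :=
    int_mono fun x => by simpa using (abs_le.1 (hb x)).2
  have hlo : int ((-(η * B)) • (1 : Per (1 : Fin 2 → ℝ))) ≤ int (w N * φ - W * φ) :=
    int_mono fun x => by simpa using (abs_le.1 (hb x)).1
  rw [map_sub, map_smul, smul_eq_mul] at hup hlo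
  rw [Real.dist_eq]
  have hlt : η * B * int (1 : Per (1 : Fin 2 → ℝ)) < ε := by
    have : η * (2 * (B * int (1 : Per (1 : Fin 2 → ℝ)) + 1)) = ε := by
      simp only [η]; field_simp
    nlinarith [mul_nonneg hB0.le hI]
  rw [abs_lt]
  constructor <;> linarith

/-! ### Completeness of the trigonometric monomials -/

theorem mFourier_proj (n : Fin 2 → ℤ) (x : Fin 2 → ℝ) :
    UnitAddTorus.mFourier n (proj x) = (cosMon n x : ℂ) + (sinMon n x : ℂ) * Complex.I := by
  have h1 : UnitAddTorus.mFourier n (proj x) =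
      ∏ i, fourier (n i) ((x i : ℝ) : AddCircle (1 : ℝ)) := rfl
  rw [h1, Fin.prod_univ_two, fourier_coe_apply, fourier_coe_apply, ← Complex.exp_add]
  simp only [cosMon, sinMon, mk_apply, Complex.ofReal_cos, Complex.ofReal_sin]
  rw [← Complex.exp_mul_I, phase]
  congr 1
  push_cast
  ring

/-- A smooth periodic function which is orthogonal to all trigonometric monomials vanishes, since
these span a dense subspace of the continuous functions. -/
theorem eq_zero_of_orthogonal {R : Per (1 : Fin 2 → ℝ)} (hc : ∀ n, int (R * cosMon n) = 0)
    (hs : ∀ n, int (R * sinMon n) = 0) : R = 0 := by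
  set g : C(T2, ℂ) := ⟨fun p => (descend R p : ℂ),
    Complex.continuous_ofReal.comp (continuous_descend R)⟩
  have hproj : Continuous proj := isOpenQuotientMap_proj.continuous
  have hRc : Continuous fun x => (R x : ℂ) := Complex.continuous_ofReal.comp R.continuous
  have hint : ∀ φ : C(T2, ℂ), IntegrableOn (fun x => (R x : ℂ) * φ (proj x)) (Icc 0 1) := fun φ =>
    (hRc.mul (φ.continuous.comp hproj)).continuousOn.integrableOn_compact isCompact_Icc
  have horth : ∀ φ ∈ Submodule.span ℂ (range (UnitAddTorus.mFourier (d := Fin 2))),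
      ∫ x in Icc (0 : Fin 2 → ℝ) 1, (R x : ℂ) * φ (proj x) = 0 := by
    intro φ hφ
    induction hφ using Submodule.span_induction with
    | mem φ hφ =>
      obtain ⟨n, rfl⟩ := hφ
      have h1 : ∀ x, (R x : ℂ) * UnitAddTorus.mFourier n (proj x) =
          (((R * cosMon n) x : ℝ) : ℂ) + (((R * sinMon n) x : ℝ) : ℂ) * Complex.I := fun x => by
        rw [mFourier_proj, Per.mul_apply, Per.mul_apply]; push_cast; ring
      simp only [h1]
      have e : ∀ h : Per (1 : Fin 2 → ℝ), IntegrableOn (fun x => ((h x : ℝ) : ℂ)) (Icc 0 1) :=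
        fun h => (Complex.continuous_ofReal.comp h.continuous).continuousOn.integrableOn_compact
          isCompact_Icc
      rw [integral_add (e _) ((e _).mul_const _), integral_mul_const, integral_complex_ofReal,
        integral_complex_ofReal, ← int_def, ← int_def, hc, hs]
      simp
    | zero => simp
    | add φ ψ _ _ hφ hψ =>
      simp only [ContinuousMap.add_apply, mul_add]
      rw [integral_add (hint φ) (hint ψ), hφ, hψ, add_zero]
    | smul r φ _ hφ =>
      simp only [ContinuousMap.smul_apply, smul_eq_mul, mul_left_comm _ r]
      rw [integral_const_mul, hφ, mul_zero]
  obtain ⟨B, hB0, hB⟩ := exists_bound one_pos' R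
  have hvol : (volume (Icc (0 : Fin 2 → ℝ) 1)) < ⊤ := isCompact_Icc.measure_lt_top
  have hsq : int (R * R) ≤ 0 := by
    refine le_of_forall_pos_le_add fun ε hε => ?_
    set v := volume.real (Icc (0 : Fin 2 → ℝ) 1)
    have hv : 0 ≤ v := measureReal_nonneg
    have hg : g ∈ (Submodule.span ℂ
        (range (UnitAddTorus.mFourier (d := Fin 2)))).topologicalClosure := by
      rw [UnitAddTorus.span_mFourier_closure_eq_top]; trivial
    obtain ⟨φ, hφ, hφg⟩ := Metric.mem_closure_iff.1 hg (ε / (B * v + 1)) (by positivity)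
    have h1 : ((int (R * R) : ℝ) : ℂ) =
        ∫ x in Icc (0 : Fin 2 → ℝ) 1, (R x : ℂ) * (g - φ) (proj x) := by
      have : ∀ x, (R x : ℂ) * (g - φ) (proj x) =
          (((R * R) x : ℝ) : ℂ) - (R x : ℂ) * φ (proj x) := fun x => by
        rw [ContinuousMap.sub_apply, mul_sub]
        simp [g, descend_proj]
      simp only [this]
      rw [integral_sub _ (hint φ), horth φ hφ, sub_zero, integral_complex_ofReal, ← int_def]
      exact (Complex.continuous_ofReal.comp (R * R).continuous).continuousOn.integrableOn_compact
        isCompact_Icc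
    have h2 : ‖((int (R * R) : ℝ) : ℂ)‖ ≤ (B * (ε / (B * v + 1))) * v := by
      rw [h1]
      refine norm_setIntegral_le_of_norm_le_const hvol fun x _ => ?_
      rw [norm_mul, Complex.norm_real, Real.norm_eq_abs]
      refine mul_le_mul (hB x) ?_ (norm_nonneg _) hB0.le
      exact ((g - φ).norm_coe_le_norm _).trans (by rw [← dist_eq_norm]; exact hφg.le)
    rw [Complex.norm_real, Real.norm_eq_abs] at h2
    have h3 : (B * (ε / (B * v + 1))) * v ≤ ε := by
      have : (B * (ε / (B * v + 1))) * v = ε * (B * v / (B * v + 1)) := by ring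
      rw [this]
      refine mul_le_of_le_one_right hε.le ?_
      rw [div_le_one (by positivity)]
      linarith
    linarith [le_abs_self (int (R * R))]
  refine Per.ext fun x => ?_
  have := eq_zero_of_int_le one_pos' (h := R * R) (fun x => mul_self_nonneg _) hsq x
  exact mul_self_eq_zero.1 this

/-! ### Solution of the elliptic equation -/

theorem trigPoly_mono {M N : ℕ} (h : M ≤ N) : trigPoly M ≤ trigPoly N := by
  have : {n : Fin 2 → ℤ | ∀ i, |n i| ≤ M} ⊆ {n | ∀ i, |n i| ≤ N} := fun n hn i =>
    (hn i).trans (by exact_mod_cast h)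
  exact Submodule.span_mono (union_subset_union (image_mono this) (image_mono this))

/-- An elliptic equation in divergence form on the torus has a smooth solution, namely a limit of
the Galerkin approximations normalized by `u(0) = 0`. -/
theorem exists_div_flux_eq_zero {a : Fin 2 → Fin 2 → Per (1 : Fin 2 → ℝ)} {κ : ℝ} (hκ : 0 < κ)
    (ha : Elliptic a κ) (F : Fin 2 → Per (1 : Fin 2 → ℝ)) :
    ∃ U : Per (1 : Fin 2 → ℝ), ∑ i, d i (flux a F U i) = 0 := by
  choose u hu hu0 using exists_isGalerkin hκ ha F
  have hbd : ∀ k i, BddDeriv k fun N => d i (u N) := fun k =>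
    bddDeriv_of_isGalerkin hκ ha k (F := fun i _ => F i) hu fun i => BddDeriv.const _
  have hsup : ∀ w : ℕ → Per (1 : Fin 2 → ℝ), BddDeriv 2 w → ∃ C, ∀ N x, |w N x| ≤ C := by
    intro w hw
    obtain ⟨C0, h0⟩ := hw.1
    obtain ⟨C1, h1⟩ := (hw.2 0).1
    obtain ⟨C2, h2⟩ := (hw.2 1).1
    obtain ⟨C3, h3⟩ := (hw.2 0).2 1
    refine ⟨int (4 : Per (1 : Fin 2 → ℝ)) + C0 + C1 + C2 + C3, fun N x => ?_⟩
    refine (abs_le_sobolev (w N) x).trans ?_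
    simp only [map_add]
    have := h0 N; have := h1 N; have := h2 N; have := h3 N
    linarith
  have hbdw : ∀ (l : List (Fin 2)) (k : ℕ) (i : Fin 2),
      BddDeriv k fun N => dw l (d i (u N)) := by
    intro l
    induction l with
    | nil => exact fun k i => hbd k i
    | cons j l ih => exact fun k i => (ih (k + 1) i).2 j
  have hcomm : ∀ (l : List (Fin 2)) (i : Fin 2) (h : Per (1 : Fin 2 → ℝ)),
      dw l (d i h) = d i (dw l h) := by
    intro l i h
    induction l with
    | nil => rfl
    | cons j l ih => rw [dw_cons, dw_cons, ih, d_comm]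
  -- the normalization is needed only for the empty word
  have hall : ∀ l, ∃ C, ∀ N x, |dw l (u N) x| ≤ C := by
    intro l
    cases l with
    | nil =>
      choose C hC using fun i => hsup _ (hbd 2 i)
      refine ⟨2 * (|C 0| + |C 1|), fun N x => ?_⟩
      obtain ⟨y, hy, hyx⟩ := exists_mem_Icc one_pos' x
      have h1 := abs_sub_le_of_d_le (w := u N) (C := |C 0| + |C 1|) (fun i x =>
        (hC i N x).trans (le_abs_add_abs C i)) 0 y
      rw [hu0, sub_zero, sub_zero, hyx] at h1
      refine h1.trans (mul_le_of_le_one_right (by positivity) ?_)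
      refine (pi_norm_le_iff_of_nonneg zero_le_one).2 fun i => ?_
      rw [Real.norm_eq_abs, abs_of_nonneg (hy.1 i)]
      exact hy.2 i
    | cons i l =>
      obtain ⟨C, hC⟩ := hsup _ (hbdw l 2 i)
      refine ⟨C, fun N x => ?_⟩
      rw [dw_cons, ← hcomm]
      exact hC N x
  let 𝒰 : Ultrafilter ℕ := hyperfilter ℕ
  obtain ⟨U, hU⟩ := exists_limit 𝒰 hall
  refine ⟨U, ?_⟩
  -- the divergence as an expression in derivatives, which converge pointwise
  have hres : ∀ h : Per (1 : Fin 2 → ℝ), ∑ i, d i (flux a F h i) =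
      ∑ i, (∑ j, (a i j * dw [i, j] h + d i (a i j) * dw [j] h) - d i (F i)) := by
    intro h
    refine Finset.sum_congr rfl fun i _ => ?_
    simp only [flux, map_sub, map_sum, Derivation.leibniz, smul_eq_mul, dw_cons]
    congr 1
    refine Finset.sum_congr rfl fun j _ => ?_
    rw [mul_comm (d j _)]
    rfl
  have hconv : ∀ x, Tendsto (fun N => (∑ i, d i (flux a F (u N) i)) x) 𝒰
      (𝓝 ((∑ i, d i (flux a F U i)) x)) := by
    intro x
    simp only [hres, Per.sum_apply, Per.sub_apply, Per.add_apply, Per.mul_apply]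
    exact tendsto_finsetSum _ fun i _ => (tendsto_finsetSum _ fun j _ =>
      ((hU [i, j] x).const_mul _).add ((hU [j] x).const_mul _)).sub_const _
  have hbdres : BddDeriv 3 fun N => ∑ i, d i (flux a F (u N) i) := by
    have e : ∀ i j, BddDeriv 3 fun N =>
        a i j * dw [i] (d j (u N)) + d i (a i j) * dw [] (d j (u N)) :=
      fun i j => ((hbdw [i] 3 j).mul_left _).add ((hbdw [] 3 j).mul_left _)
    have : (fun N => ∑ i, d i (flux a F (u N) i)) = fun N =>
        (((a 0 0 * dw [0] (d 0 (u N)) + d 0 (a 0 0) * dw [] (d 0 (u N))) +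
        (a 0 1 * dw [0] (d 1 (u N)) + d 0 (a 0 1) * dw [] (d 1 (u N)))) +
        ((a 1 0 * dw [1] (d 0 (u N)) + d 1 (a 1 0) * dw [] (d 0 (u N))) +
        (a 1 1 * dw [1] (d 1 (u N)) + d 1 (a 1 1) * dw [] (d 1 (u N))))) +
        (-d 0 (F 0) + -d 1 (F 1)) := by
      funext N
      rw [hres]
      simp only [Fin.sum_univ_two, dw_cons]
      simp only [dw, List.foldr]
      ring
    rw [this]
    exact (((e 0 0).add (e 0 1)).add ((e 1 0).add (e 1 1))).add (BddDeriv.const _)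
  choose C hC using fun i => hsup _ (hbdres.2 i)
  have horth : ∀ M, ∀ φ ∈ trigPoly M, int ((∑ i, d i (flux a F U i)) * φ) = 0 := by
    intro M φ hφ
    have h1 := tendsto_int_mul (𝒰 := (𝒰 : Filter ℕ)) (C := |C 0| + |C 1|) (fun N i x =>
      (hC i N x).trans (le_abs_add_abs C i)) hconv φ
    refine tendsto_nhds_unique h1 (tendsto_const_nhds.congr' ?_)
    have hge : ∀ᶠ N in (𝒰 : Filter ℕ), M ≤ N :=
      Nat.hyperfilter_le_atTop (eventually_ge_atTop M)
    filter_upwards [hge] with N hN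
    have h2 := (hu N).2 φ (trigPoly_mono hN hφ)
    rw [Finset.sum_mul, map_sum]
    simp only [int_d_mul one_pos', Finset.sum_neg_distrib]
    rw [← map_sum, h2, neg_zero]
  have hfreq : ∀ n : Fin 2 → ℤ, ∀ i, |n i| ≤ ((max (n 0).natAbs (n 1).natAbs : ℕ) : ℤ) := by
    intro n i
    fin_cases i <;> simp
  exact eq_zero_of_orthogonal (fun n => horth _ _ (cosMon_mem (hfreq n)))
    (fun n => horth _ _ (sinMon_mem (hfreq n)))

end

section

open MeasureTheory Set Filter Per

/-! ### The thermostat vector field in coordinates -/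

/-- The periods of the coordinates `(x₀, x₁, α)` of the unit circle bundle, where `α` is the angle
in an orthonormal frame. -/
def period3 : Fin 3 → ℝ := ![1, 1, 2 * Real.pi]

theorem period3_pos (i : Fin 3) : 0 < period3 i := by
  fin_cases i <;> simp [period3, Real.pi_pos]

/-- The foot point of a point of the unit circle bundle. -/
def foot (z : Fin 3 → ℝ) : Fin 2 → ℝ := ![z 0, z 1]

theorem foot_add_single (z : Fin 3 → ℝ) (i : Fin 3) :
    ∀ j, ∃ k : ℤ, foot (z + Pi.single i (period3 i)) j = foot z j + k * (1 : Fin 2 → ℝ) j := by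
  intro j
  fin_cases i <;> fin_cases j <;> simp [foot, period3]
  all_goals exact ⟨1, by simp⟩

/-- The linear map underlying `foot`. -/
def footL : (Fin 3 → ℝ) →L[ℝ] (Fin 2 → ℝ) :=
  ContinuousLinearMap.pi ![ContinuousLinearMap.proj 0, ContinuousLinearMap.proj 1]

theorem footL_apply (z : Fin 3 → ℝ) : footL z = foot z := by
  funext i; fin_cases i <;> rfl

theorem contDiff_foot : ContDiff ℝ ∞ foot := by
  rw [show foot = footL from funext fun z => (footL_apply z).symm]
  exact footL.contDiff

/-- The pull-back of a function on the base to the unit circle bundle. -/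
def pull (h : Per (1 : Fin 2 → ℝ)) : Per period3 :=
  Per.mk (fun z => h (foot z)) (h.contDiff.comp contDiff_foot)
    fun i z => h.eq_of_sub_int (foot_add_single z i)

theorem pull_apply (h : Per (1 : Fin 2 → ℝ)) (z : Fin 3 → ℝ) : pull h z = h (foot z) := rfl

theorem d_pull_apply (h : Per (1 : Fin 2 → ℝ)) (i : Fin 3) (z : Fin 3 → ℝ) :
    d i (pull h) z = fderiv ℝ h (foot z) (foot (Pi.single i 1)) := by
  have h1 : HasFDerivAt (pull h) (fderiv ℝ h (foot z) ∘L footL) z := by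
    have h2 : HasFDerivAt foot footL z := by
      rw [show foot = footL from funext fun z => (footL_apply z).symm]
      exact footL.hasFDerivAt
    exact (h.differentiable _).hasFDerivAt.comp z h2
  rw [d_apply, h1.fderiv, ContinuousLinearMap.comp_apply, footL_apply]

theorem d0_pull (h : Per (1 : Fin 2 → ℝ)) : d 0 (pull h) = pull (d 0 h) := Per.ext fun z => by
  rw [d_pull_apply, pull_apply, d_apply]
  congr 1
  funext j; fin_cases j <;> simp [foot]

theorem d1_pull (h : Per (1 : Fin 2 → ℝ)) : d 1 (pull h) = pull (d 1 h) := Per.ext fun z => by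
  rw [d_pull_apply, pull_apply, d_apply]
  congr 1
  funext j; fin_cases j <;> simp [foot]

theorem d2_pull (h : Per (1 : Fin 2 → ℝ)) : d 2 (pull h) = 0 := Per.ext fun z => by
  rw [d_pull_apply]
  have : foot (Pi.single 2 1) = 0 := by funext j; fin_cases j <;> simp [foot]
  rw [this, map_zero]; rfl

theorem angle_periodic (i : Fin 3) (z : Fin 3 → ℝ) :
    (z + Pi.single i (period3 i) : Fin 3 → ℝ) 2 = z 2 ∨
      (z + Pi.single i (period3 i) : Fin 3 → ℝ) 2 = z 2 + 2 * Real.pi := by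
  fin_cases i <;> simp [period3]

/-- The function `cos α`. -/
def cosA : Per period3 :=
  Per.mk (fun z => Real.cos (z 2)) (Real.contDiff_cos.comp (contDiff_apply ℝ ℝ 2)) fun i z => by
    rcases angle_periodic i z with h | h <;> rw [h]
    rw [Real.cos_add_two_pi]

/-- The function `sin α`. -/
def sinA : Per period3 :=
  Per.mk (fun z => Real.sin (z 2)) (Real.contDiff_sin.comp (contDiff_apply ℝ ℝ 2)) fun i z => by
    rcases angle_periodic i z with h | h <;> rw [h]
    rw [Real.sin_add_two_pi]

theorem d_cosA_apply (i : Fin 3) (z : Fin 3 → ℝ) :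
    d i cosA z = -(sinA z * (Pi.single i (1 : ℝ) : Fin 3 → ℝ) 2) := by
  have : HasFDerivAt cosA _ z := ((hasFDerivAt_apply (𝕜 := ℝ) 2 z)).cos
  rw [d_apply, this.fderiv]
  simp [sinA]

theorem d_sinA_apply (i : Fin 3) (z : Fin 3 → ℝ) :
    d i sinA z = cosA z * (Pi.single i (1 : ℝ) : Fin 3 → ℝ) 2 := by
  have : HasFDerivAt sinA _ z := ((hasFDerivAt_apply (𝕜 := ℝ) 2 z)).sin
  rw [d_apply, this.fderiv]
  simp [cosA]

@[simp] theorem d0_cosA (z : Fin 3 → ℝ) : d 0 cosA z = 0 := by simp [d_cosA_apply]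
@[simp] theorem d1_cosA (z : Fin 3 → ℝ) : d 1 cosA z = 0 := by simp [d_cosA_apply]
@[simp] theorem d2_cosA (z : Fin 3 → ℝ) : d 2 cosA z = -sinA z := by simp [d_cosA_apply]
@[simp] theorem d0_sinA (z : Fin 3 → ℝ) : d 0 sinA z = 0 := by simp [d_sinA_apply]
@[simp] theorem d1_sinA (z : Fin 3 → ℝ) : d 1 sinA z = 0 := by simp [d_sinA_apply]
@[simp] theorem d2_sinA (z : Fin 3 → ℝ) : d 2 sinA z = cosA z := by simp [d_sinA_apply]

theorem sinA_sq (z : Fin 3 → ℝ) : sinA z ^ 2 = 1 - cosA z ^ 2 := Real.sin_sq _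

/-- Coordinate data of a thermostat: the coframe `θ₁ = a dx₀ + b dx₁`, `θ₂ = c dx₁` is orthonormal
and positively oriented, and the thermostat geodesics with `γ̇ = (cos α, sin α)` in the dual frame
satisfy `α̇ = f - η(γ̇)`, where `η = η₀ dx₀ + η₁ dx₁`. -/
structure Coords where
  /-- `θ₁(∂₀)` -/
  a : Per (1 : Fin 2 → ℝ)
  /-- `θ₁(∂₁)` -/
  b : Per (1 : Fin 2 → ℝ)
  /-- `θ₂(∂₁)` -/
  c : Per (1 : Fin 2 → ℝ)
  /-- the function `f` in `λ = f + ⟨e, iv⟩` -/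
  f : Per (1 : Fin 2 → ℝ)
  /-- the components of the one-form `η` -/
  η : Fin 2 → Per (1 : Fin 2 → ℝ)
  a_pos : ∀ x, 0 < a x
  c_pos : ∀ x, 0 < c x

namespace Coords

variable (D : Coords)

/-- The component `ω(∂₀)` of the Levi-Civita connection form. -/
def ω₀ : Per (1 : Fin 2 → ℝ) :=
  (d 0 D.b - d 1 D.a) * D.c.inv fun x => (D.c_pos x).ne'

/-- The component `ω(∂₁)` of the Levi-Civita connection form. -/
def ω₁ : Per (1 : Fin 2 → ℝ) :=
  D.b * (d 0 D.b - d 1 D.a) * (D.a.inv fun x => (D.a_pos x).ne') *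
    (D.c.inv fun x => (D.c_pos x).ne') + d 0 D.c * D.a.inv fun x => (D.a_pos x).ne'

/-- The function `1/a` on the unit circle bundle. -/
def ia : Per period3 := pull (D.a.inv fun x => (D.a_pos x).ne')

/-- The function `1/c` on the unit circle bundle. -/
def ic : Per period3 := pull (D.c.inv fun x => (D.c_pos x).ne')

/-- The component `dx₀(v)` of the unit vector `v`. -/
def v₀ : Per period3 := cosA * D.ia - pull D.b * sinA * D.ia * D.ic

/-- The component `dx₁(v)` of the unit vector `v`. -/
def v₁ : Per period3 := sinA * D.ic

/-- The component `dx₀(iv)`, where `v` is the unit vector. -/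
def n₀ : Per period3 := -(sinA * D.ia) - pull D.b * cosA * D.ia * D.ic

/-- The component `dx₁(iv)`, where `v` is the unit vector. -/
def n₁ : Per period3 := cosA * D.ic

/-- The generator of the thermostat flow. -/
def gen : Fin 3 → Per period3 :=
  ![D.v₀, D.v₁, pull D.f - pull (D.η 0) * D.v₀ - pull (D.η 1) * D.v₁]

/-- The one-form `-sin α θ₁ + cos α θ₂`, which measures the component orthogonal to the
trajectory. -/
def yForm : Fin 3 → Per period3 :=
  ![-(sinA * pull D.a), -(sinA * pull D.b) + cosA * pull D.c, 0]

/-- The one-form `dα + η - f (cos α θ₁ + sin α θ₂)`. -/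
def qForm : Fin 3 → Per period3 :=
  ![pull (D.η 0) - pull D.f * (cosA * pull D.a),
    pull (D.η 1) - pull D.f * (cosA * pull D.b + sinA * pull D.c), 1]

/-- The divergence of the generator with respect to the Liouville measure. -/
def p : Per period3 :=
  -((pull (D.η 0) - pull D.ω₀) * D.n₀ + (pull (D.η 1) - pull D.ω₁) * D.n₁)

/-- The two-form `dη` evaluated on the coordinate frame. -/
def dη : Per (1 : Fin 2 → ℝ) := d 0 (D.η 1) - d 1 (D.η 0)

/-- The curvature term of the Riccati equation. -/
def kt : Per period3 :=
  -(pull D.dη * D.ia * D.ic) - (D.n₀ * pull (d 0 D.f) + D.n₁ * pull (d 1 D.f)) + pull D.f ^ 2 -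
    pull D.f * ((pull (D.η 0) - pull D.ω₀) * D.v₀ + (pull (D.η 1) - pull D.ω₁) * D.v₁)

/-- The Lie derivative of a one-form along the generator. -/
def lie (β : Fin 3 → Per period3) (j : Fin 3) : Per period3 :=
  ∑ i, (D.gen i * d i (β j) + β i * d j (D.gen i))

theorem d0_ia (z : Fin 3 → ℝ) : d 0 D.ia z = -(d 0 D.a (foot z)) / D.a (foot z) ^ 2 := by
  rw [ia, d0_pull, pull_apply, d_inv_apply]

theorem d1_ia (z : Fin 3 → ℝ) : d 1 D.ia z = -(d 1 D.a (foot z)) / D.a (foot z) ^ 2 := by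
  rw [ia, d1_pull, pull_apply, d_inv_apply]

theorem d0_ic (z : Fin 3 → ℝ) : d 0 D.ic z = -(d 0 D.c (foot z)) / D.c (foot z) ^ 2 := by
  rw [ic, d0_pull, pull_apply, d_inv_apply]

theorem d1_ic (z : Fin 3 → ℝ) : d 1 D.ic z = -(d 1 D.c (foot z)) / D.c (foot z) ^ 2 := by
  rw [ic, d1_pull, pull_apply, d_inv_apply]

theorem d2_ia (z : Fin 3 → ℝ) : d 2 D.ia z = 0 := by rw [ia, d2_pull]; rfl

theorem d2_ic (z : Fin 3 → ℝ) : d 2 D.ic z = 0 := by rw [ic, d2_pull]; rfl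

theorem ia_apply (z : Fin 3 → ℝ) : D.ia z = (D.a (foot z))⁻¹ := rfl

theorem ic_apply (z : Fin 3 → ℝ) : D.ic z = (D.c (foot z))⁻¹ := rfl

theorem d0_v₀ (z : Fin 3 → ℝ) : d 0 D.v₀ z = cosA z * d 0 D.ia z -
    sinA z * (d 0 D.b (foot z) * D.ia z * D.ic z + D.b (foot z) * d 0 D.ia z * D.ic z +
      D.b (foot z) * D.ia z * d 0 D.ic z) := by
  simp only [v₀, map_sub, Per.sub_apply, d_mul_apply, Per.mul_apply, d0_cosA, d0_sinA, d0_pull,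
    pull_apply]
  ring

theorem d1_v₀ (z : Fin 3 → ℝ) : d 1 D.v₀ z = cosA z * d 1 D.ia z -
    sinA z * (d 1 D.b (foot z) * D.ia z * D.ic z + D.b (foot z) * d 1 D.ia z * D.ic z +
      D.b (foot z) * D.ia z * d 1 D.ic z) := by
  simp only [v₀, map_sub, Per.sub_apply, d_mul_apply, Per.mul_apply, d1_cosA, d1_sinA, d1_pull,
    pull_apply]
  ring

theorem d2_v₀ : d 2 D.v₀ = D.n₀ := Per.ext fun z => by
  simp only [v₀, n₀, map_sub, Per.sub_apply, d_mul_apply, Per.mul_apply, d2_cosA, d2_sinA, d2_pull,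
    pull_apply, d2_ia, d2_ic, Per.neg_apply, Per.zero_apply]
  ring

theorem d0_v₁ (z : Fin 3 → ℝ) : d 0 D.v₁ z = sinA z * d 0 D.ic z := by
  simp only [v₁, d_mul_apply, d0_sinA]
  ring

theorem d1_v₁ (z : Fin 3 → ℝ) : d 1 D.v₁ z = sinA z * d 1 D.ic z := by
  simp only [v₁, d_mul_apply, d1_sinA]
  ring

theorem d2_v₁ : d 2 D.v₁ = D.n₁ := Per.ext fun z => by
  simp only [v₁, n₁, Per.mul_apply, d_mul_apply, d2_sinA, d2_ic]
  ring

theorem d2_n₀ : d 2 D.n₀ = -D.v₀ := Per.ext fun z => by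
  simp only [v₀, n₀, map_sub, map_neg, Per.sub_apply, d_mul_apply, Per.mul_apply, d2_cosA, d2_sinA,
    d2_pull, pull_apply, d2_ia, d2_ic, Per.neg_apply, Per.zero_apply]
  ring

theorem d2_n₁ : d 2 D.n₁ = -D.v₁ := Per.ext fun z => by
  simp only [v₁, n₁, Per.mul_apply, d_mul_apply, d2_cosA, d2_ic, Per.neg_apply]
  ring

theorem v₀_apply (z : Fin 3 → ℝ) : D.v₀ z = cosA z / D.a (foot z) -
    D.b (foot z) * sinA z / (D.a (foot z) * D.c (foot z)) := by
  have ha := (D.a_pos (foot z)).ne'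
  have hc := (D.c_pos (foot z)).ne'
  simp only [v₀, Per.sub_apply, Per.mul_apply, ia_apply, ic_apply, pull_apply]
  field_simp

theorem v₁_apply (z : Fin 3 → ℝ) : D.v₁ z = sinA z / D.c (foot z) := by
  simp only [v₁, Per.mul_apply, ic_apply]; rfl

theorem n₀_apply (z : Fin 3 → ℝ) : D.n₀ z = -(sinA z / D.a (foot z)) -
    D.b (foot z) * cosA z / (D.a (foot z) * D.c (foot z)) := by
  have ha := (D.a_pos (foot z)).ne'
  have hc := (D.c_pos (foot z)).ne'
  simp only [n₀, Per.sub_apply, Per.neg_apply, Per.mul_apply, ia_apply, ic_apply, pull_apply]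
  field_simp

theorem n₁_apply (z : Fin 3 → ℝ) : D.n₁ z = cosA z / D.c (foot z) := by
  simp only [n₁, Per.mul_apply, ic_apply]; rfl

theorem ω₀_apply (x : Fin 2 → ℝ) : D.ω₀ x = (d 0 D.b x - d 1 D.a x) / D.c x := rfl

theorem ω₁_apply (x : Fin 2 → ℝ) : D.ω₁ x =
    D.b x * (d 0 D.b x - d 1 D.a x) / (D.a x * D.c x) + d 0 D.c x / D.a x := by
  have ha := (D.a_pos x).ne'
  have hc := (D.c_pos x).ne'
  simp only [ω₁, Per.add_apply, Per.mul_apply, Per.sub_apply, inv_apply]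
  field_simp

/-- The first structure equation: `L_F y = q + p y`. -/
theorem lie_yForm (j : Fin 3) : D.lie D.yForm j = D.qForm j + D.p * D.yForm j := by
  refine Per.ext fun z => ?_
  have ha := (D.a_pos (foot z)).ne'
  have hc := (D.c_pos (foot z)).ne'
  have hs := sinA_sq z
  fin_cases j
  all_goals
    simp only [lie, Fin.sum_univ_three, Per.add_apply, Per.mul_apply, yForm, qForm, gen, p,
      Matrix.cons_val_zero, Matrix.cons_val_one, Matrix.cons_val, map_neg, map_add, map_zero,
      map_sub,
      Per.neg_apply, Per.sub_apply, Per.zero_apply, d_mul_apply, d0_cosA, d0_sinA, d1_cosA,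
      d1_sinA, d2_cosA, d2_sinA, d0_pull, d1_pull, d2_pull, pull_apply, d0_v₀, d1_v₀, d2_v₀,
      d0_v₁, d1_v₁, d2_v₁, Fin.zero_eta, Fin.mk_one, Fin.reduceFinMk, d0_ia, d1_ia, d0_ic, d1_ic,
      v₀_apply, v₁_apply, n₀_apply, n₁_apply, ω₀_apply, ω₁_apply, ia_apply, ic_apply, Per.one_apply]
    generalize sinA z = s at *
    generalize cosA z = k at *
    have hs' : s ^ 2 + k ^ 2 = 1 := by linarith
    field_simp
  · linear_combination D.a (foot z) ^ 2 * D.c (foot z) ^ 2 * D.η 0 (foot z) * hs'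
  · linear_combination D.a (foot z) ^ 2 * D.c (foot z) ^ 2 * D.η 1 (foot z) * hs'
  · linear_combination D.a (foot z) * D.c (foot z) ^ 2 * hs'

/-- The second structure equation: `L_F q = -K y`, where `K` is the curvature term. Together with
the first one it turns the linearized flow into a Jacobi equation for the pair `(y, q)`. -/
theorem lie_qForm (j : Fin 3) : D.lie D.qForm j = -(D.kt * D.yForm j) := by
  refine Per.ext fun z => ?_
  have ha := (D.a_pos (foot z)).ne'
  have hc := (D.c_pos (foot z)).ne'
  have hs := sinA_sq z
  fin_cases j
  all_goals
    simp only [lie, Fin.sum_univ_three, Per.add_apply, Per.mul_apply, yForm, qForm, gen, kt, dη,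
      Matrix.cons_val_zero, Matrix.cons_val_one, Matrix.cons_val, map_add, map_sub,
      Derivation.map_one_eq_zero, Per.pow_apply,
      Per.neg_apply, Per.sub_apply, Per.zero_apply, d_mul_apply, d0_cosA, d0_sinA, d1_cosA,
      d1_sinA, d2_cosA, d2_sinA, d0_pull, d1_pull, d2_pull, pull_apply, d0_v₀, d1_v₀, d2_v₀,
      d0_v₁, d1_v₁, d2_v₁, Fin.zero_eta, Fin.mk_one, Fin.reduceFinMk, d0_ia, d1_ia, d0_ic, d1_ic,
      v₀_apply, v₁_apply, n₀_apply, n₁_apply, ω₀_apply, ω₁_apply, ia_apply, ic_apply, Per.one_apply]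
    generalize sinA z = s at *
    generalize cosA z = k at *
    have hs' : s ^ 2 + k ^ 2 = 1 := by linarith
    field_simp
  · linear_combination -(D.a (foot z) ^ 2 * D.c (foot z) ^ 2 * d 0 D.f (foot z) * hs')
  · linear_combination -(D.a (foot z) ^ 2 * D.c (foot z) ^ 2 * d 1 D.f (foot z) * hs')
  · ring

/-- The divergence of the generator with respect to the density `a c` is `p`. -/
theorem div_gen : ∑ i, d i (pull D.a * pull D.c * D.gen i) = D.p * (pull D.a * pull D.c) := by
  refine Per.ext fun z => ?_
  have ha := (D.a_pos (foot z)).ne'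
  have hc := (D.c_pos (foot z)).ne'
  simp only [Fin.sum_univ_three, Per.add_apply, Per.mul_apply, gen, p,
      Matrix.cons_val_zero, Matrix.cons_val_one, Matrix.cons_val, map_sub,
      Per.neg_apply, Per.sub_apply, Per.zero_apply, d_mul_apply, d0_pull, d1_pull, d2_pull,
      pull_apply, d0_v₀, d2_v₀,
      d1_v₁, d2_v₁, d0_ia, d0_ic, d1_ic,
      v₀_apply, v₁_apply, n₀_apply, n₁_apply, ω₀_apply, ω₁_apply, ia_apply, ic_apply]
  field_simp
  ring

end Coords

end

section

open MeasureTheory Set Filter Per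

/-! ### The flow of a periodic vector field -/

section PeriodicField

variable {n : ℕ} {L : Fin n → ℝ}

/-- The vector field on `ℝⁿ` with the given periodic components. -/
def vec (F : Fin n → Per L) (z : Fin n → ℝ) : Fin n → ℝ := fun i => F i z

theorem contDiff_vec (F : Fin n → Per L) : ContDiff ℝ ∞ (vec F) :=
  contDiff_pi.2 fun i => (F i).contDiff

theorem fderiv_vec (F : Fin n → Per L) (z u : Fin n → ℝ) (j : Fin n) :
    fderiv ℝ (vec F) z u j = ∑ i, u i * d i (F j) z := by
  rw [← fderiv_apply, ← ContinuousLinearMap.proj_apply (R := ℝ) (φ := fun _ => ℝ) j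
    (fderiv ℝ (vec F) z u), ← ContinuousLinearMap.comp_apply]
  congr 1
  exact ((hasFDerivAt_pi'.1 ((contDiff_vec F).differentiable (by simp) z).hasFDerivAt)
    j).fderiv.symm

theorem exists_lipschitzWith (hL : ∀ i, 0 < L i) (F : Fin n → Per L) :
    ∃ K, LipschitzWith K (vec F) := by
  choose C hC0 hC using fun i j => exists_bound hL (d i (F j))
  have hC' : 0 ≤ ∑ j, ∑ i, C i j :=
    Finset.sum_nonneg fun j _ => Finset.sum_nonneg fun i _ => (hC0 i j).le
  refine ⟨⟨∑ j, ∑ i, C i j, hC'⟩, lipschitzWith_of_nnnorm_fderiv_le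
    ((contDiff_vec F).differentiable (by simp)) fun z => ?_⟩
  refine ContinuousLinearMap.opNorm_le_bound _ hC' fun u => ?_
  refine (pi_norm_le_iff_of_nonneg (by positivity)).2 fun j => ?_
  rw [fderiv_vec]
  calc ‖∑ i, u i * d i (F j) z‖ ≤ ∑ i, ‖u i * d i (F j) z‖ := norm_sum_le _ _
    _ ≤ ∑ i, C i j * ‖u‖ := by
        refine Finset.sum_le_sum fun i _ => ?_
        rw [norm_mul, mul_comm]
        exact mul_le_mul (hC i j z) (norm_le_pi_norm u i) (norm_nonneg _) (hC0 i j).le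
    _ = (∑ i, C i j) * ‖u‖ := by rw [Finset.sum_mul]
    _ ≤ (∑ j, ∑ i, C i j) * ‖u‖ := by
        refine mul_le_mul_of_nonneg_right ?_ (norm_nonneg _)
        exact Finset.single_le_sum (f := fun j => ∑ i, C i j)
          (fun j _ => Finset.sum_nonneg fun i _ => (hC0 i j).le) (Finset.mem_univ j)

theorem exists_flow (hL : ∀ i, 0 < L i) (F : Fin n → Per L) :
    ∃ Φ : ℝ → (Fin n → ℝ) → Fin n → ℝ,
      (∀ z, Φ 0 z = z) ∧ ∀ t z, HasDerivAt (Φ · z) (vec F (Φ t z)) t := by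
  obtain ⟨K, hK⟩ := exists_lipschitzWith hL F
  choose C hC0 hC using fun i => exists_bound hL (F i)
  have hC' : 0 ≤ ∑ i, C i := Finset.sum_nonneg fun i _ => (hC0 i).le
  refine exists_globalFlow (contDiff_vec F) hK (M := ⟨∑ i, C i, hC'⟩) fun z => ?_
  refine (pi_norm_le_iff_of_nonneg hC').2 fun i => (hC i z).trans ?_
  exact Finset.single_le_sum (fun i _ => (hC0 i).le) (Finset.mem_univ i)

/-- The flow of a periodic vector field. -/
def flowMap (hL : ∀ i, 0 < L i) (F : Fin n → Per L) : ℝ → (Fin n → ℝ) → Fin n → ℝ :=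
  (exists_flow hL F).choose

variable (hL : ∀ i, 0 < L i) (F : Fin n → Per L)

theorem flowMap_zero (z : Fin n → ℝ) : flowMap hL F 0 z = z := (exists_flow hL F).choose_spec.1 z

theorem hasDerivAt_flowMap (t : ℝ) (z : Fin n → ℝ) :
    HasDerivAt (flowMap hL F · z) (vec F (flowMap hL F t z)) t :=
  (exists_flow hL F).choose_spec.2 t z

theorem flowMap_unique {γ : ℝ → Fin n → ℝ} (h : ∀ t, HasDerivAt γ (vec F (γ t)) t) (t : ℝ) :
    γ t = flowMap hL F t (γ 0) := by
  obtain ⟨K, hK⟩ := exists_lipschitzWith hL F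
  exact congrFun (flow_unique hK h (fun t => hasDerivAt_flowMap hL F t (γ 0))
    (flowMap_zero hL F _).symm) t

theorem flowMap_add (s t : ℝ) (z : Fin n → ℝ) :
    flowMap hL F (s + t) z = flowMap hL F s (flowMap hL F t z) := by
  obtain ⟨K, hK⟩ := exists_lipschitzWith hL F
  exact flow_add hK (flowMap_zero hL F) (hasDerivAt_flowMap hL F) s t z

theorem contDiff_flowMap :
    ContDiff ℝ ∞ (fun p : ℝ × (Fin n → ℝ) => flowMap hL F p.1 p.2) := by
  obtain ⟨K, hK⟩ := exists_lipschitzWith hL F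
  exact contDiff_flow (contDiff_vec F) hK (flowMap_zero hL F) (hasDerivAt_flowMap hL F)

theorem flowMap_periodic (t : ℝ) (i : Fin n) (z : Fin n → ℝ) :
    flowMap hL F t (z + Pi.single i (L i)) = flowMap hL F t z + Pi.single i (L i) := by
  have h := flowMap_unique hL F (γ := fun t => flowMap hL F t z + Pi.single i (L i)) (fun t => ?_) t
  · simp only [flowMap_zero] at h
    exact h.symm
  · have h1 := (hasDerivAt_flowMap hL F t z).add_const (Pi.single i (L i))
    exact h1.congr_deriv (funext fun j => ((F j).periodic i _).symm)

/-- The derivative of the time `t` map of the flow at `z` in the direction `u`. -/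
def variation (u : Fin n → ℝ) (t : ℝ) (z : Fin n → ℝ) : Fin n → ℝ :=
  fderiv ℝ (fun p : ℝ × (Fin n → ℝ) => flowMap hL F p.1 p.2) (t, z) (0, u)

theorem contDiff_variation (u : Fin n → ℝ) :
    ContDiff ℝ ∞ (fun p : ℝ × (Fin n → ℝ) => variation hL F u p.1 p.2) :=
  ((contDiff_flowMap hL F).fderiv_right (m := ∞) (by simp)).clm_apply contDiff_const

theorem fderiv_flowMap (u : Fin n → ℝ) (t : ℝ) (z : Fin n → ℝ) :
    fderiv ℝ (flowMap hL F t) z u = variation hL F u t z := by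
  have h1 := ((contDiff_flowMap hL F).differentiable (by simp) (t, z)).hasFDerivAt
  have h2 : HasFDerivAt (flowMap hL F t) _ z := h1.comp z (hasFDerivAt_prodMk_right t z)
  rw [h2.fderiv]
  rfl

theorem variation_zero (u z : Fin n → ℝ) : variation hL F u 0 z = u := by
  rw [← fderiv_flowMap, show flowMap hL F 0 = id from funext fun z => flowMap_zero hL F z,
    fderiv_id]
  rfl

theorem variation_periodic (u : Fin n → ℝ) (t : ℝ) (i : Fin n) (z : Fin n → ℝ) :
    variation hL F u t (z + Pi.single i (L i)) = variation hL F u t z := by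
  rw [← fderiv_flowMap, ← fderiv_comp_add_right, ← fderiv_flowMap]
  simp_rw [flowMap_periodic]
  rw [fderiv_add_const]

/-- The linearized flow equation, a consequence of the symmetry of second derivatives. -/
theorem hasDerivAt_variation (u : Fin n → ℝ) (t : ℝ) (z : Fin n → ℝ) :
    HasDerivAt (fun t => variation hL F u t z)
      (fderiv ℝ (vec F) (flowMap hL F t z) (variation hL F u t z)) t := by
  set G := fun p : ℝ × (Fin n → ℝ) => flowMap hL F p.1 p.2 with hG
  have hGs : ContDiff ℝ ∞ G := contDiff_flowMap hL F
  have hG1 : ContDiff ℝ ∞ (fderiv ℝ G) := hGs.fderiv_right (m := ∞) (by simp)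
  have h2 := (hG1.differentiable (by simp) (t, z)).hasFDerivAt
  have hsymm : IsSymmSndFDerivAt ℝ G (t, z) :=
    (hGs.contDiffAt).isSymmSndFDerivAt (by simpa using two_le_infty)
  have h3 : HasDerivAt (fun t => fderiv ℝ G (t, z) (0, u))
      (fderiv ℝ (fderiv ℝ G) (t, z) (1, 0) (0, u)) t := by
    have h4 : HasDerivAt (fun s : ℝ => (s, z)) ((1 : ℝ), (0 : Fin n → ℝ)) t :=
      (hasDerivAt_id t).prodMk (hasDerivAt_const t z)
    have h5 := h2.comp_hasDerivAt t h4
    have h6 := h5.clm_apply (hasDerivAt_const t ((0 : ℝ), u))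
    simpa using h6
  rw [hsymm.eq (1, 0) (0, u)] at h3
  have h7 : (fun p => fderiv ℝ G p (1, 0)) = fun p => vec F (G p) := by
    funext p
    have h8 := (hGs.differentiable (by simp) p).hasFDerivAt
    have h9 : HasDerivAt (fun s : ℝ => (s, p.2)) ((1 : ℝ), (0 : Fin n → ℝ)) p.1 :=
      (hasDerivAt_id p.1).prodMk (hasDerivAt_const p.1 p.2)
    have h10 := h8.comp_hasDerivAt p.1 h9
    exact HasDerivAt.unique (f := fun s => G (s, p.2)) h10 (hasDerivAt_flowMap hL F p.1 p.2)
  have h10 : fderiv ℝ (fun p => fderiv ℝ G p (1, 0)) (t, z) (0, u) =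
      fderiv ℝ (fderiv ℝ G) (t, z) (0, u) (1, 0) := by
    have := (h2.clm_apply (hasFDerivAt_const ((1 : ℝ), (0 : Fin n → ℝ)) (t, z))).fderiv
    rw [this]
    simp
  rw [h7] at h10
  have h11 : HasFDerivAt (fun p => vec F (G p)) _ (t, z) :=
    (((contDiff_vec F).differentiable (by simp) (G (t, z))).hasFDerivAt).comp (t, z)
      (hGs.differentiable (by simp) (t, z)).hasFDerivAt
  rw [h11.fderiv] at h10
  rw [← h10] at h3
  exact h3

/-- Along the flow, the pairing of a one-form with an invariant vector field is differentiated by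
taking the Lie derivative of the one-form. -/
theorem hasDerivAt_pairing (β : Fin n → Per L) (u : Fin n → ℝ) (t : ℝ) (z : Fin n → ℝ) :
    HasDerivAt (fun t => ∑ j, β j (flowMap hL F t z) * variation hL F u t z j)
      (∑ j, (∑ i, (F i * d i (β j) + β i * d j (F i)) : Per L) (flowMap hL F t z) *
        variation hL F u t z j) t := by
  have hβ : ∀ j, HasDerivAt (fun t => β j (flowMap hL F t z))
      (∑ i, F i (flowMap hL F t z) * d i (β j) (flowMap hL F t z)) t := fun j => by
    have := ((β j).differentiable _).hasFDerivAt.comp_hasDerivAt t (hasDerivAt_flowMap hL F t z)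
    rw [fderiv_apply] at this
    exact this
  have hW := fun j => hasDerivAt_pi.1 (hasDerivAt_variation hL F u t z) j
  have h := HasDerivAt.fun_sum fun (j : Fin n) (_ : j ∈ Finset.univ) => (hβ j).mul (hW j)
  refine h.congr_deriv ?_
  simp only [fderiv_vec, Per.sum_apply, Per.add_apply, Per.mul_apply, Finset.sum_add_distrib,
    add_mul]
  congr 1
  simp only [Finset.sum_mul, Finset.mul_sum]
  rw [Finset.sum_comm]
  exact Finset.sum_congr rfl fun i _ => Finset.sum_congr rfl fun j _ => by ring

end PeriodicField

/-! ### The Jacobi equation of a thermostat -/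

namespace Coords

variable (D : Coords)

/-- The thermostat flow on the universal covering of the unit circle bundle. -/
def Φ : ℝ → (Fin 3 → ℝ) → Fin 3 → ℝ := flowMap period3_pos D.gen

/-- The vector field along a trajectory obtained by turning the initial velocity. -/
def W : ℝ → (Fin 3 → ℝ) → Fin 3 → ℝ := variation period3_pos D.gen (Pi.single 2 1)

/-- The component of the variation field orthogonal to the trajectory. -/
def Y (t : ℝ) (z : Fin 3 → ℝ) : ℝ := ∑ j, D.yForm j (D.Φ t z) * D.W t z j

/-- The value of the form `qForm` on the variation field. -/
def Q (t : ℝ) (z : Fin 3 → ℝ) : ℝ := ∑ j, D.qForm j (D.Φ t z) * D.W t z j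

theorem hasDerivAt_Y (t : ℝ) (z : Fin 3 → ℝ) :
    HasDerivAt (D.Y · z) (D.Q t z + D.p (D.Φ t z) * D.Y t z) t := by
  refine (hasDerivAt_pairing period3_pos D.gen D.yForm (Pi.single 2 1) t z).congr_deriv (Eq.symm ?_)
  rw [Q, Y, Finset.mul_sum, ← Finset.sum_add_distrib]
  refine Finset.sum_congr rfl fun j _ => ?_
  have := congrArg (fun h : Per period3 => h (D.Φ t z)) (D.lie_yForm j)
  simp only [lie, Per.add_apply, Per.mul_apply] at this
  simp only [Per.sum_apply, Per.add_apply, Per.mul_apply] at this ⊢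
  change _ = (∑ i, _) * D.W t z j
  rw [show flowMap period3_pos D.gen t z = D.Φ t z from rfl, this]
  ring

theorem hasDerivAt_Q (t : ℝ) (z : Fin 3 → ℝ) :
    HasDerivAt (D.Q · z) (-(D.kt (D.Φ t z) * D.Y t z)) t := by
  refine (hasDerivAt_pairing period3_pos D.gen D.qForm (Pi.single 2 1) t z).congr_deriv (Eq.symm ?_)
  rw [Y, Finset.mul_sum, ← Finset.sum_neg_distrib]
  refine Finset.sum_congr rfl fun j _ => ?_
  have := congrArg (fun h : Per period3 => h (D.Φ t z)) (D.lie_qForm j)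
  simp only [lie, Per.neg_apply, Per.mul_apply] at this
  simp only [Per.sum_apply, Per.add_apply, Per.mul_apply] at this ⊢
  change _ = (∑ i, _) * D.W t z j
  rw [show flowMap period3_pos D.gen t z = D.Φ t z from rfl, this]
  ring

theorem Y_zero (z : Fin 3 → ℝ) : D.Y 0 z = 0 := by
  simp [Y, W, variation_zero, Fin.sum_univ_three, yForm]

theorem Q_zero (z : Fin 3 → ℝ) : D.Q 0 z = 1 := by
  simp [Q, W, variation_zero, Fin.sum_univ_three, qForm]

theorem contDiff_Φ : ContDiff ℝ ∞ (fun p : ℝ × (Fin 3 → ℝ) => D.Φ p.1 p.2) :=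
  contDiff_flowMap period3_pos D.gen

theorem contDiff_pairing (β : Fin 3 → Per period3) :
    ContDiff ℝ ∞ (fun p : ℝ × (Fin 3 → ℝ) => ∑ j, β j (D.Φ p.1 p.2) * D.W p.1 p.2 j) :=
  ContDiff.sum fun j _ => ((β j).contDiff.comp D.contDiff_Φ).mul
    ((contDiff_apply ℝ ℝ j).comp (contDiff_variation period3_pos D.gen _))

theorem contDiff_Y : ContDiff ℝ ∞ (fun p : ℝ × (Fin 3 → ℝ) => D.Y p.1 p.2) :=
  D.contDiff_pairing D.yForm

theorem contDiff_Q : ContDiff ℝ ∞ (fun p : ℝ × (Fin 3 → ℝ) => D.Q p.1 p.2) :=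
  D.contDiff_pairing D.qForm

theorem pairing_periodic (β : Fin 3 → Per period3) (t : ℝ) (i : Fin 3) (z : Fin 3 → ℝ) :
    ∑ j, β j (D.Φ t (z + Pi.single i (period3 i))) * D.W t (z + Pi.single i (period3 i)) j =
      ∑ j, β j (D.Φ t z) * D.W t z j := by
  refine Finset.sum_congr rfl fun j _ => ?_
  rw [W, variation_periodic, Φ, flowMap_periodic, Per.periodic]

theorem Φ_add (s t : ℝ) (z : Fin 3 → ℝ) : D.Φ (s + t) z = D.Φ s (D.Φ t z) :=
  flowMap_add period3_pos D.gen s t z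

theorem Φ_zero (z : Fin 3 → ℝ) : D.Φ 0 z = z := flowMap_zero period3_pos D.gen z

theorem hasDerivAt_Φ (t : ℝ) (z : Fin 3 → ℝ) :
    HasDerivAt (D.Φ · z) (vec D.gen (D.Φ t z)) t :=
  hasDerivAt_flowMap period3_pos D.gen t z

/-- If `f = 0` and `η` is closed then `Q = 1`, so that `Y` is a solution of `Y' = 1 + pY` with
`Y(0) = 0`. -/
theorem Y_pos (hf : D.f = 0) (hη : D.dη = 0) {t : ℝ} (ht : 0 < t) (z : Fin 3 → ℝ) :
    0 < D.Y t z := by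
  have hk : ∀ z, D.kt z = 0 := fun z => by
    simp [kt, hf, hη, pull_apply]
  have hQ : ∀ t, D.Q t z = 1 := fun t => by
    rw [← D.Q_zero z]
    refine is_const_of_deriv_eq_zero (f := (D.Q · z))
      (fun s => (D.hasDerivAt_Q s z).differentiableAt) (fun s => ?_) t 0
    rw [(D.hasDerivAt_Q s z).deriv, hk]; simp
  -- the integrating factor of the linear equation
  set P : ℝ → ℝ := fun t => ∫ s in (0 : ℝ)..t, D.p (D.Φ s z)
  have hPc : Continuous fun s => D.p (D.Φ s z) := D.p.continuous.comp
    (D.contDiff_Φ.continuous.comp (continuous_id.prodMk continuous_const))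
  have hP : ∀ t, HasDerivAt P (D.p (D.Φ t z)) t := fun t =>
    intervalIntegral.integral_hasDerivAt_right (hPc.intervalIntegrable _ _)
      (hPc.stronglyMeasurableAtFilter _ _) hPc.continuousAt
  have hZ : ∀ t, HasDerivAt (fun t => Real.exp (-P t) * D.Y t z) (Real.exp (-P t)) t := fun t => by
    have := ((hP t).neg.exp).mul (D.hasDerivAt_Y t z)
    refine this.congr_deriv ?_
    rw [hQ, Pi.neg_apply]
    ring
  have hmono : StrictMono (fun t => Real.exp (-P t) * D.Y t z) :=
    strictMono_of_deriv_pos fun t => by rw [(hZ t).deriv]; positivity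
  have := hmono ht
  simp only [Y_zero, mul_zero] at this
  exact (pos_iff_pos_of_mul_pos this).1 (Real.exp_pos _)

end Coords

end

section

open MeasureTheory Set Filter Per

/-! ### Hopf's argument -/

/-- Differentiation under the integral over a box, for a function that is smooth on a half-space. -/
theorem hasDerivAt_integral_Icc {n : ℕ} {a b : Fin n → ℝ} {g : ℝ × (Fin n → ℝ) → ℝ}
    (hg : ∀ t, 0 < t → ∀ z, ContDiffAt ℝ ∞ g (t, z)) {T : ℝ} (hT : 0 < T) :
    HasDerivAt (fun t => ∫ z in Icc a b, g (t, z))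
      (∫ z in Icc a b, fderiv ℝ g (T, z) (1, 0)) T := by
  have hg' : ∀ p ∈ Icc (T / 2) (2 * T) ×ˢ Icc a b,
      ContinuousWithinAt (fun p => fderiv ℝ g p (1, 0)) (Icc (T / 2) (2 * T) ×ˢ Icc a b) p := by
    rintro ⟨t, z⟩ ⟨ht, -⟩
    have h1 := ((hg t (by linarith [ht.1]) z).fderiv_right (m := ∞) (by simp)).continuousAt
    exact (h1.clm_apply continuousAt_const).continuousWithinAt
  obtain ⟨C, hC⟩ := (isCompact_Icc.prod isCompact_Icc).exists_bound_of_continuousOn hg'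
  have hcont : ∀ t, 0 < t → Continuous fun z => g (t, z) := fun t ht =>
    continuous_iff_continuousAt.2 fun z => (hg t ht z).continuousAt.comp
      (f := fun z => (t, z)) (continuous_const.prodMk continuous_id).continuousAt
  have hcont' : Continuous fun z => fderiv ℝ g (T, z) (1, 0) :=
    continuous_iff_continuousAt.2 fun z => by
      have h1 := ((hg T hT z).fderiv_right (m := ∞) (by simp)).continuousAt
      exact ContinuousAt.comp (f := fun z => (T, z)) (g := fun p => fderiv ℝ g p (1, 0))
        (h1.clm_apply continuousAt_const) (continuous_const.prodMk continuous_id).continuousAt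
  refine (hasDerivAt_integral_of_dominated_loc_of_deriv_le (F := fun t z => g (t, z))
    (F' := fun t z => fderiv ℝ g (t, z) (1, 0))
    (bound := fun _ => C) (s := Ioo (T / 2) (2 * T)) (Ioo_mem_nhds (by linarith) (by linarith))
    ?_ ?_ ?_ ?_ ?_ ?_).2
  · filter_upwards [Ioi_mem_nhds hT] with t ht
    exact (hcont t ht).aestronglyMeasurable
  · exact (hcont T hT).continuousOn.integrableOn_compact isCompact_Icc
  · exact hcont'.aestronglyMeasurable
  · filter_upwards [ae_restrict_mem measurableSet_Icc] with z hz t ht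
    exact hC (t, z) ⟨Ioo_subset_Icc_self ht, hz⟩
  · exact integrableOn_const isCompact_Icc.measure_lt_top.ne
  · filter_upwards with z t ht
    have h1 := ((hg t (by linarith [ht.1]) z).differentiableAt (by simp)).hasFDerivAt
    exact h1.comp_hasDerivAt t ((hasDerivAt_id t).prodMk (hasDerivAt_const t z))

/-- A solution of the Riccati inequality `J' ≤ -c - J²/M` cannot exist for all positive times:
`arctan (J / √(c M))` would decrease at least at the rate `√(c M) / M`, but it is bounded. -/
theorem not_riccati {J J' : ℝ → ℝ} {c M : ℝ} (hc : 0 < c) (hM : 0 < M)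
    (hJ : ∀ t, 0 < t → HasDerivAt J (J' t) t) (h : ∀ t, 0 < t → J' t ≤ -c - J t ^ 2 / M) :
    False := by
  set r := √(c * M)
  have hr : 0 < r := Real.sqrt_pos.2 (by positivity)
  have hr2 : r ^ 2 = c * M := Real.sq_sqrt (by positivity)
  set κ := r / M
  have hκ : 0 < κ := by positivity
  have hd : ∀ t, 0 < t → HasDerivAt (fun t => Real.arctan (J t / r) + κ * t)
      (1 / (1 + (J t / r) ^ 2) * (J' t / r) + κ * 1) t := fun t ht =>
    (((hJ t ht).div_const r).arctan).add ((hasDerivAt_id t).const_mul κ)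
  have hanti : AntitoneOn (fun t => Real.arctan (J t / r) + κ * t) (Ioi 0) := by
    refine antitoneOn_of_deriv_nonpos (convex_Ioi 0)
      (fun t ht => (hd t ht).continuousAt.continuousWithinAt)
      (fun t ht => (hd t (interior_subset ht)).differentiableAt.differentiableWithinAt)
      fun t ht => ?_
    have ht' : 0 < t := interior_subset ht
    rw [(hd t ht').deriv]
    have h1 := h t ht'
    have h2 : 1 / (1 + (J t / r) ^ 2) * (J' t / r) + κ * 1 =
        r / (r ^ 2 + J t ^ 2) * (J' t - (-c - J t ^ 2 / M)) := by
      have h3 : 0 < r ^ 2 + J t ^ 2 := by positivity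
      simp only [κ]
      have h4 : c = r ^ 2 / M := by rw [hr2]; field_simp
      rw [h4]
      field_simp
      ring
    rw [h2]
    exact mul_nonpos_of_nonneg_of_nonpos (by positivity) (by linarith)
  have h4 : (1 : ℝ) ≤ 1 + 2 * Real.pi / κ := by
    have := Real.pi_pos
    have : 0 < 2 * Real.pi / κ := by positivity
    linarith
  have h5 := hanti (mem_Ioi.2 one_pos) (mem_Ioi.2 (one_pos.trans_le h4)) h4
  simp only at h5
  have h6 : κ * (1 + 2 * Real.pi / κ) = κ + 2 * Real.pi := by field_simp
  have h7 := Real.arctan_lt_pi_div_two (J 1 / r)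
  have h8 := Real.neg_pi_div_two_lt_arctan (J (1 + 2 * Real.pi / κ) / r)
  have := Real.pi_pos
  linarith

namespace Coords

variable (D : Coords)

/-- The solution of the Riccati equation which is singular at time `-T`. -/
def ρ (T : ℝ) (z : Fin 3 → ℝ) : ℝ := D.Q T (D.Φ (-T) z) / D.Y T (D.Φ (-T) z)

/-- The density of the Liouville measure in the coordinates `(x₀, x₁, α)`. -/
def A : Per period3 := pull D.a * pull D.c

theorem A_pos (z : Fin 3 → ℝ) : 0 < D.A z := mul_pos (D.a_pos _) (D.c_pos _)

/-- The derivative of a function along the thermostat flow. -/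
def X (h : Per period3) : Per period3 := ∑ i, D.gen i * d i h

/-- Integration by parts along the flow, whose divergence with respect to `A` is `p`. -/
theorem int_X_mul (g h : Per period3) :
    int (D.X g * h * D.A) = -int (g * (D.X h + D.p * h) * D.A) := by
  have h1 : ∀ i, int (D.gen i * d i g * h * D.A) =
      -int (g * d i (D.gen i * (h * D.A))) := fun i => by
    rw [← int_d_mul period3_pos]
    congr 1
    ring
  have h2 : D.X g * h * D.A = ∑ i, D.gen i * d i g * h * D.A := by
    rw [X, Finset.sum_mul, Finset.sum_mul]
  rw [h2, map_sum, Finset.sum_congr rfl fun i _ => h1 i, Finset.sum_neg_distrib, ← map_sum,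
    ← Finset.mul_sum]
  congr 2
  rw [mul_assoc]
  congr 1
  have h3 : ∀ i, d i (D.gen i * (h * D.A)) = D.gen i * d i h * D.A + h * d i (D.A * D.gen i) :=
    fun i => by
      rw [show D.gen i * (h * D.A) = h * (D.A * D.gen i) by ring, Derivation.leibniz]
      simp only [smul_eq_mul]
      ring
  rw [Finset.sum_congr rfl fun i _ => h3 i, Finset.sum_add_distrib, ← Finset.mul_sum,
    ← Finset.sum_mul]
  have h4 := D.div_gen
  rw [← A] at h4
  rw [h4, X]
  ring

variable {D}

theorem contDiffAt_ρ (hY : ∀ t, 0 < t → ∀ z, D.Y t z ≠ 0) (T : ℝ) (hT : 0 < T) (z : Fin 3 → ℝ) :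
    ContDiffAt ℝ ∞ (fun p : ℝ × (Fin 3 → ℝ) => D.ρ p.1 p.2) (T, z) := by
  have h1 : ContDiff ℝ ∞ (fun p : ℝ × (Fin 3 → ℝ) => (p.1, D.Φ (-p.1) p.2)) :=
    contDiff_fst.prodMk (D.contDiff_Φ.comp (contDiff_fst.neg.prodMk contDiff_snd))
  exact ((D.contDiff_Q.comp h1).contDiffAt).div ((D.contDiff_Y.comp h1).contDiffAt) (hY T hT _)

/-- The function `ρ T` as a smooth function on the unit circle bundle. -/
def ρPer (hY : ∀ t, 0 < t → ∀ z, D.Y t z ≠ 0) {T : ℝ} (hT : 0 < T) : Per period3 :=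
  Per.mk (D.ρ T)
    (contDiff_iff_contDiffAt.2 fun z => (contDiffAt_ρ hY T hT z).comp (f := fun z => (T, z)) z
      (contDiff_const.prodMk contDiff_id).contDiffAt)
    fun i z => by
      have h1 : D.Φ (-T) (z + Pi.single i (period3 i)) = D.Φ (-T) z + Pi.single i (period3 i) :=
        flowMap_periodic period3_pos D.gen (-T) i z
      simp only [ρ, h1]
      congr 1
      · exact D.pairing_periodic D.qForm T i _
      · exact D.pairing_periodic D.yForm T i _

theorem ρPer_apply (hY : ∀ t, 0 < t → ∀ z, D.Y t z ≠ 0) {T : ℝ} (hT : 0 < T) (z : Fin 3 → ℝ) :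
    ρPer hY hT z = D.ρ T z := rfl

/-- The Riccati equation, a consequence of the Jacobi equation. -/
theorem riccati (hY : ∀ t, 0 < t → ∀ z, D.Y t z ≠ 0) {T : ℝ} (hT : 0 < T) (z : Fin 3 → ℝ) :
    fderiv ℝ (fun p : ℝ × (Fin 3 → ℝ) => D.ρ p.1 p.2) (T, z) (1, 0) =
      -(D.X (ρPer hY hT) + ρPer hY hT ^ 2 + D.p * ρPer hY hT + D.kt) z := by
  have hd := ((contDiffAt_ρ hY T hT z).differentiableAt (by simp)).hasFDerivAt
  set R := fun p : ℝ × (Fin 3 → ℝ) => D.ρ p.1 p.2 with hR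
  -- differentiate `ρ` along the trajectory in two ways
  have h1 : HasDerivAt (fun h : ℝ => R (T + h, D.Φ h z))
      (fderiv ℝ R (T, z) (1, vec D.gen z)) 0 := by
    have h2 : HasDerivAt (fun h : ℝ => (T + h, D.Φ h z)) ((1 : ℝ), vec D.gen z) 0 := by
      have h3 := D.hasDerivAt_Φ 0 z
      rw [D.Φ_zero] at h3
      exact ((hasDerivAt_id (0 : ℝ)).const_add T).prodMk h3
    have h4 : HasFDerivAt R (fderiv ℝ R (T, z)) (T + 0, D.Φ 0 z) := by
      rw [add_zero, D.Φ_zero]; exact hd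
    exact HasFDerivAt.comp_hasDerivAt (f := fun h : ℝ => (T + h, D.Φ h z)) 0 h4 h2
  set y := D.Φ (-T) z with hy
  have hyT : D.Φ T y = z := by rw [hy, ← D.Φ_add, add_neg_cancel, D.Φ_zero]
  have h5 : (fun h : ℝ => R (T + h, D.Φ h z)) = fun h => D.Q (T + h) y / D.Y (T + h) y := by
    funext h
    have : D.Φ (-(T + h)) (D.Φ h z) = y := by
      rw [← D.Φ_add, hy]; congr 1; ring
    simp only [hR, ρ, this]
  have h6 : HasDerivAt (fun h => D.Q (T + h) y / D.Y (T + h) y)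
      (-(D.kt z) - R (T, z) ^ 2 - D.p z * R (T, z)) 0 := by
    have hq := (D.hasDerivAt_Q (T + 0) y).comp_const_add T 0
    have hy' := (D.hasDerivAt_Y (T + 0) y).comp_const_add T 0
    have hne : D.Y (T + 0) y ≠ 0 := by rw [add_zero]; exact hY T hT y
    refine (hq.div hy' hne).congr_deriv ?_
    have hne := hY T hT y
    have hRT : R (T, z) = D.Q T y / D.Y T y := rfl
    rw [hRT]
    simp only [add_zero, hyT]
    field_simp
    ring
  rw [h5] at h1
  have h7 := h1.unique h6
  have h8 : fderiv ℝ R (T, z) (0, vec D.gen z) = D.X (ρPer hY hT) z := by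
    have h9 : HasFDerivAt (ρPer hY hT) _ z :=
      HasFDerivAt.comp (f := fun z => (T, z)) z hd (hasFDerivAt_prodMk_right T z)
    have h10 := fderiv_apply (ρPer hY hT) z (vec D.gen z)
    rw [h9.fderiv] at h10
    rw [X, Per.sum_apply]
    exact h10
  have h11 : fderiv ℝ R (T, z) (1, vec D.gen z) =
      fderiv ℝ R (T, z) (1, 0) + fderiv ℝ R (T, z) (0, vec D.gen z) := by
    rw [← map_add]; simp
  rw [h11, h8] at h7
  simp only [Per.add_apply, Per.mul_apply, Per.pow_apply, ρPer_apply]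
  have : R (T, z) = D.ρ T z := rfl
  rw [this] at h7
  linarith

/-- In the absence of conjugate points, the integral of the Riccati equation against a positive
weight `w` gives an inequality for the curvature term. -/
theorem int_kt_le (hY : ∀ t, 0 < t → ∀ z, D.Y t z ≠ 0) (w : Per period3) (hw : ∀ z, 0 < w z) :
    int (w * D.kt * D.A) ≤
      int ((1 / 2 : ℝ) • (D.X w ^ 2 * w.inv (fun z => (hw z).ne') * D.A)) := by
  by_contra! hlt
  set iw := w.inv (fun z => (hw z).ne')
  set c := int (w * D.kt * D.A) - int ((1 / 2 : ℝ) • (D.X w ^ 2 * iw * D.A)) with hc_def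
  have hc : 0 < c := sub_pos.2 hlt
  have hm0 : ∀ z, 0 < (w * D.A) z := fun z => mul_pos (hw z) (D.A_pos z)
  have hN : 0 < int (w * D.A) := by
    refine lt_of_not_ge fun h => ?_
    exact (hm0 0).ne' (eq_zero_of_int_le period3_pos (fun z => (hm0 z).le) h 0)
  set N := int (w * D.A) with hN_def
  set J : ℝ → ℝ := fun t => ∫ z in Icc 0 period3, D.ρ t z * (w * D.A) z with hJ_def
  have hJ : ∀ t (ht : 0 < t), J t = int (ρPer hY ht * (w * D.A)) := fun t ht => rfl
  have hJ' : ∀ t (ht : 0 < t), HasDerivAt J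
      (int (-(D.X (ρPer hY ht) + ρPer hY ht ^ 2 + D.p * ρPer hY ht + D.kt) * (w * D.A))) t :=
    fun t ht => by
      have h1 : ∀ t, 0 < t → ∀ z, ContDiffAt ℝ ∞
          (fun p : ℝ × (Fin 3 → ℝ) => D.ρ p.1 p.2 * (w * D.A) p.2) (t, z) := fun t ht z =>
        (contDiffAt_ρ hY t ht z).mul ((w * D.A).contDiff.comp contDiff_snd).contDiffAt
      refine (hasDerivAt_integral_Icc h1 ht).congr_deriv ?_
      rw [int_def]
      congr 1
      funext z
      have h2 := ((contDiffAt_ρ hY t ht z).differentiableAt (by simp)).hasFDerivAt.mul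
        (((w * D.A).differentiable z).hasFDerivAt.comp (f := Prod.snd) (t, z) hasFDerivAt_snd)
      have h3 : HasFDerivAt (fun p : ℝ × (Fin 3 → ℝ) => D.ρ p.1 p.2 * (w * D.A) p.2) _ (t, z) := h2
      rw [h3.fderiv]
      simp [-Per.add_apply, riccati hY ht z]
      simp only [Per.neg_apply, Per.add_apply]
      ring
  refine not_riccati hc (M := 2 * N) (by positivity)
    (fun t ht => (hJ' t ht).differentiableAt.hasDerivAt) fun t ht => ?_
  rw [(hJ' t ht).deriv, hJ t ht]
  set r := ρPer hY ht
  -- integrate by parts, and complete the square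
  have h1 : -(D.X r + r ^ 2 + D.p * r + D.kt) * (w * D.A) =
      -(D.X r * w * D.A) - r * (D.p * w) * D.A - w * r ^ 2 * D.A - w * D.kt * D.A := by ring
  have h2 : r * (D.X w + D.p * w) * D.A - r * (D.p * w) * D.A = r * D.X w * D.A := by ring
  have h3 : int (-(D.X r + r ^ 2 + D.p * r + D.kt) * (w * D.A)) =
      int (r * D.X w * D.A) - int (w * r ^ 2 * D.A) - int (w * D.kt * D.A) := by
    rw [h1, ← h2, map_sub, map_sub, map_sub, map_sub, map_neg, D.int_X_mul]
    ring
  have h4 : int (r * D.X w * D.A) ≤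
      int ((1 / 2 : ℝ) • (w * r ^ 2 * D.A) + (1 / 2 : ℝ) • (D.X w ^ 2 * iw * D.A)) := by
    refine int_mono fun z => ?_
    simp only [Per.add_apply, Per.smul_apply, Per.mul_apply, Per.pow_apply, iw, inv_apply]
    have hwz := hw z
    have h5 : 1 / 2 * (w z * r z ^ 2 * D.A z) + 1 / 2 * (D.X w z ^ 2 * (w z)⁻¹ * D.A z) -
        r z * D.X w z * D.A z = D.A z * (w z * r z - D.X w z) ^ 2 / (2 * w z) := by
      field_simp
      ring
    have h6 : 0 ≤ D.A z * (w z * r z - D.X w z) ^ 2 / (2 * w z) := by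
      have := D.A_pos z
      positivity
    linarith
  rw [map_add, map_smul] at h4
  -- the Cauchy-Schwarz inequality
  have h7 : int (r * (w * D.A)) ^ 2 / N ≤ int (w * r ^ 2 * D.A) := by
    set q := int (r * (w * D.A)) / N with hq
    have h8 : 0 ≤ int ((r - algebraMap ℝ _ q) ^ 2 * (w * D.A)) :=
      int_nonneg fun z => mul_nonneg (sq_nonneg _) (hm0 z).le
    have h9 : (r - algebraMap ℝ _ q) ^ 2 * (w * D.A) =
        w * r ^ 2 * D.A - (2 * q) • (r * (w * D.A)) + (q ^ 2) • (w * D.A) := by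
      rw [Algebra.smul_def, Algebra.smul_def]
      push_cast [map_mul, map_pow, map_ofNat]
      ring
    rw [h9, map_add, map_sub, map_smul, map_smul] at h8
    have h10 : int (r * (w * D.A)) = q * N := by rw [hq]; field_simp
    simp only [smul_eq_mul] at h8
    rw [h10] at h8 ⊢
    have h11 : (q * N) ^ 2 / N = q ^ 2 * N := by field_simp
    rw [h11]
    linarith
  have h12 : int (r * (w * D.A)) ^ 2 / (2 * N) = (1 / 2) * (int (r * (w * D.A)) ^ 2 / N) := by
    field_simp
  rw [h3, h12]
  simp only [smul_eq_mul] at h4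
  linarith

theorem int_ia_ic (h : Per (1 : Fin 2 → ℝ)) : int (pull h * D.ia * D.ic * D.A) = int (pull h) := by
  congr 1
  refine Per.ext fun z => ?_
  have ha := (D.a_pos (foot z)).ne'
  have hc := (D.c_pos (foot z)).ne'
  simp only [A, Per.mul_apply, ia_apply, ic_apply, pull_apply]
  field_simp

theorem int_dη : int (pull D.dη) = 0 := by
  have h : pull D.dη = d 0 (pull (D.η 1)) - d 1 (pull (D.η 0)) := by
    rw [d0_pull, d1_pull]; rfl
  rw [h, map_sub, int_d period3_pos, int_d period3_pos, sub_zero]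

/-- The integral over the fibres vanishes, as the integrand is a derivative in the angle. -/
theorem int_fibre_n (g₀ g₁ : Per (1 : Fin 2 → ℝ)) :
    int ((pull g₀ * D.n₀ + pull g₁ * D.n₁) * D.A) = 0 := by
  have h : (pull g₀ * D.n₀ + pull g₁ * D.n₁) * D.A =
      d 2 ((pull g₀ * D.v₀ + pull g₁ * D.v₁) * D.A) := by
    simp only [A, Derivation.leibniz, map_add, d2_v₀, d2_v₁, d2_pull, smul_eq_mul]
    ring
  rw [h, int_d period3_pos]

/-- The integral over the fibres vanishes, as the integrand is a derivative in the angle. -/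
theorem int_fibre_v (g₀ g₁ : Per (1 : Fin 2 → ℝ)) :
    int ((pull g₀ * D.v₀ + pull g₁ * D.v₁) * D.A) = 0 := by
  have h : (pull g₀ * D.v₀ + pull g₁ * D.v₁) * D.A =
      d 2 (-((pull g₀ * D.n₀ + pull g₁ * D.n₁) * D.A)) := by
    simp only [A, Derivation.leibniz, map_add, map_neg, d2_n₀, d2_n₁, d2_pull, smul_eq_mul]
    ring
  rw [h, int_d period3_pos]

theorem pull_mul (g h : Per (1 : Fin 2 → ℝ)) : pull (g * h) = pull g * pull h := rfl

theorem pull_sub (g h : Per (1 : Fin 2 → ℝ)) : pull (g - h) = pull g - pull h := rfl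

theorem int_kt : int (D.kt * D.A) = int (pull D.f ^ 2 * D.A) := by
  have h : D.kt * D.A = -(pull D.dη * D.ia * D.ic * D.A) -
      (pull (d 0 D.f) * D.n₀ + pull (d 1 D.f) * D.n₁) * D.A + pull D.f ^ 2 * D.A -
      (pull (D.f * (D.η 0 - D.ω₀)) * D.v₀ + pull (D.f * (D.η 1 - D.ω₁)) * D.v₁) * D.A := by
    simp only [kt, pull_mul, pull_sub]
    ring
  rw [h, map_sub, map_add, map_sub, map_neg, int_ia_ic, int_dη, int_fibre_n, int_fibre_v]
  ring

theorem eq_zero_of_pull {h : Per (1 : Fin 2 → ℝ)} (H : ∀ z, pull h z = 0) : h = 0 :=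
  Per.ext fun x => by
    have := H ![x 0, x 1, 0]
    rw [pull_apply, show foot ![x 0, x 1, 0] = x by funext i; fin_cases i <;> rfl] at this
    exact this

/-- Hopf's argument with the weight `1`: the integral of the curvature term is that of `f²`. -/
theorem f_eq_zero (hY : ∀ t, 0 < t → ∀ z, D.Y t z ≠ 0) : D.f = 0 := by
  have h := int_kt_le hY 1 fun z => one_pos
  have hX : D.X 1 = 0 := by
    rw [X]; exact Finset.sum_eq_zero fun i _ => by rw [Derivation.map_one_eq_zero, mul_zero]
  rw [hX, one_mul, int_kt] at h
  simp only [ne_eq, OfNat.ofNat_ne_zero, not_false_eq_true, zero_pow, zero_mul, smul_zero,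
    map_zero] at h
  refine eq_zero_of_pull fun z => ?_
  have h1 := eq_zero_of_int_le period3_pos (fun z => ?_) h z
  · rw [Per.mul_apply, Per.pow_apply] at h1
    exact pow_eq_zero_iff two_ne_zero |>.1 ((mul_eq_zero.1 h1).resolve_right (D.A_pos z).ne')
  · exact mul_nonneg (sq_nonneg _) (D.A_pos z).le

/-- With the weight `1 + s K`, where `K` is the curvature term and `s` is small, Hopf's argument
shows that `K` vanishes. -/
theorem dη_eq_zero (hY : ∀ t, 0 < t → ∀ z, D.Y t z ≠ 0) : D.dη = 0 := by
  have hf := f_eq_zero hY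
  have hk : D.kt = -(pull D.dη * D.ia * D.ic) := by
    rw [kt, hf, show pull 0 = 0 from rfl, map_zero, map_zero, show pull 0 = 0 from rfl]
    ring
  set k := D.kt with hk_def
  have hk0 : int (k * D.A) = 0 := by
    rw [hk, neg_mul, map_neg, int_ia_ic, int_dη, neg_zero]
  obtain ⟨C, hC, hCk⟩ := exists_bound period3_pos k
  set B := int (D.X k ^ 2 * D.A) with hB_def
  have hB : 0 ≤ B := int_nonneg fun z => mul_nonneg (sq_nonneg _) (D.A_pos z).le
  have key : ∀ s : ℝ, 0 < s → s * C ≤ 1 / 2 → int (k ^ 2 * D.A) ≤ s * B := by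
    intro s hs hsC
    have hw : ∀ z, 1 / 2 ≤ (1 + s • k : Per period3) z := fun z => by
      have h1 := neg_le_of_abs_le (hCk z)
      have h2 := mul_le_mul_of_nonneg_left h1 hs.le
      simp only [Per.add_apply, Per.one_apply, Per.smul_apply]
      linarith
    have hw' : ∀ z, 0 < (1 + s • k : Per period3) z := fun z => lt_of_lt_of_le (by norm_num) (hw z)
    have h := int_kt_le hY (1 + s • k) hw'
    have hX : D.X (1 + s • k) = s • D.X k := by
      simp only [X, map_add, Derivation.map_one_eq_zero, Derivation.map_smul, zero_add,
        Finset.smul_sum, mul_smul_comm]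
    have h1 : (1 + s • k) * k * D.A = k * D.A + s • (k ^ 2 * D.A) := by
      simp only [Algebra.smul_def]; ring
    rw [← hk_def, h1, map_add, hk0, zero_add, map_smul, hX, smul_eq_mul] at h
    have h2 : int ((1 / 2 : ℝ) • ((s • D.X k) ^ 2 * (1 + s • k : Per period3).inv
        (fun z => (hw' z).ne') * D.A)) ≤ int ((s * s) • (D.X k ^ 2 * D.A)) := by
      refine int_mono fun z => ?_
      simp only [Per.smul_apply, Per.mul_apply, Per.pow_apply, inv_apply]
      have h3 : ((1 + s • k : Per period3) z)⁻¹ ≤ 2 :=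
        inv_le_of_inv_le₀ (by norm_num) (by simpa using hw z)
      have h4 : 0 ≤ (s * D.X k z) ^ 2 * D.A z := mul_nonneg (sq_nonneg _) (D.A_pos z).le
      nlinarith [mul_le_mul_of_nonneg_left h3 h4]
    rw [int.map_smul (s * s), smul_eq_mul, ← hB_def, mul_assoc s s B] at h2
    exact le_of_mul_le_mul_left (h.trans h2) hs
  have hle : int (k ^ 2 * D.A) ≤ 0 := by
    refine le_of_forall_pos_le_add fun ε hε => ?_
    set s := min (1 / (2 * C)) (ε / (B + 1)) with hs_def
    have hs : 0 < s := lt_min (by positivity) (by positivity)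
    have h1 : s * C ≤ 1 / 2 := by
      calc s * C ≤ 1 / (2 * C) * C := mul_le_mul_of_nonneg_right (min_le_left _ _) hC.le
        _ = 1 / 2 := by field_simp
    have h2 : s * B ≤ ε := by
      calc s * B ≤ ε / (B + 1) * B := mul_le_mul_of_nonneg_right (min_le_right _ _) hB
        _ ≤ ε / (B + 1) * (B + 1) := by gcongr; linarith
        _ = ε := by field_simp
    linarith [key s hs h1]
  refine eq_zero_of_pull fun z => ?_
  have h1 := eq_zero_of_int_le period3_pos (fun z => mul_nonneg (sq_nonneg _) (D.A_pos z).le) hle z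
  rw [Per.mul_apply, Per.pow_apply] at h1
  have h2 : k z = 0 :=
    pow_eq_zero_iff two_ne_zero |>.1 ((mul_eq_zero.1 h1).resolve_right (D.A_pos z).ne')
  rw [hk] at h2
  simp only [Per.neg_apply, Per.mul_apply, ia_apply, ic_apply, neg_eq_zero] at h2
  have ha := inv_ne_zero (D.a_pos (foot z)).ne'
  have hc := inv_ne_zero (D.c_pos (foot z)).ne'
  exact (mul_eq_zero.1 ((mul_eq_zero.1 h2).resolve_right hc)).resolve_right ha

end Coords

end

section

open Set Filter Per

/-! ### The Levi-Civita connection in an orthonormal frame -/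

/-- Partial derivatives on the torus are computed on the universal covering. -/
theorem pd_eq {h : T2 → ℝ} {H : Per (1 : Fin 2 → ℝ)} (hH : ∀ x, h (proj x) = H x) (i : Fin 2)
    (x : Fin 2 → ℝ) : pd i h (proj x) = d i H x := by
  have hh : Smooth h := by
    rw [Smooth, funext hH]; exact H.contDiff
  rw [pd_proj i h hh, show lift h hh = H from Per.ext hH]

namespace Coords

variable (D : Coords)

/-- The metric `m` is `θ₁² + θ₂²`, where `θ₁ = a dx₀ + b dx₁` and `θ₂ = c dx₁`. -/
def Represents (m : Metric) : Prop := ∀ x, m.g (proj x) =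
  !![D.a x ^ 2, D.a x * D.b x; D.a x * D.b x, D.b x ^ 2 + D.c x ^ 2]

/-- The components of the metric. -/
def gPer : Fin 2 → Fin 2 → Per (1 : Fin 2 → ℝ) :=
  ![![D.a ^ 2, D.a * D.b], ![D.a * D.b, D.b ^ 2 + D.c ^ 2]]

/-- The function `1/a`. -/
def ia' : Per (1 : Fin 2 → ℝ) := D.a.inv fun x => (D.a_pos x).ne'

/-- The function `1/c`. -/
def ic' : Per (1 : Fin 2 → ℝ) := D.c.inv fun x => (D.c_pos x).ne'

/-- The components of `θ₁`. -/
def θ₁ : Fin 2 → Per (1 : Fin 2 → ℝ) := ![D.a, D.b]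

/-- The components of `θ₂`. -/
def θ₂ : Fin 2 → Per (1 : Fin 2 → ℝ) := ![0, D.c]

/-- The components of the Levi-Civita connection form. -/
def conn : Fin 2 → Per (1 : Fin 2 → ℝ) := ![D.ω₀, D.ω₁]

/-- The exterior derivative of the connection form, evaluated on the coordinate frame. -/
def dω : Per (1 : Fin 2 → ℝ) := d 0 D.ω₁ - d 1 D.ω₀

/-- The Christoffel symbols: `∇_{∂ᵢ} ∂ⱼ` has the components `∂ᵢ θ₁(∂ⱼ) - ωᵢ θ₂(∂ⱼ)` and
`∂ᵢ θ₂(∂ⱼ) + ωᵢ θ₁(∂ⱼ)` in the orthonormal frame. -/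
def Γ (k i j : Fin 2) : Per (1 : Fin 2 → ℝ) :=
  ![(d i (D.θ₁ j) - D.conn i * D.θ₂ j) * D.ia' -
      D.b * (d i (D.θ₂ j) + D.conn i * D.θ₁ j) * D.ia' * D.ic',
    (d i (D.θ₂ j) + D.conn i * D.θ₁ j) * D.ic'] k

theorem d_ia' (i : Fin 2) (x : Fin 2 → ℝ) : d i D.ia' x = -(d i D.a x) / D.a x ^ 2 :=
  d_inv_apply _ _ _ _

theorem d_ic' (i : Fin 2) (x : Fin 2 → ℝ) : d i D.ic' x = -(d i D.c x) / D.c x ^ 2 :=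
  d_inv_apply _ _ _ _

theorem ia'_apply (x : Fin 2 → ℝ) : D.ia' x = (D.a x)⁻¹ := rfl

theorem ic'_apply (x : Fin 2 → ℝ) : D.ic' x = (D.c x)⁻¹ := rfl

variable {D} {m : Metric}

theorem Represents.g_apply (h : D.Represents m) (i j : Fin 2) (x : Fin 2 → ℝ) :
    m.g (proj x) i j = D.gPer i j x := by
  rw [h x]
  fin_cases i <;> fin_cases j <;> rfl

theorem Represents.det (h : D.Represents m) (x : Fin 2 → ℝ) :
    (m.g (proj x)).det = (D.a x * D.c x) ^ 2 := by
  rw [h x, Matrix.det_fin_two_of]; ring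

theorem Represents.sqrt_det (h : D.Represents m) (x : Fin 2 → ℝ) :
    √(m.g (proj x)).det = D.a x * D.c x := by
  rw [h.det, Real.sqrt_sq (mul_pos (D.a_pos x) (D.c_pos x)).le]

theorem Represents.inv (h : D.Represents m) (x : Fin 2 → ℝ) :
    (m.g (proj x))⁻¹ = !![(D.b x ^ 2 + D.c x ^ 2) / (D.a x * D.c x) ^ 2,
      -(D.b x / (D.a x * D.c x ^ 2)); -(D.b x / (D.a x * D.c x ^ 2)), 1 / D.c x ^ 2] := by
  have ha := (D.a_pos x).ne'
  have hc := (D.c_pos x).ne'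
  rw [Matrix.inv_def, h.det, Ring.inverse_eq_inv', h x, Matrix.adjugate_fin_two_of]
  ext i j
  fin_cases i <;> fin_cases j <;> simp <;> field_simp

theorem Represents.christoffel (h : D.Represents m) (k i j : Fin 2) (x : Fin 2 → ℝ) :
    m.christoffel k i j (proj x) = D.Γ k i j x := by
  have ha := (D.a_pos x).ne'
  have hc := (D.c_pos x).ne'
  rw [Metric.christoffel, h.inv]
  simp only [fun i j l => pd_eq (h := fun q => m.g q i j) (h.g_apply i j) l x]
  fin_cases k <;> fin_cases i <;> fin_cases j
  all_goals
    simp only [Fin.sum_univ_two, gPer, Γ, θ₁, θ₂, conn, Fin.zero_eta, Fin.mk_one,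
      Matrix.cons_val_zero, Matrix.cons_val_one, Matrix.of_apply, Matrix.cons_val',
      Matrix.cons_val_fin_one, map_add, map_zero, Per.add_apply, Per.sub_apply, Per.mul_apply,
      Per.zero_apply, pow_two, d_mul_apply, ia'_apply, ic'_apply, ω₀_apply, ω₁_apply]
    field_simp
    ring

/-- The curvature tensor is the curvature form `dω` times the rotation of the frame. -/
theorem Represents.curvature (h : D.Represents m) (l k i j : Fin 2) (x : Fin 2 → ℝ) :
    m.curvature l k i j (proj x) = (d i (D.conn j) x - d j (D.conn i) x) *
      ![-(D.θ₂ k x / D.a x) - D.b x * D.θ₁ k x / (D.a x * D.c x), D.θ₁ k x / D.c x] l := by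
  have ha := (D.a_pos x).ne'
  have hc := (D.c_pos x).ne'
  rw [Metric.curvature]
  simp only [fun l i j k => pd_eq (h := m.christoffel l j k) (h.christoffel l j k) i x,
    h.christoffel]
  have hs : ∀ g : Per (1 : Fin 2 → ℝ), d 1 (d 0 g) = d 0 (d 1 g) := fun g => d_comm _ _ _
  fin_cases i <;> fin_cases j
  · simp
  · fin_cases l <;> fin_cases k
    all_goals
      simp only [Fin.sum_univ_two, Γ, θ₁, θ₂, Fin.zero_eta, Fin.mk_one,
        Matrix.cons_val_zero, Matrix.cons_val_one, map_add, map_sub, map_zero, Per.add_apply,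
        Per.sub_apply, Per.mul_apply, Per.zero_apply, d_mul_apply, ia'_apply, ic'_apply, d_ia',
        d_ic', hs]
      generalize D.conn 0 x = w₀
      generalize D.conn 1 x = w₁
      field_simp
      ring
  · fin_cases l <;> fin_cases k
    all_goals
      simp only [Fin.sum_univ_two, Γ, θ₁, θ₂, Fin.zero_eta, Fin.mk_one,
        Matrix.cons_val_zero, Matrix.cons_val_one, map_add, map_sub, map_zero, Per.add_apply,
        Per.sub_apply, Per.mul_apply, Per.zero_apply, d_mul_apply, ia'_apply, ic'_apply, d_ia',
        d_ic', hs]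
      generalize D.conn 0 x = w₀
      generalize D.conn 1 x = w₁
      field_simp
      ring
  · simp

/-- A metric is flat if and only if its connection form is closed. -/
theorem Represents.isFlat_iff (h : D.Represents m) : m.IsFlat ↔ D.dω = 0 := by
  constructor
  · intro H
    refine Per.ext fun x => ?_
    have h1 := H 1 0 0 1 (proj x)
    rw [h.curvature] at h1
    have ha := (D.a_pos x).ne'
    have hc := (D.c_pos x).ne'
    have h2 : D.θ₁ 0 x / D.c x ≠ 0 := div_ne_zero ha hc
    exact (mul_eq_zero.1 h1).resolve_right h2
  · intro H l k i j p
    obtain ⟨x, rfl⟩ := proj_surjective p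
    rw [h.curvature]
    have h1 : d 0 D.ω₁ x - d 1 D.ω₀ x = 0 := congrArg (fun g : Per (1 : Fin 2 → ℝ) => g x) H
    have h2 : d i (D.conn j) x - d j (D.conn i) x = 0 := by
      fin_cases i <;> fin_cases j
      · exact sub_self _
      · exact h1
      · exact (neg_sub _ _).symm.trans (by rw [neg_eq_zero]; exact h1)
      · exact sub_self _
    rw [h2, zero_mul]

end Coords

end

section

open Set Filter Per

/-! ### Thermostat geodesics in coordinates -/

namespace Metric

variable (m : Metric)

/-- The components of the metric as periodic functions. -/
def comp (i j : Fin 2) : Per (1 : Fin 2 → ℝ) := lift (fun p => m.g p i j) (m.smooth i j)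

theorem comp_apply (i j : Fin 2) (x : Fin 2 → ℝ) : m.comp i j x = m.g (proj x) i j := rfl

theorem g_symm (p : T2) : m.g p 1 0 = m.g p 0 1 := by
  simpa using (m.posDef p).isHermitian.apply 0 1

theorem comp_pos (x : Fin 2 → ℝ) : 0 < m.comp 0 0 x := (m.posDef (proj x)).diag_pos

/-- The determinant of the metric. -/
def detPer : Per (1 : Fin 2 → ℝ) := m.comp 0 0 * m.comp 1 1 - m.comp 0 1 ^ 2

theorem detPer_pos (x : Fin 2 → ℝ) : 0 < m.detPer x := by
  have := (m.posDef (proj x)).det_pos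
  rw [Matrix.det_fin_two, m.g_symm] at this
  simp only [detPer, Per.sub_apply, Per.mul_apply, Per.pow_apply, comp_apply]
  nlinarith

/-- The square root of `g₀₀`. -/
def aPer : Per (1 : Fin 2 → ℝ) :=
  Per.comp Real.sqrt (m.comp 0 0) fun x => Real.contDiffAt_sqrt (m.comp_pos x).ne'

theorem aPer_pos (x : Fin 2 → ℝ) : 0 < m.aPer x := Real.sqrt_pos.2 (m.comp_pos x)

theorem aPer_sq (x : Fin 2 → ℝ) : m.aPer x ^ 2 = m.comp 0 0 x := Real.sq_sqrt (m.comp_pos x).le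

/-- The Riemannian area density. -/
def areaPer : Per (1 : Fin 2 → ℝ) :=
  Per.comp Real.sqrt m.detPer fun x => Real.contDiffAt_sqrt (m.detPer_pos x).ne'

theorem areaPer_pos (x : Fin 2 → ℝ) : 0 < m.areaPer x := Real.sqrt_pos.2 (m.detPer_pos x)

theorem areaPer_sq (x : Fin 2 → ℝ) : m.areaPer x ^ 2 = m.detPer x :=
  Real.sq_sqrt (m.detPer_pos x).le

/-- The orthonormal coframe obtained from the coordinate coframe by the Gram-Schmidt process. -/
def frame : Coords where
  a := m.aPer
  b := m.comp 0 1 * m.aPer.inv fun x => (m.aPer_pos x).ne'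
  c := m.areaPer * m.aPer.inv fun x => (m.aPer_pos x).ne'
  f := 0
  η := 0
  a_pos := m.aPer_pos
  c_pos := fun x => mul_pos (m.areaPer_pos x) (inv_pos.2 (m.aPer_pos x))

/-- Gram-Schmidt, i.e. the Cholesky decomposition of the matrix of the metric. -/
theorem represents_frame : m.frame.Represents m := fun x => by
  have ha := (m.aPer_pos x).ne'
  have h1 := m.aPer_sq x
  have h2 := m.areaPer_sq x
  simp only [detPer, Per.sub_apply, Per.mul_apply, Per.pow_apply, ← h1] at h2
  ext i j
  fin_cases i <;> fin_cases j
  · simp [frame, h1, comp_apply]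
  · simp [frame, comp_apply, inv_apply]
    field_simp
  · simp [frame, comp_apply, inv_apply, m.g_symm]
    field_simp
  · simp [frame, inv_apply]
    field_simp
    rw [h2, m.comp_apply 1 1]
    ring

end Metric

namespace Coords

variable {D : Coords} {m : Metric}

/-- The coordinates of the thermostat with the orthonormal coframe of `D`, the function `f` and the
vector field `e`. -/
def thermostat (D : Coords) (f : Per (1 : Fin 2 → ℝ)) (e : Fin 2 → Per (1 : Fin 2 → ℝ)) : Coords :=
  { D with
    f := f
    η := ![D.ω₀ - D.a * D.c * e 1, D.ω₁ + D.a * D.c * e 0] }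

theorem Represents.inner_eq (h : D.Represents m) (x V V' : Fin 2 → ℝ) :
    m.inner (proj x) V V' = (D.a x * V 0 + D.b x * V 1) * (D.a x * V' 0 + D.b x * V' 1) +
      (D.c x * V 1) * (D.c x * V' 1) := by
  rw [Metric.inner, h x]
  simp [dotProduct, Matrix.mulVec, Fin.sum_univ_two]
  ring

theorem Represents.norm_eq (h : D.Represents m) (x V : Fin 2 → ℝ) :
    m.norm (proj x) V = √((D.a x * V 0 + D.b x * V 1) ^ 2 + (D.c x * V 1) ^ 2) := by
  rw [Metric.norm, h.inner_eq]
  ring_nf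

theorem Represents.rot_eq {M : OrientedTorus} (h : D.Represents M.toMetric) (x V : Fin 2 → ℝ) :
    M.rot (proj x) V = (((M.sign : ℤ) : ℝ)) •
      ![-(D.c x * V 1) / D.a x - D.b x * (D.a x * V 0 + D.b x * V 1) / (D.a x * D.c x),
        (D.a x * V 0 + D.b x * V 1) / D.c x] := by
  have ha := (D.a_pos x).ne'
  have hc := (D.c_pos x).ne'
  rw [OrientedTorus.rot, h.sqrt_det, h x]
  funext i
  fin_cases i
  · simp [dotProduct, Matrix.mulVec, Fin.sum_univ_two]
    field_simp
    ring
  · simp [dotProduct, Matrix.mulVec, Fin.sum_univ_two]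
    field_simp

/-- `D` describes the thermostat `(M, f, e)`. -/
structure Describes (D : Coords) (M : OrientedTorus) (f : T2 → ℝ) (e : T2 → Fin 2 → ℝ) : Prop where
  metric : D.Represents M.toMetric
  f_eq : ∀ x, D.f x = ((M.sign : ℤ) : ℝ) * f (proj x)
  η₀_eq : ∀ x, D.η 0 x = D.ω₀ x - D.a x * D.c x * e (proj x) 1
  η₁_eq : ∀ x, D.η 1 x = D.ω₁ x + D.a x * D.c x * e (proj x) 0

variable {M : OrientedTorus} {f : T2 → ℝ} {e : T2 → Fin 2 → ℝ}

/-- The right-hand side of the equation of thermostat geodesics. The sign of the orientation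
survives only in front of `f`, since the rotation enters the term `⟨e, iv⟩ iv` twice. -/
theorem Describes.force (hD : D.Describes M f e) (x V : Fin 2 → ℝ) (k : Fin 2) :
    M.lam f e (proj x) V * M.rot (proj x) V k =
      (D.f x + D.a x * D.c x * (e (proj x) 1 * V 0 - e (proj x) 0 * V 1)) *
      ![-(D.c x * V 1) / D.a x - D.b x * (D.a x * V 0 + D.b x * V 1) / (D.a x * D.c x),
        (D.a x * V 0 + D.b x * V 1) / D.c x] k := by
  have ha := (D.a_pos x).ne'
  have hc := (D.c_pos x).ne'
  have hsg : ((M.sign : ℤ) : ℝ) ^ 2 = 1 := by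
    rcases Int.units_eq_one_or M.sign with h | h <;> simp [h]
  rw [OrientedTorus.lam, hD.metric.inner_eq, hD.metric.rot_eq, hD.f_eq]
  simp only [Pi.smul_apply, smul_eq_mul]
  generalize ((M.sign : ℤ) : ℝ) = s at *
  rw [← mul_assoc]
  congr 1
  simp only [Matrix.cons_val_zero, Matrix.cons_val_one]
  field_simp
  linear_combination (D.a x * (e (proj x) 1 * V 0 - e (proj x) 0 * V 1) * D.c x ^ 2) * hsg

theorem gen_apply (z : Fin 3 → ℝ) : vec D.gen z = ![D.v₀ z, D.v₁ z,
    D.f (foot z) - D.η 0 (foot z) * D.v₀ z - D.η 1 (foot z) * D.v₁ z] := by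
  funext i
  fin_cases i <;> rfl

theorem hasDerivAt_comp_Φ (h : Per period3) (t : ℝ) (z : Fin 3 → ℝ) :
    HasDerivAt (fun t => h (D.Φ t z)) (D.X h (D.Φ t z)) t := by
  have := (h.differentiable _).hasFDerivAt.comp_hasDerivAt t (D.hasDerivAt_Φ t z)
  rw [fderiv_apply] at this
  rw [X, Per.sum_apply]
  exact this

theorem hasDerivAt_foot_Φ (t : ℝ) (z : Fin 3 → ℝ) :
    HasDerivAt (fun t => foot (D.Φ t z)) ![D.v₀ (D.Φ t z), D.v₁ (D.Φ t z)] t := by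
  have h := D.hasDerivAt_Φ t z
  rw [gen_apply] at h
  have h' := hasDerivAt_pi.1 h
  refine hasDerivAt_pi.2 fun i => ?_
  fin_cases i
  · exact h' 0
  · exact h' 1

/-- The geodesic equation for the first coordinate of a trajectory, with `∇_v v` expressed through
the Christoffel symbols. -/
theorem X_v₀ (z : Fin 3 → ℝ) : D.X D.v₀ z +
    (D.Γ 0 0 0 (foot z) * D.v₀ z * D.v₀ z + D.Γ 0 0 1 (foot z) * D.v₀ z * D.v₁ z +
      (D.Γ 0 1 0 (foot z) * D.v₁ z * D.v₀ z + D.Γ 0 1 1 (foot z) * D.v₁ z * D.v₁ z)) =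
    (D.f (foot z) - (D.η 0 (foot z) - D.ω₀ (foot z)) * D.v₀ z -
      (D.η 1 (foot z) - D.ω₁ (foot z)) * D.v₁ z) * D.n₀ z := by
  have ha := (D.a_pos (foot z)).ne'
  have hc := (D.c_pos (foot z)).ne'
  simp only [X, Fin.sum_univ_three, Per.add_apply, Per.mul_apply, gen, Matrix.cons_val_zero,
    Matrix.cons_val_one, Matrix.cons_val, Per.sub_apply, pull_apply, d0_v₀, d1_v₀, d2_v₀, d0_ia,
    d1_ia, d0_ic, d1_ic, v₀_apply, v₁_apply, n₀_apply, ia_apply, ic_apply, Γ, θ₁, θ₂, conn,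
    ia'_apply, ic'_apply, map_zero, Per.zero_apply]
  generalize D.ω₀ (foot z) = w₀
  generalize D.ω₁ (foot z) = w₁
  field_simp
  ring

/-- The geodesic equation for the second coordinate of a trajectory. -/
theorem X_v₁ (z : Fin 3 → ℝ) : D.X D.v₁ z +
    (D.Γ 1 0 0 (foot z) * D.v₀ z * D.v₀ z + D.Γ 1 0 1 (foot z) * D.v₀ z * D.v₁ z +
      (D.Γ 1 1 0 (foot z) * D.v₁ z * D.v₀ z + D.Γ 1 1 1 (foot z) * D.v₁ z * D.v₁ z)) =
    (D.f (foot z) - (D.η 0 (foot z) - D.ω₀ (foot z)) * D.v₀ z -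
      (D.η 1 (foot z) - D.ω₁ (foot z)) * D.v₁ z) * D.n₁ z := by
  have ha := (D.a_pos (foot z)).ne'
  have hc := (D.c_pos (foot z)).ne'
  simp only [X, Fin.sum_univ_three, Per.add_apply, Per.mul_apply, gen, Matrix.cons_val_zero,
    Matrix.cons_val_one, Matrix.cons_val, Per.sub_apply, pull_apply, d0_v₁, d1_v₁, d2_v₁,
    d0_ic, d1_ic, v₀_apply, v₁_apply, n₁_apply, Γ, θ₁, θ₂, conn,
    ic'_apply, map_zero, Per.zero_apply]
  generalize D.ω₀ (foot z) = w₀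
  generalize D.ω₁ (foot z) = w₁
  field_simp
  ring

/-- The components of the unit vector in the orthonormal frame are `cos α` and `sin α`. -/
theorem frame_v (z : Fin 3 → ℝ) : D.a (foot z) * D.v₀ z + D.b (foot z) * D.v₁ z = cosA z := by
  have ha := (D.a_pos (foot z)).ne'
  have hc := (D.c_pos (foot z)).ne'
  rw [v₀_apply, v₁_apply]
  field_simp
  ring

theorem frame_v' (z : Fin 3 → ℝ) : D.c (foot z) * D.v₁ z = sinA z := by
  have hc := (D.c_pos (foot z)).ne'
  rw [v₁_apply]
  field_simp

/-- The trajectories of the flow in coordinates project to thermostat geodesics. -/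
theorem Describes.isThermostatGeodesic (hD : D.Describes M f e) (z : Fin 3 → ℝ) :
    M.IsThermostatGeodesic f e (fun t => foot (D.Φ t z)) := by
  have hd : deriv (fun t => foot (D.Φ t z)) = fun t => ![D.v₀ (D.Φ t z), D.v₁ (D.Φ t z)] :=
    funext fun t => (hasDerivAt_foot_Φ t z).deriv
  have hdd : ∀ t, deriv (fun t => ![D.v₀ (D.Φ t z), D.v₁ (D.Φ t z)]) t =
      ![D.X D.v₀ (D.Φ t z), D.X D.v₁ (D.Φ t z)] := fun t => by
    refine HasDerivAt.deriv (hasDerivAt_pi.2 fun i => ?_)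
    fin_cases i
    · exact hasDerivAt_comp_Φ D.v₀ t z
    · exact hasDerivAt_comp_Φ D.v₁ t z
  refine ⟨?_, fun t => ?_, fun t k => ?_⟩
  · exact ((contDiff_foot.comp D.contDiff_Φ).comp
      (contDiff_id.prodMk (contDiff_const (c := z)))).of_le two_le_infty
  · rw [hd, hD.metric.norm_eq]
    simp only [Matrix.cons_val_zero, Matrix.cons_val_one]
    rw [frame_v, frame_v', sinA_sq]
    simp
  · rw [hd, hdd, hD.force]
    simp only [Fin.sum_univ_two, hD.metric.christoffel, Matrix.cons_val_zero, Matrix.cons_val_one]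
    set y := D.Φ t z
    have h1 := D.n₀_apply y
    have h2 := D.n₁_apply y
    rw [frame_v, frame_v']
    have h3 : D.f (foot y) + D.a (foot y) * D.c (foot y) *
        (e (proj (foot y)) 1 * D.v₀ y - e (proj (foot y)) 0 * D.v₁ y) =
        D.f (foot y) - (D.η 0 (foot y) - D.ω₀ (foot y)) * D.v₀ y -
          (D.η 1 (foot y) - D.ω₁ (foot y)) * D.v₁ y := by
      rw [hD.η₀_eq, hD.η₁_eq]; ring
    rw [h3]
    fin_cases k
    · have h4 := D.X_v₀ y
      rw [h1] at h4
      simp only [Fin.zero_eta, Matrix.cons_val_zero]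
      rw [h4]
      ring
    · have h4 := D.X_v₁ y
      rw [h2] at h4
      simp only [Fin.mk_one, Matrix.cons_val_one, Matrix.cons_val_fin_one]
      rw [h4]

theorem hasDerivAt_comp_curve (h : Per (1 : Fin 2 → ℝ)) {c : ℝ → Fin 2 → ℝ} {V : Fin 2 → ℝ} {t : ℝ}
    (hc : HasDerivAt c V t) :
    HasDerivAt (fun t => h (c t)) (V 0 * d 0 h (c t) + V 1 * d 1 h (c t)) t := by
  have := (h.differentiable _).hasFDerivAt.comp_hasDerivAt t hc
  rw [fderiv_apply, Fin.sum_univ_two] at this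
  exact this

/-- A thermostat geodesic is the projection of a trajectory of the flow in coordinates: the angle of
its velocity is recovered by integrating `α̇ = f - η(γ̇)`. -/
theorem Describes.eq_foot_Φ (hD : D.Describes M f e) {c : ℝ → Fin 2 → ℝ}
    (hc : M.IsThermostatGeodesic f e c) {α₀ : ℝ}
    (h0 : deriv c 0 = ![D.v₀ ![c 0 0, c 0 1, α₀], D.v₁ ![c 0 0, c 0 1, α₀]]) (t : ℝ) :
    c t = foot (D.Φ t ![c 0 0, c 0 1, α₀]) := by
  have hc1 : ∀ t, HasDerivAt c (deriv c t) t := fun t =>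
    (hc.contDiff.differentiable (by norm_num) t).hasDerivAt
  have hcd : ContDiff ℝ 1 (deriv c) := hc.contDiff.deriv' (n := 1)
  have hc2 : ∀ t i, HasDerivAt (fun t => deriv c t i) (deriv (deriv c) t i) t := fun t =>
    hasDerivAt_pi.1 (hcd.differentiable (by norm_num) t).hasDerivAt
  set κ : ℝ → ℝ := fun t => D.f (c t) - D.η 0 (c t) * deriv c t 0 - D.η 1 (c t) * deriv c t 1
  have hcc : Continuous c := hc.contDiff.continuous
  have hcdc : ∀ i, Continuous fun t => deriv c t i := fun i =>
    (continuous_apply i).comp hcd.continuous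
  have hκ : Continuous κ := (((D.f.continuous.comp hcc)).sub
    (((D.η 0).continuous.comp hcc).mul (hcdc 0))).sub (((D.η 1).continuous.comp hcc).mul (hcdc 1))
  set α : ℝ → ℝ := fun t => α₀ + ∫ s in (0 : ℝ)..t, κ s
  have hα : ∀ t, HasDerivAt α (κ t) t := fun t =>
    (intervalIntegral.integral_hasDerivAt_right (hκ.intervalIntegrable _ _)
      (hκ.stronglyMeasurableAtFilter _ _) hκ.continuousAt).const_add α₀
  set u : ℝ → ℝ := fun t => D.a (c t) * deriv c t 0 + D.b (c t) * deriv c t 1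
  set w : ℝ → ℝ := fun t => D.c (c t) * deriv c t 1
  have hu : ∀ t, HasDerivAt u (-(κ t * w t)) t := fun t => by
    have h1 := ((hasDerivAt_comp_curve D.a (hc1 t)).mul (hc2 t 0)).add
      ((hasDerivAt_comp_curve D.b (hc1 t)).mul (hc2 t 1))
    refine h1.congr_deriv ?_
    have e0 := hc.equation t 0
    have e1 := hc.equation t 1
    rw [hD.force] at e0 e1
    simp only [Fin.sum_univ_two, hD.metric.christoffel, Matrix.cons_val_zero,
      Matrix.cons_val_one] at e0 e1
    rw [← eq_sub_iff_add_eq] at e0 e1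
    rw [e0, e1]
    have ha := (D.a_pos (c t)).ne'
    have hc := (D.c_pos (c t)).ne'
    simp only [κ, w, hD.η₀_eq, hD.η₁_eq, Γ, θ₁, θ₂, conn, ia'_apply, ic'_apply, map_zero,
      Per.zero_apply, Per.add_apply, Per.sub_apply, Per.mul_apply, Matrix.cons_val_zero,
      Matrix.cons_val_one]
    generalize D.ω₀ (c t) = w₀
    generalize D.ω₁ (c t) = w₁
    field_simp
    ring
  have hw : ∀ t, HasDerivAt w (κ t * u t) t := fun t => by
    have h1 := (hasDerivAt_comp_curve D.c (hc1 t)).mul (hc2 t 1)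
    refine h1.congr_deriv ?_
    have e1 := hc.equation t 1
    rw [hD.force] at e1
    simp only [Fin.sum_univ_two, hD.metric.christoffel, Matrix.cons_val_zero,
      Matrix.cons_val_one] at e1
    rw [← eq_sub_iff_add_eq] at e1
    rw [e1]
    have ha := (D.a_pos (c t)).ne'
    have hc := (D.c_pos (c t)).ne'
    simp only [κ, u, hD.η₀_eq, hD.η₁_eq, Γ, θ₁, θ₂, conn, ic'_apply, map_zero,
      Per.zero_apply, Per.add_apply, Per.mul_apply, Matrix.cons_val_zero,
      Matrix.cons_val_one]
    generalize D.ω₀ (c t) = w₀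
    generalize D.ω₁ (c t) = w₁
    field_simp
    ring
  set z₀ : Fin 3 → ℝ := ![c 0 0, c 0 1, α₀] with hz₀
  have hfoot : foot z₀ = c 0 := by funext i; fin_cases i <;> rfl
  have hα0 : α 0 = α₀ := by simp [α]
  have hu0 : u 0 = Real.cos α₀ := by
    have := D.frame_v z₀
    rw [hfoot] at this
    simp only [u, h0, Matrix.cons_val_zero, Matrix.cons_val_one]
    exact this
  have hw0 : w 0 = Real.sin α₀ := by
    have := D.frame_v' z₀
    rw [hfoot] at this
    simp only [w, h0, Matrix.cons_val_one]
    exact this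
  -- the frame components `(u, w)` and `(cos α, sin α)` rotate with the same speed `κ`
  have hp : ∀ t, u t * Real.cos (α t) + w t * Real.sin (α t) = 1 := fun t => by
    have h1 : ∀ t, HasDerivAt (fun t => u t * Real.cos (α t) + w t * Real.sin (α t)) 0 t :=
      fun t => by
        refine (((hu t).mul (hα t).cos).add ((hw t).mul (hα t).sin)).congr_deriv ?_
        ring
    have h2 := is_const_of_deriv_eq_zero (fun t => (h1 t).differentiableAt)
      (fun t => (h1 t).deriv) t 0
    rw [h2, hα0, hu0, hw0]
    linarith [Real.sin_sq_add_cos_sq α₀]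
  have huw : ∀ t, u t ^ 2 + w t ^ 2 = 1 := fun t => by
    have := hc.unitSpeed t
    rw [hD.metric.norm_eq, Real.sqrt_eq_one] at this
    exact this
  have hcs : ∀ t, u t = Real.cos (α t) ∧ w t = Real.sin (α t) := fun t => by
    have h1 : (u t - Real.cos (α t)) ^ 2 + (w t - Real.sin (α t)) ^ 2 = 0 := by
      linarith [huw t, hp t, Real.sin_sq_add_cos_sq (α t)]
    have h2 := sq_nonneg (u t - Real.cos (α t))
    have h3 := sq_nonneg (w t - Real.sin (α t))
    exact ⟨sub_eq_zero.1 (pow_eq_zero_iff two_ne_zero |>.1 (by linarith)),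
      sub_eq_zero.1 (pow_eq_zero_iff two_ne_zero |>.1 (by linarith))⟩
  have hz : ∀ t, HasDerivAt (fun t => ![c t 0, c t 1, α t])
      (vec D.gen ![c t 0, c t 1, α t]) t := fun t => by
    have hf : foot ![c t 0, c t 1, α t] = c t := by funext i; fin_cases i <;> rfl
    have ha := (D.a_pos (c t)).ne'
    have hc' := (D.c_pos (c t)).ne'
    have hv1 : D.v₁ ![c t 0, c t 1, α t] = deriv c t 1 := by
      rw [v₁_apply, hf, show sinA ![c t 0, c t 1, α t] = w t from (hcs t).2.symm]
      simp only [w]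
      field_simp
    have hv0 : D.v₀ ![c t 0, c t 1, α t] = deriv c t 0 := by
      rw [v₀_apply, hf, show sinA ![c t 0, c t 1, α t] = w t from (hcs t).2.symm,
        show cosA ![c t 0, c t 1, α t] = u t from (hcs t).1.symm]
      simp only [u, w]
      field_simp
      ring
    rw [gen_apply, hv0, hv1, hf]
    refine hasDerivAt_pi.2 fun i => ?_
    fin_cases i
    · exact hasDerivAt_pi.1 (hc1 t) 0
    · exact hasDerivAt_pi.1 (hc1 t) 1
    · exact hα t
  have h := flowMap_unique period3_pos D.gen hz t
  simp only [hα0] at h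
  rw [Φ, ← h]
  funext i
  fin_cases i <;> rfl

end Coords

end

section

open Set Filter Per

/-! ### Conjugate points and the Jacobi equation -/

theorem det_fin_two (A : (Fin 2 → ℝ) →L[ℝ] (Fin 2 → ℝ)) :
    A.det = A (Pi.single 0 1) 0 * A (Pi.single 1 1) 1 -
      A (Pi.single 1 1) 0 * A (Pi.single 0 1) 1 := by
  rw [ContinuousLinearMap.det, ← LinearMap.det_toMatrix', Matrix.det_fin_two]
  simp [LinearMap.toMatrix'_apply]

/-- The inverse function theorem in the plane. -/
theorem isLocalDiffeomorphAt_of_det {F : (Fin 2 → ℝ) → Fin 2 → ℝ} (hF : ContDiff ℝ ∞ F)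
    {q : Fin 2 → ℝ} (h : (fderiv ℝ F q).det ≠ 0) :
    IsLocalDiffeomorphAt 𝓘(ℝ, Fin 2 → ℝ) 𝓘(ℝ, Fin 2 → ℝ) ∞ F q := by
  have hd : ∀ p, HasFDerivAt F (fderiv ℝ F p) p := fun p =>
    (hF.differentiable (by simp) p).hasFDerivAt
  have hdet : ∀ p (hp : (fderiv ℝ F p).det ≠ 0), HasFDerivAt F
      (((fderiv ℝ F p).toContinuousLinearEquivOfDetNeZero hp : (Fin 2 → ℝ) ≃L[ℝ] (Fin 2 → ℝ)) :
        (Fin 2 → ℝ) →L[ℝ] (Fin 2 → ℝ)) p := fun p hp => by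
    rw [ContinuousLinearMap.coe_toContinuousLinearEquivOfDetNeZero]
    exact hd p
  have hS : IsOpen {p | (fderiv ℝ F p).det ≠ 0} := by
    have : Continuous fun p => (fderiv ℝ F p).det :=
      ContinuousLinearMap.continuous_det.comp (hF.continuous_fderiv (by simp))
    exact isOpen_ne.preimage this
  set e := (hF.contDiffAt.toOpenPartialHomeomorph F (hdet q h) (by simp)).restrOpen _ hS with he
  have hes : e.source ⊆ {p | (fderiv ℝ F p).det ≠ 0} := by
    rw [he, OpenPartialHomeomorph.restrOpen_source]; exact inter_subset_right
  have heF : (e : (Fin 2 → ℝ) → Fin 2 → ℝ) = F := rfl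
  refine ⟨⟨e.toPartialEquiv, e.open_source, e.open_target, ?_, ?_⟩, ?_, fun p _ => rfl⟩
  · exact (hF.contMDiff).contMDiffOn
  · rw [contMDiffOn_iff_contDiffOn]
    intro y hy
    exact (e.contDiffAt_symm hy (hdet _ (hes (e.map_target hy))) hF.contDiffAt).contDiffWithinAt
  · exact ⟨hF.contDiffAt.mem_toOpenPartialHomeomorph_source (hdet q h) (by simp), h⟩

theorem det_ne_zero_of_isLocalDiffeomorphAt {F : (Fin 2 → ℝ) → Fin 2 → ℝ} {q : Fin 2 → ℝ}
    (h : IsLocalDiffeomorphAt 𝓘(ℝ, Fin 2 → ℝ) 𝓘(ℝ, Fin 2 → ℝ) ∞ F q) :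
    (fderiv ℝ F q).det ≠ 0 := by
  have h1 := h.mfderivToContinuousLinearEquiv_coe (by simp)
  rw [mfderiv_eq_fderiv] at h1
  rw [← h1]
  exact (LinearEquiv.isUnit_det' (ContinuousLinearEquiv.toLinearEquiv
    (h.mfderivToContinuousLinearEquiv (by simp)) : (Fin 2 → ℝ) ≃ₗ[ℝ] (Fin 2 → ℝ))).ne_zero

theorem fderiv_single {F : (Fin 2 → ℝ) → Fin 2 → ℝ} {q V : Fin 2 → ℝ} (i : Fin 2)
    (hF : DifferentiableAt ℝ F q) (h : HasDerivAt (fun s => F (Function.update q i s)) V (q i)) :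
    fderiv ℝ F q (Pi.single i 1) = V := by
  have h1 := hasDerivAt_update q i (q i)
  have h2 : HasFDerivAt F (fderiv ℝ F q) (Function.update q i (q i)) := by
    rw [Function.update_eq_self]; exact hF.hasFDerivAt
  exact (h2.comp_hasDerivAt (q i) h1).unique h

/-- The flow of a periodic vector field commutes with the translations of the period lattice. -/
theorem flowMap_translate {n : ℕ} {L : Fin n → ℝ} (hL : ∀ i, 0 < L i) (F : Fin n → Per L) (t : ℝ)
    {z z' : Fin n → ℝ} (h : ∀ i, ∃ k : ℤ, z i = z' i + k * L i) :
    flowMap hL F t z = flowMap hL F t z' + (z - z') := by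
  have h1 := flowMap_unique hL F (γ := fun t => flowMap hL F t z' + (z - z')) (fun t => ?_) t
  · simp only [flowMap_zero, add_sub_cancel] at h1
    exact h1.symm
  · refine ((hasDerivAt_flowMap hL F t z').add_const (z - z')).congr_deriv (funext fun j => ?_)
    refine ((F j).eq_of_sub_int fun i => ?_).symm
    obtain ⟨k, hk⟩ := h i
    exact ⟨k, by simp [hk]⟩

/-- The point of the unit circle bundle with foot point `x` and angle `α`. -/
def base (x : Fin 2 → ℝ) (α : ℝ) : Fin 3 → ℝ := ![x 0, x 1, α]

theorem foot_base (x : Fin 2 → ℝ) (α : ℝ) : foot (base x α) = x := by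
  funext i; fin_cases i <;> rfl

theorem base_foot (z : Fin 3 → ℝ) : base (foot z) (z 2) = z := by
  funext i; fin_cases i <;> rfl

theorem hasDerivAt_base (x : Fin 2 → ℝ) (α : ℝ) :
    HasDerivAt (base x) (Pi.single 2 1) α := by
  refine hasDerivAt_pi.2 fun i => ?_
  fin_cases i
  · exact hasDerivAt_const _ _
  · exact hasDerivAt_const _ _
  · exact hasDerivAt_id _

theorem contDiff_base (x : Fin 2 → ℝ) : ContDiff ℝ ∞ (base x) := by
  refine contDiff_pi.2 fun i => ?_
  fin_cases i
  · exact contDiff_const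
  · exact contDiff_const
  · exact contDiff_id

namespace Coords

variable (D : Coords)

/-- The tangent vector at `x` with polar coordinates `q = (r, α)`. -/
def polar (x q : Fin 2 → ℝ) : Fin 2 → ℝ :=
  ![q 0 * D.v₀ (base x (q 1)), q 0 * D.v₁ (base x (q 1))]

/-- The exponential map at `x` in polar coordinates. -/
def expPolar (x q : Fin 2 → ℝ) : Fin 2 → ℝ := foot (D.Φ (q 0) (base x (q 1)))

theorem contDiff_polar (x : Fin 2 → ℝ) : ContDiff ℝ ∞ (D.polar x) := by
  have h1 : ContDiff ℝ ∞ fun q : Fin 2 → ℝ => base x (q 1) :=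
    (contDiff_base x).comp (contDiff_apply ℝ ℝ 1)
  refine contDiff_pi.2 fun i => ?_
  fin_cases i
  · exact (contDiff_apply ℝ ℝ 0).mul (D.v₀.contDiff.comp h1)
  · exact (contDiff_apply ℝ ℝ 0).mul (D.v₁.contDiff.comp h1)

theorem contDiff_expPolar (x : Fin 2 → ℝ) : ContDiff ℝ ∞ (D.expPolar x) := by
  have h1 : ContDiff ℝ ∞ fun q : Fin 2 → ℝ => base x (q 1) :=
    (contDiff_base x).comp (contDiff_apply ℝ ℝ 1)
  exact contDiff_foot.comp (D.contDiff_Φ.comp ((contDiff_apply ℝ ℝ 0).prodMk h1))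

theorem hasDerivAt_comp_base (h : Per period3) (x : Fin 2 → ℝ) (α : ℝ) :
    HasDerivAt (fun s => h (base x s)) (d 2 h (base x α)) α :=
  (h.differentiable _).hasFDerivAt.comp_hasDerivAt α (hasDerivAt_base x α)

theorem det_polar (x q : Fin 2 → ℝ) :
    (fderiv ℝ (D.polar x) q).det = q 0 / (D.a x * D.c x) := by
  have hd := (D.contDiff_polar x).differentiable (by simp) q
  set z := base x (q 1) with hz
  have h0 : fderiv ℝ (D.polar x) q (Pi.single 0 1) = ![D.v₀ z, D.v₁ z] := by
    refine fderiv_single 0 hd (hasDerivAt_pi.2 fun i => ?_)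
    fin_cases i
    · simpa [polar] using (hasDerivAt_id (q 0)).mul_const (D.v₀ z)
    · simpa [polar] using (hasDerivAt_id (q 0)).mul_const (D.v₁ z)
  have h1 : fderiv ℝ (D.polar x) q (Pi.single 1 1) = ![q 0 * D.n₀ z, q 0 * D.n₁ z] := by
    refine fderiv_single 1 hd (hasDerivAt_pi.2 fun i => ?_)
    fin_cases i
    · have := (hasDerivAt_comp_base D.v₀ x (q 1)).const_mul (q 0)
      rw [d2_v₀] at this
      simpa [polar] using this
    · have := (hasDerivAt_comp_base D.v₁ x (q 1)).const_mul (q 0)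
      rw [d2_v₁] at this
      simpa [polar] using this
  rw [det_fin_two, h0, h1]
  simp only [Matrix.cons_val_zero, Matrix.cons_val_one]
  have ha := (D.a_pos x).ne'
  have hc := (D.c_pos x).ne'
  have hs := sinA_sq z
  rw [v₀_apply, v₁_apply, n₀_apply, n₁_apply, hz, foot_base, ← hz]
  field_simp
  linear_combination q 0 * D.c x * hs

/-- The Jacobian of the exponential map in polar coordinates is the solution `Y` of the Jacobi
equation. -/
theorem det_expPolar (x q : Fin 2 → ℝ) :
    (fderiv ℝ (D.expPolar x) q).det * (D.a (D.expPolar x q) * D.c (D.expPolar x q)) =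
      D.Y (q 0) (base x (q 1)) := by
  have hd := (D.contDiff_expPolar x).differentiable (by simp) q
  set z := base x (q 1) with hz
  set y := D.Φ (q 0) z with hy
  set w := D.W (q 0) z with hw
  have h0 : fderiv ℝ (D.expPolar x) q (Pi.single 0 1) = ![D.v₀ y, D.v₁ y] := by
    refine fderiv_single 0 hd ?_
    simpa [expPolar] using D.hasDerivAt_foot_Φ (q 0) z
  have h1 : fderiv ℝ (D.expPolar x) q (Pi.single 1 1) = foot w := by
    refine fderiv_single 1 hd ?_
    have h2 : DifferentiableAt ℝ (D.Φ (q 0)) z :=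
      (D.contDiff_Φ.comp (contDiff_const.prodMk contDiff_id)).differentiable (by simp) z
    have h3 := h2.hasFDerivAt.comp_hasDerivAt (q 1) (hasDerivAt_base x (q 1))
    have h4 := footL.hasFDerivAt.comp_hasDerivAt (q 1) h3
    rw [show fderiv ℝ (D.Φ (q 0)) z (Pi.single 2 1) = w from
      fderiv_flowMap period3_pos D.gen _ _ _, footL_apply] at h4
    refine (h4.congr_of_eventuallyEq (Eventually.of_forall fun s => ?_))
    simp [expPolar, footL_apply]
  have hE : D.expPolar x q = foot y := rfl
  rw [det_fin_two, h0, h1, hE]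
  have ha := (D.a_pos (foot y)).ne'
  have hc := (D.c_pos (foot y)).ne'
  simp only [Matrix.cons_val_zero, Matrix.cons_val_one, Y, Fin.sum_univ_three, ← hy, ← hw, yForm,
    Matrix.cons_val, Per.neg_apply, Per.add_apply, Per.mul_apply, Per.zero_apply, pull_apply,
    v₀_apply, v₁_apply, foot]
  simp only [foot] at ha hc
  field_simp
  ring

theorem exists_polar (x : Fin 2 → ℝ) {w : Fin 2 → ℝ} (hw : w ≠ 0) :
    ∃ q : Fin 2 → ℝ, 0 < q 0 ∧ D.polar x q = w := by
  have ha := (D.a_pos x).ne'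
  have hc := (D.c_pos x).ne'
  set u : ℂ := ⟨D.a x * w 0 + D.b x * w 1, D.c x * w 1⟩ with hu
  have hu0 : u ≠ 0 := by
    intro h
    have h1 : D.c x * w 1 = 0 := congrArg Complex.im h
    have h2 : D.a x * w 0 + D.b x * w 1 = 0 := congrArg Complex.re h
    have h3 : w 1 = 0 := (mul_eq_zero.1 h1).resolve_left hc
    rw [h3, mul_zero, add_zero] at h2
    refine hw (funext fun i => ?_)
    fin_cases i
    · exact (mul_eq_zero.1 h2).resolve_left ha
    · exact h3
  have h1 : ‖u‖ * Real.cos u.arg = D.a x * w 0 + D.b x * w 1 := Complex.norm_mul_cos_arg u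
  have h2 : ‖u‖ * Real.sin u.arg = D.c x * w 1 := Complex.norm_mul_sin_arg u
  refine ⟨![‖u‖, u.arg], norm_pos_iff.2 hu0, ?_⟩
  have hcos : cosA (base x u.arg) = Real.cos u.arg := rfl
  have hsin : sinA (base x u.arg) = Real.sin u.arg := rfl
  funext i
  fin_cases i
  · simp only [polar, Fin.zero_eta, Matrix.cons_val_zero, Matrix.cons_val_one, v₀_apply, foot_base,
      hcos, hsin]
    field_simp
    linear_combination D.c x * h1 - D.b x * h2
  · simp only [polar, Fin.mk_one, Matrix.cons_val_zero, Matrix.cons_val_one, v₁_apply, foot_base,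
      hsin]
    field_simp
    linear_combination h2

variable {D} {M : OrientedTorus} {f : T2 → ℝ} {e : T2 → Fin 2 → ℝ}

/-- The exponential map of the thermostat in polar coordinates. -/
theorem Describes.expMap_polar (hD : D.Describes M f e) (x q : Fin 2 → ℝ) (hq : 0 < q 0) :
    M.expMap f e (proj x) (D.polar x q) = proj (D.expPolar x q) := by
  set z := base x (q 1) with hz
  have hfz : foot z = x := foot_base _ _
  have hnorm : M.norm (proj x) (D.polar x q) = q 0 := by
    have h1 := D.frame_v z
    have h2 := D.frame_v' z
    rw [hfz] at h1 h2
    rw [hD.metric.norm_eq]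
    simp only [polar, ← hz, Matrix.cons_val_zero, Matrix.cons_val_one]
    rw [show (D.a x * (q 0 * D.v₀ z) + D.b x * (q 0 * D.v₁ z)) ^ 2 +
      (D.c x * (q 0 * D.v₁ z)) ^ 2 = q 0 ^ 2 * ((D.a x * D.v₀ z + D.b x * D.v₁ z) ^ 2 +
        (D.c x * D.v₁ z) ^ 2) by ring, h1, h2, sinA_sq, add_sub_cancel, mul_one, Real.sqrt_sq hq.le]
  have hdir : (q 0)⁻¹ • D.polar x q = ![D.v₀ z, D.v₁ z] := by
    funext i
    fin_cases i
    · simp [polar, ← hz, hq.ne']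
    · simp [polar, ← hz, hq.ne']
  have hex : ∃ c, M.IsThermostatGeodesic f e c ∧ proj (c 0) = proj x ∧
      deriv c 0 = ![D.v₀ z, D.v₁ z] := by
    refine ⟨_, hD.isThermostatGeodesic z, ?_, ?_⟩
    · simp only [Φ_zero, hfz]
    · rw [(hasDerivAt_foot_Φ 0 z).deriv, Φ_zero]
  rw [OrientedTorus.expMap, hnorm, hdir, OrientedTorus.flow, dif_pos hex]
  obtain ⟨hc1, hc2, hc3⟩ := hex.choose_spec
  set c := hex.choose
  have hint : ∀ i, ∃ k : ℤ, base (c 0) (q 1) i = z i + k * period3 i := by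
    intro i
    fin_cases i
    · obtain ⟨k, hk⟩ := proj_eq_iff.1 hc2 0
      exact ⟨k, by simpa [base, period3, hz] using hk⟩
    · obtain ⟨k, hk⟩ := proj_eq_iff.1 hc2 1
      exact ⟨k, by simpa [base, period3, hz] using hk⟩
    · exact ⟨0, by simp [base, hz]⟩
  have h3 := hD.eq_foot_Φ hc1 (α₀ := q 1) (by
    change _ = ![D.v₀ (base (c 0) (q 1)), D.v₁ (base (c 0) (q 1))]
    rw [hc3, D.v₀.eq_of_sub_int hint, D.v₁.eq_of_sub_int hint]) (q 0)
  change proj (c (q 0)) = _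
  rw [h3]
  change proj (foot (D.Φ (q 0) (base (c 0) (q 1)))) = _
  rw [Φ, flowMap_translate period3_pos D.gen _ hint, proj_eq_iff]
  intro i
  obtain ⟨k, hk⟩ := proj_eq_iff.1 hc2 i
  refine ⟨k, ?_⟩
  fin_cases i
  · simp [foot, expPolar, Φ, hz, base] at hk ⊢; linarith
  · simp [foot, expPolar, Φ, hz, base] at hk ⊢; linarith

/-- There are no conjugate points if and only if the solutions of the Jacobi equation have no
zeros at positive times. -/
theorem Describes.noConjugatePoints_iff (hD : D.Describes M f e) :
    M.NoConjugatePoints f e ↔ ∀ t, 0 < t → ∀ z, D.Y t z ≠ 0 := by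
  constructor
  · intro H t ht z
    set x := foot z with hx
    set q : Fin 2 → ℝ := ![t, z 2] with hq
    have hw : D.polar x q ≠ 0 := by
      intro h0
      have h1 := D.frame_v z
      have h2 := D.frame_v' z
      have h3 : t * D.v₀ z = 0 := by
        simpa [polar, hq, hx, base_foot] using congrFun h0 0
      have h4 : t * D.v₁ z = 0 := by
        simpa [polar, hq, hx, base_foot] using congrFun h0 1
      rw [(mul_eq_zero.1 h3).resolve_left ht.ne', (mul_eq_zero.1 h4).resolve_left ht.ne'] at h1
      rw [(mul_eq_zero.1 h4).resolve_left ht.ne'] at h2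
      have := sinA_sq z
      rw [← h1, ← h2] at this
      norm_num at this
    obtain ⟨G, hG, hGe⟩ := H (proj x) _ hw
    -- the two lifts of the exponential map differ by a locally constant function
    have hPc : ContinuousAt (D.polar x) q := (D.contDiff_polar x).continuous.continuousAt
    have hGd : DifferentiableAt ℝ G (D.polar x q) :=
      (hG.mdifferentiableAt (by simp)).differentiableAt
    set B := fun p => D.expPolar x p - G (D.polar x p) with hB
    have hBc : ContinuousAt B q := (D.contDiff_expPolar x).continuous.continuousAt.sub
      (ContinuousAt.comp (g := G) hGd.continuousAt hPc)
    have hint : ∀ᶠ p in 𝓝 q, ∀ i, ∃ k : ℤ, B p i = k := by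
      have h1 := hPc.eventually hGe
      have h2 : ∀ᶠ p in 𝓝 q, 0 < p 0 :=
        (continuous_apply (0 : Fin 2)).continuousAt.eventually
          (lt_mem_nhds (by simpa [hq] using ht))
      filter_upwards [h1, h2] with p hp1 hp2 i
      rw [hD.expMap_polar x p hp2, proj_eq_iff] at hp1
      obtain ⟨k, hk⟩ := hp1 i
      exact ⟨k, by simp [hB, hk]⟩
    have hconst : ∀ᶠ p in 𝓝 q, B p = B q := by
      have h1 := hint.self_of_nhds
      filter_upwards [hint, hBc.eventually (Metric.ball_mem_nhds (B q) one_pos)] with p hp1 hp2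
      funext i
      obtain ⟨k, hk⟩ := hp1 i
      obtain ⟨l, hl⟩ := h1 i
      have h2 := (dist_le_pi_dist (B p) (B q) i).trans_lt hp2
      rw [hk, hl, Real.dist_eq] at h2
      rw [hk, hl]
      have h3 : |k - l| < 1 := by exact_mod_cast h2
      have h4 := Int.abs_lt_one_iff.1 h3
      rw [sub_eq_zero.1 h4]
    have hEP : D.expPolar x =ᶠ[𝓝 q] fun p => G (D.polar x p) + B q := by
      filter_upwards [hconst] with p hp
      rw [← hp]; simp [hB]
    have hPd := ((D.contDiff_polar x).differentiable (by simp) q).hasFDerivAt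
    have hGP : HasFDerivAt (fun p => G (D.polar x p) + B q)
        (fderiv ℝ G (D.polar x q) ∘L fderiv ℝ (D.polar x) q) q :=
      (hGd.hasFDerivAt.comp q hPd).add_const _
    have hdet : (fderiv ℝ (D.expPolar x) q).det ≠ 0 := by
      rw [hEP.fderiv_eq, hGP.fderiv]
      have h1 : (fderiv ℝ G (D.polar x q) ∘L fderiv ℝ (D.polar x) q).det =
          (fderiv ℝ G (D.polar x q)).det * (fderiv ℝ (D.polar x) q).det :=
        LinearMap.det_comp _ _
      rw [h1, det_polar]
      refine mul_ne_zero (det_ne_zero_of_isLocalDiffeomorphAt hG) ?_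
      exact div_ne_zero (by simpa [hq] using ht.ne')
        (mul_ne_zero (D.a_pos x).ne' (D.c_pos x).ne')
    have h5 := D.det_expPolar x q
    rw [show base x (q 1) = z from base_foot z, show q 0 = t from rfl] at h5
    rw [← h5]
    exact mul_ne_zero hdet (mul_ne_zero (D.a_pos _).ne' (D.c_pos _).ne')
  · intro hY p w hw
    obtain ⟨x, rfl⟩ := proj_surjective p
    obtain ⟨q, hq, rfl⟩ := D.exists_polar x hw
    have hP : IsLocalDiffeomorphAt 𝓘(ℝ, Fin 2 → ℝ) 𝓘(ℝ, Fin 2 → ℝ) ∞ (D.polar x) q := by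
      refine isLocalDiffeomorphAt_of_det (D.contDiff_polar x) ?_
      rw [det_polar]
      exact div_ne_zero hq.ne' (mul_ne_zero (D.a_pos x).ne' (D.c_pos x).ne')
    have hE : IsLocalDiffeomorphAt 𝓘(ℝ, Fin 2 → ℝ) 𝓘(ℝ, Fin 2 → ℝ) ∞ (D.expPolar x) q := by
      refine isLocalDiffeomorphAt_of_det (D.contDiff_expPolar x) fun h0 =>
        hY (q 0) hq (base x (q 1)) ?_
      rw [← D.det_expPolar x q, h0, zero_mul]
    have hinv : hP.localInverse (D.polar x q) = q :=
      hP.localInverse_left_inv hP.localInverse_mem_target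
    have hE' : IsLocalDiffeomorphAt 𝓘(ℝ, Fin 2 → ℝ) 𝓘(ℝ, Fin 2 → ℝ) ∞ (D.expPolar x)
        (hP.localInverse (D.polar x q)) := by rw [hinv]; exact hE
    refine ⟨D.expPolar x ∘ hP.localInverse, hP.localInverse_isLocalDiffeomorphAt.comp _ _ hE', ?_⟩
    have hcont : ContinuousAt hP.localInverse (D.polar x q) :=
      hP.localInverse_contMDiffAt.continuousAt
    have h1 : ∀ᶠ u in 𝓝 (D.polar x q), 0 < hP.localInverse u 0 := by
      have h2 : ContinuousAt (fun u => hP.localInverse u 0) (D.polar x q) :=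
        (continuous_apply (0 : Fin 2)).continuousAt.comp hcont
      exact h2.eventually (lt_mem_nhds (by simpa only [hinv] using hq))
    filter_upwards [h1, hP.localInverse_open_source.mem_nhds hP.localInverse_mem_source]
      with u h2 h3
    have h4 := hD.expMap_polar x _ h2
    rw [hP.localInverse_right_inv h3] at h4
    exact h4

end Coords

end

section

open Set Filter Per

/-! ### Conformal changes and the divergence -/

namespace Coords

variable (D : Coords)

/-- The matrix `√g g⁻¹`, which depends only on the conformal class of the metric. -/
def coef : Fin 2 → Fin 2 → Per (1 : Fin 2 → ℝ) :=
  ![![(D.b ^ 2 + D.c ^ 2) * D.ia' * D.ic', -(D.b * D.ic')], ![-(D.b * D.ic'), D.a * D.ic']]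

/-- The ellipticity constant is the inverse of a bound of the trace, as the determinant is `1`. -/
theorem exists_elliptic : ∃ κ, 0 < κ ∧ Elliptic D.coef κ := by
  obtain ⟨C, hC, hT⟩ := exists_bound one_pos' ((D.a ^ 2 + D.b ^ 2 + D.c ^ 2) * D.ia' * D.ic')
  refine ⟨1 / C, by positivity, fun x ξ => ?_⟩
  have ha := D.a_pos x
  have hc := D.c_pos x
  have hT' := (le_abs_self _).trans (hT x)
  simp only [Per.add_apply, Per.mul_apply, Per.pow_apply, ia'_apply, ic'_apply] at hT'
  simp only [coef, Fin.sum_univ_two, Matrix.cons_val_zero, Matrix.cons_val_one, Per.add_apply,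
    Per.mul_apply, Per.pow_apply, Per.neg_apply, ia'_apply, ic'_apply]
  set a := D.a x
  set b := D.b x
  set c := D.c x
  set T := (a ^ 2 + b ^ 2 + c ^ 2) * a⁻¹ * c⁻¹ with hT_def
  set N := (b ^ 2 + c ^ 2) * a⁻¹ * c⁻¹ * ξ 0 * ξ 0 + -(b * c⁻¹) * ξ 1 * ξ 0 +
    (-(b * c⁻¹) * ξ 0 * ξ 1 + a * c⁻¹ * ξ 1 * ξ 1) with hN_def
  have hN : 0 ≤ N := by
    have h : N = ((b * ξ 0 - a * ξ 1) ^ 2 + (c * ξ 0) ^ 2) / (a * c) := by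
      rw [hN_def]; field_simp; ring
    rw [h]; positivity
  -- the Cayley-Hamilton theorem for a matrix of determinant one
  have hTN : T * N - (ξ 0 ^ 2 + ξ 1 ^ 2) =
      (((b ^ 2 + c ^ 2) * ξ 0 - a * b * ξ 1) ^ 2 + (a * b * ξ 0 - a ^ 2 * ξ 1) ^ 2) /
        (a * c) ^ 2 := by
    rw [hN_def, hT_def]; field_simp; ring
  have h2 : 0 ≤ T * N - (ξ 0 ^ 2 + ξ 1 ^ 2) := by rw [hTN]; positivity
  have h3 := mul_le_mul_of_nonneg_right hT' hN
  rw [div_mul_eq_mul_div, one_mul, div_le_iff₀ hC]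
  linarith

/-- The coframe of the conformal metric `e^{-2u} g`. -/
def conformal (u : Per (1 : Fin 2 → ℝ)) : Coords where
  a := D.a * Per.comp Real.exp (-u) fun _ => Real.contDiff_exp.contDiffAt
  b := D.b * Per.comp Real.exp (-u) fun _ => Real.contDiff_exp.contDiffAt
  c := D.c * Per.comp Real.exp (-u) fun _ => Real.contDiff_exp.contDiffAt
  f := 0
  η := 0
  a_pos := fun x => mul_pos (D.a_pos x) (Real.exp_pos _)
  c_pos := fun x => mul_pos (D.c_pos x) (Real.exp_pos _)

theorem d_exp_neg (u : Per (1 : Fin 2 → ℝ)) (i : Fin 2) (x : Fin 2 → ℝ) :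
    d i (Per.comp Real.exp (-u) fun _ => Real.contDiff_exp.contDiffAt) x =
      -(Real.exp (-u x) * d i u x) := by
  have h : HasFDerivAt (Per.comp Real.exp (-u) fun _ => Real.contDiff_exp.contDiffAt) _ x :=
    (u.differentiable x).hasFDerivAt.neg.exp
  rw [d_apply, h.fderiv]
  simp [d_apply]

theorem conformal_ω₀ (u : Per (1 : Fin 2 → ℝ)) :
    (D.conformal u).ω₀ = D.ω₀ + ∑ j, D.coef 1 j * d j u := Per.ext fun x => by
  have ha := (D.a_pos x).ne'
  have hc := (D.c_pos x).ne'
  have hE := (Real.exp_pos (-u x)).ne'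
  rw [ω₀_apply, Per.add_apply, ω₀_apply]
  simp only [conformal, coef, d_mul_apply, d_exp_neg, Fin.sum_univ_two, Matrix.cons_val_zero,
    Matrix.cons_val_one, Per.add_apply, Per.mul_apply, Per.neg_apply, ic'_apply, comp_apply]
  field_simp
  ring

theorem conformal_ω₁ (u : Per (1 : Fin 2 → ℝ)) :
    (D.conformal u).ω₁ = D.ω₁ - ∑ j, D.coef 0 j * d j u := Per.ext fun x => by
  have ha := (D.a_pos x).ne'
  have hc := (D.c_pos x).ne'
  have hE := (Real.exp_pos (-u x)).ne'
  rw [ω₁_apply, Per.sub_apply, ω₁_apply]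
  simp only [conformal, coef, d_mul_apply, d_exp_neg, Fin.sum_univ_two, Matrix.cons_val_zero,
    Matrix.cons_val_one, Per.add_apply, Per.mul_apply, Per.neg_apply, Per.pow_apply, ia'_apply,
    ic'_apply, comp_apply]
  field_simp
  ring

/-- The two-form `dη` is the sum of the curvature form of the conformal metric `e^{-2u} g` and the
divergence of `e + ∇u`. -/
theorem dη_thermostat (f u : Per (1 : Fin 2 → ℝ)) (e : Fin 2 → Per (1 : Fin 2 → ℝ)) :
    (D.thermostat f e).dη = (D.conformal u).dω +
      ∑ i, d i (flux D.coef (fun i => -(D.a * D.c * e i)) u i) := by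
  simp only [dη, dω, thermostat, conformal_ω₀, conformal_ω₁, flux, Fin.sum_univ_two,
    Matrix.cons_val_zero, Matrix.cons_val_one, map_add, map_sub, map_neg]
  ring

variable {D} {m : Metric}

theorem Represents.conformal (h : D.Represents m) (U : T2 → ℝ) (hU : Smooth U) :
    (D.conformal (lift U hU)).Represents (m.conformal U hU) := fun x => by
  have h1 : Real.exp (-2 * U (proj x)) = Real.exp (-U (proj x)) ^ 2 := by
    rw [← Real.exp_nat_mul]; congr 1; push_cast; ring
  change Real.exp (-2 * U (proj x)) • m.g (proj x) = _
  rw [h x, h1]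
  simp only [Coords.conformal, Per.mul_apply, comp_apply, Per.neg_apply, lift_apply]
  ext i j
  fin_cases i <;> fin_cases j <;> simp <;> ring

/-- The divergence on the torus in terms of the flux on the universal covering. -/
theorem Represents.div_eq (h : D.Represents m) (U : T2 → ℝ) (hU : Smooth U) (e : T2 → Fin 2 → ℝ)
    (he : ∀ i, Smooth (fun p => e p i)) (x : Fin 2 → ℝ) :
    m.div (fun q => e q + m.grad U q) (proj x) = 1 / (D.a x * D.c x) *
      (∑ i, d i (flux D.coef (fun i => -(D.a * D.c * lift (fun p => e p i) (he i)))
        (lift U hU) i)) x := by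
  have key : ∀ i y, √(m.g (proj y)).det * (e (proj y) + m.grad U (proj y)) i =
      flux D.coef (fun i => -(D.a * D.c * lift (fun p => e p i) (he i))) (lift U hU) i y := by
    intro i y
    have ha := (D.a_pos y).ne'
    have hc := (D.c_pos y).ne'
    rw [h.sqrt_det, Pi.add_apply, Metric.grad, h.inv]
    simp only [pd_proj _ U hU, flux, coef, Fin.sum_univ_two, Per.sub_apply, Per.add_apply,
      Per.mul_apply, Per.neg_apply, lift_apply (fun p => e p i)]
    fin_cases i
    · simp [ia'_apply, ic'_apply]
      field_simp
      ring
    · simp [ic'_apply]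
      field_simp
      ring
  rw [Metric.div, h.sqrt_det, Per.sum_apply]
  congr 1
  exact Finset.sum_congr rfl fun i _ =>
    pd_eq (h := fun q => √(m.g q).det * (e q + m.grad U q) i) (key i) i x

end Coords

/-- The coordinates of a thermostat given by a Riemannian metric, a function and a vector field. -/
def OrientedTorus.coords (M : OrientedTorus) (f : T2 → ℝ) (hf : Smooth f) (e : T2 → Fin 2 → ℝ)
    (he : ∀ i, Smooth (fun p => e p i)) : Coords :=
  M.frame.thermostat (((M.sign : ℤ) : ℝ) • lift f hf) fun i => lift (fun p => e p i) (he i)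

theorem OrientedTorus.describes_coords (M : OrientedTorus) (f : T2 → ℝ) (hf : Smooth f)
    (e : T2 → Fin 2 → ℝ) (he : ∀ i, Smooth (fun p => e p i)) :
    (M.coords f hf e he).Describes M f e where
  metric := M.represents_frame
  f_eq := fun _ => rfl
  η₀_eq := fun _ => rfl
  η₁_eq := fun _ => rfl

end

end

end Thermostat

theorem theoremA (M : Thermostat.OrientedTorus)
    (f : Thermostat.T2 → ℝ) (hf : Thermostat.Smooth f)
    (e : Thermostat.T2 → Fin 2 → ℝ) (he : ∀ i, Thermostat.Smooth (fun p => e p i)) :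
    M.NoConjugatePoints f e ↔
      ((∀ p, f p = 0) ∧
        ∃ (U : Thermostat.T2 → ℝ) (hU : Thermostat.Smooth U),
          (∀ p, M.div (fun q => e q + M.grad U q) p = 0) ∧ (M.conformal U hU).IsFlat) := by
  open Thermostat in
  set D := M.coords f hf e he with hD_def
  have hD : D.Describes M f e := M.describes_coords f hf e he
  have hsg : ((M.sign : ℤ) : ℝ) ≠ 0 := by exact_mod_cast M.sign.ne_zero
  rw [hD.noConjugatePoints_iff]
  constructor
  · intro hY
    refine ⟨fun p => ?_, ?_⟩
    · obtain ⟨x, rfl⟩ := proj_surjective p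
      have h1 := hD.f_eq x
      rw [Coords.f_eq_zero hY] at h1
      exact (mul_eq_zero.1 h1.symm).resolve_left hsg
    · obtain ⟨κ, hκ, hell⟩ := M.frame.exists_elliptic
      obtain ⟨u, hu⟩ := exists_div_flux_eq_zero hκ hell
        fun i => -(M.frame.a * M.frame.c * lift (fun p => e p i) (he i))
      have hU := smooth_descend u
      have hlift : lift (descend u) hU = u := Per.ext (descend_proj u)
      refine ⟨descend u, hU, fun p => ?_, ?_⟩
      · obtain ⟨x, rfl⟩ := proj_surjective p
        rw [M.represents_frame.div_eq (descend u) hU e he, hlift, hu, Per.zero_apply, mul_zero]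
      · rw [(M.represents_frame.conformal (descend u) hU).isFlat_iff, hlift]
        have h1 := Coords.dη_eq_zero hY
        rw [hD_def, OrientedTorus.coords, Coords.dη_thermostat _ _ u, hu, add_zero] at h1
        exact h1
  · rintro ⟨hf0, U, hU, hdiv, hflat⟩ t ht z
    refine (D.Y_pos ?_ ?_ ht z).ne'
    · refine Per.ext fun x => ?_
      rw [hD.f_eq, hf0, mul_zero, Per.zero_apply]
    · rw [hD_def, OrientedTorus.coords, Coords.dη_thermostat _ _ (lift U hU),
        (M.represents_frame.conformal U hU).isFlat_iff.1 hflat, zero_add]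
      refine Per.ext fun x => ?_
      have h1 := hdiv (proj x)
      rw [M.represents_frame.div_eq U hU e he] at h1
      exact (mul_eq_zero.1 h1).resolve_left
        (one_div_ne_zero (mul_pos (M.frame.a_pos x) (M.frame.c_pos x)).ne')
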